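/- Let $d,n,m\ge 1$ be integers and $\delta>0$. Write points of $\mathbb R^{d+1}=\mathbb R\times\mathbb R^d$ as $X=(t,x)$, let $D^\alpha=D_1^{\alpha_1}\cdots D_d^{\alpha_d}$ denote spatial (weak) derivatives, and put $$|D^ku|^2=\sum_{|\alpha|=k}|D^\alpha u|^2,\qquad Q_r(t,x)=(t-r^{2m},t)\times B_r(x),\qquad (g)_{Q}=\frac1{|Q|}\int_{Q} g\,dx\,dt .$$ For $|\alpha|=|\beta|=m$ let $A^{\alpha\beta}=A^{\alpha\beta}(t)$ be measurable complex $n\times n$ matrix-valued functions of $t\in\mathbb R$ alone with $|A^{\alpha\beta}|\le\delta^{-1}$, satisfying the Legendre–Hadamard condition $$\operatorname{Re}\Big(\sum_{|\alpha|=|\beta|=m}\theta^{\mathrm{tr}}\xi^\alpha\xi^\beta A^{\alpha\beta}(t)\bar\theta\Big)\ge\delta|\xi|^{2m}|\theta|^2\qquad\text{for all }t\in\mathbb R,\ \xi\in\mathbb R^d,\ \theta\in\mathbb C^n,$$ and set $\mathcal L_0u=\sum_{|\alpha|=|\beta|=m}D^\alpha(A^{\alpha\beta}D^\beta u)$. Let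 $\mathcal H^m_{2,\mathrm{loc}}(\mathbb R^{d+1})$ be the space of functions $u:\mathbb R^{d+1}\to\mathbb C^n$ with $D^\alpha u\in L_{2,\mathrm{loc}}(\mathbb R^{d+1})$ for $|\alpha|\le m$ and such that on every bounded cylinder $(-R,R)\times B_R(0)$ one has, in the sense of distributions, $u_t=\sum_{|\alpha|\le m}D^\alpha g_\alpha$ for some $g_\alpha\in L_2((-R,R)\times B_R(0))$. **Theorem.** There is a constant $N=N(d,n,m,\delta)>0$ such that the following holds for all such coefficients. Let $r\in(0,\infty)$, $\kappa\in[8,\infty)$, $\lambda>0$, $X_0\in\mathbb R^{d+1}$, and let $f_\alpha\in L_{2,\mathrm{loc}}(\mathbb R^{d+1})$, $|\alpha|\le m$, be $\mathbb C^n$-valued. Suppose that $u\in\mathcal H^m_{2,\mathrm{loc}}(\mathbb R^{d+1})$ satisfies, in the weak (distributional) sense, $$u_t+(-1)^m\mathcal L_0u+\lambda u=\sum_{|\alpha|\le m}D^\alpha f_\alpha\qquad\text{in }Q_{\kappa r}(X_0).$$ Then for every $\alpha$ with $|\alpha|=m$, $$\big(|D^\alpha u-(D^\alpha u)_{Q_r(X_0)}|\big)_{Q_r(X_0)}+\lambda^{\frac12}\big(|u-(u)_{Q_r(X_0)}|\big)_{Q_r(X_0)}$$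 $$\le N\kappa^{-1}\sum_{k=0}^m\lambda^{\frac12-\frac k{2m}}\big(|D^ku|^2\big)_{Q_{\kappa r}(X_0)}^{\frac12}+N\kappa^{m+\frac d2}\sum_{|\beta|\le m}\lambda^{\frac{|\beta|}{2m}-\frac12}\big(|f_\beta|^2\big)_{Q_{\kappa r}(X_0)}^{\frac12}.$$ -/

import Mathlib

open MeasureTheory
open scoped ContDiff

namespace ParabolicSystem

noncomputable section

/-- The space variable `x ∈ ℝ^d`, with its Euclidean norm. -/
abbrev Space (d : ℕ) := EuclideanSpace ℝ (Fin d)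

/-- Space-time `ℝ^{d+1} = ℝ × ℝ^d`, with points `X = (t, x)`; its `volume` is Lebesgue measure. -/
abbrev SpaceTime (d : ℕ) := ℝ × Space d

/-- The values `ℂ^n` of the unknown, with their Hermitian norm. -/
abbrev Val (n : ℕ) := EuclideanSpace ℂ (Fin n)

/-- Multi-indices `α = (α₁, …, α_d)`. -/
abbrev MultiIndex (d : ℕ) := Fin d → ℕ

/-- The order `|α| = α₁ + ⋯ + α_d`. -/
def order {d : ℕ} (α : MultiIndex d) : ℕ := ∑ i, α i

/-- The finite set of all multi-indices of order exactly `k`. -/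
def ofOrder (d k : ℕ) : Finset (MultiIndex d) := Finset.piAntidiag Finset.univ k

theorem mem_ofOrder {d k : ℕ} {α : MultiIndex d} : α ∈ ofOrder d k ↔ order α = k := by
  simp [ofOrder, order]

/-- The finite set of all multi-indices of order at most `m`. -/
def ofOrderLE (d m : ℕ) : Finset (MultiIndex d) := (Finset.range (m + 1)).biUnion (ofOrder d)

theorem mem_ofOrderLE {d m : ℕ} {α : MultiIndex d} : α ∈ ofOrderLE d m ↔ order α ≤ m := by
  simp [ofOrderLE, mem_ofOrder]

/-- The monomial `ξ^α = ξ₁^{α₁} ⋯ ξ_d^{α_d}`. -/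
def monomial {d : ℕ} (ξ : Space d) (α : MultiIndex d) : ℝ := ∏ i, ξ i ^ α i

/-- The parabolic cylinder `Q_r(t, x) = (t - r^{2m}, t) × B_r(x)`. -/
def Q {d : ℕ} (m : ℕ) (r : ℝ) (X : SpaceTime d) : Set (SpaceTime d) :=
  Set.Ioo (X.1 - r ^ (2 * m)) X.1 ×ˢ Metric.ball X.2 r

/-! ### Classical derivatives of test functions -/

/-- The time derivative `φ_t`. -/
def timeDeriv {d : ℕ} (φ : SpaceTime d → ℝ) : SpaceTime d → ℝ :=
  fun X => fderiv ℝ φ X (1, 0)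

/-- The spatial partial derivative `D_i φ`. -/
def spaceDeriv {d : ℕ} (i : Fin d) (φ : SpaceTime d → ℝ) : SpaceTime d → ℝ :=
  fun X => fderiv ℝ φ X (0, EuclideanSpace.single i 1)

/-- The spatial derivative `D^α φ = D₁^{α₁} ⋯ D_d^{α_d} φ`. -/
def multiDeriv {d : ℕ} (α : MultiIndex d) (φ : SpaceTime d → ℝ) : SpaceTime d → ℝ :=
  (List.finRange d).foldr (fun i g => (spaceDeriv i)^[α i] g) φ

/-- `φ ∈ C₀^∞(U)`. Real scalar test functions are used throughout, and identities are between
`ℂ^n`-valued integrals; taking components and linear combinations gives the same identities for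
`ℂ^n`-valued test functions. -/
structure IsTestFunction {d : ℕ} (U : Set (SpaceTime d)) (φ : SpaceTime d → ℝ) : Prop where
  smooth : ContDiff ℝ ∞ φ
  compact : HasCompactSupport φ
  supp : tsupport φ ⊆ U

/-! ### Weak derivatives and function spaces -/

/-- `g ∈ L_{2,loc}(ℝ^{d+1})`. -/
def MemL2Loc {d n : ℕ} (g : SpaceTime d → Val n) : Prop :=
  ∀ K : Set (SpaceTime d), IsCompact K → MemLp g 2 (volume.restrict K)

/-- `g` is the weak (distributional) spatial derivative `D^α u` on `ℝ^{d+1}`. -/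
structure HasWeakDeriv {d n : ℕ} (α : MultiIndex d) (u g : SpaceTime d → Val n) : Prop where
  locallyIntegrable_left : LocallyIntegrable u
  locallyIntegrable_right : LocallyIntegrable g
  integral_eq : ∀ φ : SpaceTime d → ℝ, IsTestFunction Set.univ φ →
    ∫ X, multiDeriv α φ X • u X = (-1 : ℝ) ^ order α • ∫ X, φ X • g X

open Classical in
/-- The weak derivative `D^α u`, a representative of the almost everywhere unique function with
this property (and `0` if there is none). -/
def weakDeriv {d n : ℕ} (α : MultiIndex d) (u : SpaceTime d → Val n) : SpaceTime d → Val n :=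
  if h : ∃ g, HasWeakDeriv α u g then h.choose else 0

theorem hasWeakDeriv_weakDeriv {d n : ℕ} {α : MultiIndex d} {u : SpaceTime d → Val n}
    (h : ∃ g, HasWeakDeriv α u g) : HasWeakDeriv α u (weakDeriv α u) := by
  rw [weakDeriv, dif_pos h]
  exact h.choose_spec

/-- The size `|D^k u|² = ∑_{|α| = k} |D^α u|²` of the collection of all spatial derivatives of
order `k`. -/
def sqNormDeriv {d n : ℕ} (k : ℕ) (u : SpaceTime d → Val n) (X : SpaceTime d) : ℝ :=
  ∑ α ∈ ofOrder d k, ‖weakDeriv α u X‖ ^ 2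

/-- `u_t ∈ ℍ₂^{-m}(U)`: in the sense of distributions on `U`, `u_t = ∑_{|α| ≤ m} D^α g_α` for some
`g_α ∈ L₂(U)`. -/
def TimeDerivMemDual {d n : ℕ} (m : ℕ) (U : Set (SpaceTime d)) (u : SpaceTime d → Val n) : Prop :=
  ∃ g : MultiIndex d → SpaceTime d → Val n,
    (∀ α ∈ ofOrderLE d m, MemLp (g α) 2 (volume.restrict U)) ∧
    ∀ φ : SpaceTime d → ℝ, IsTestFunction U φ →
      ∫ X in U, (-timeDeriv φ X) • u X =
        ∫ X in U, ∑ α ∈ ofOrderLE d m, ((-1 : ℝ) ^ order α * multiDeriv α φ X) • g α X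

/-- `u ∈ 𝓗^m_{2,loc}(ℝ^{d+1})`: the derivatives `D^α u`, `|α| ≤ m`, exist and belong to `L_{2,loc}`,
and `u_t ∈ ℍ₂^{-m}` on each bounded cylinder `(-R, R) × B_R`. -/
structure MemHLoc {d n : ℕ} (m : ℕ) (u : SpaceTime d → Val n) : Prop where
  space : ∀ α ∈ ofOrderLE d m, ∃ g, HasWeakDeriv α u g ∧ MemL2Loc g
  time : ∀ R : ℝ, 0 < R → TimeDerivMemDual m (Set.Ioo (-R) R ×ˢ Metric.ball 0 R) u

/-! ### The system -/

/-- The leading coefficients `A^{αβ}(t)`, `|α| = |β| = m`, are measurable functions of `t` alone,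
bounded by `δ⁻¹`, and satisfy the Legendre-Hadamard condition with constant `δ`. The bound is
imposed on the entries, so it holds if `|A^{αβ}| ≤ δ⁻¹` in the operator or the Frobenius norm. -/
structure IsLegendreHadamard {d n : ℕ} (m : ℕ) (δ : ℝ)
    (A : MultiIndex d → MultiIndex d → ℝ → Matrix (Fin n) (Fin n) ℂ) : Prop where
  measurable : ∀ α ∈ ofOrder d m, ∀ β ∈ ofOrder d m, ∀ i j, Measurable fun t => A α β t i j
  bound : ∀ α ∈ ofOrder d m, ∀ β ∈ ofOrder d m, ∀ i j t, ‖A α β t i j‖ ≤ δ⁻¹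
  elliptic : ∀ (t : ℝ) (ξ : Space d) (θ : Val n),
    δ * ‖ξ‖ ^ (2 * m) * ‖θ‖ ^ 2 ≤
      (∑ α ∈ ofOrder d m, ∑ β ∈ ofOrder d m, ∑ i, ∑ j,
        θ i * (monomial ξ α * monomial ξ β : ℝ) * A α β t i j * (starRingEnd ℂ) (θ j)).re

/-- The matrix-vector product `A v` in `ℂ^n`. -/
def matVec {n : ℕ} (A : Matrix (Fin n) (Fin n) ℂ) (v : Val n) : Val n :=
  WithLp.toLp 2 (A.mulVec v.ofLp)

/-- `u` is a weak solution of
`u_t + (-1)^m ∑_{|α| = |β| = m} D^α (A^{αβ}(t) D^β u) + λ u = ∑_{|α| ≤ m} D^α f_α` in `U`. -/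
def IsWeakSolution {d n : ℕ} (m : ℕ)
    (A : MultiIndex d → MultiIndex d → ℝ → Matrix (Fin n) (Fin n) ℂ) (lam : ℝ)
    (f : MultiIndex d → SpaceTime d → Val n) (U : Set (SpaceTime d))
    (u : SpaceTime d → Val n) : Prop :=
  ∀ φ : SpaceTime d → ℝ, IsTestFunction U φ →
    ∫ X in U, ((-timeDeriv φ X) • u X
        + (∑ α ∈ ofOrder d m, ∑ β ∈ ofOrder d m,
            ((-1 : ℝ) ^ (m + order α) * multiDeriv α φ X) • matVec (A α β X.1) (weakDeriv β u X))
        + (lam * φ X) • u X) =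
      ∫ X in U, ∑ α ∈ ofOrderLE d m, ((-1 : ℝ) ^ order α * multiDeriv α φ X) • f α X

/-- The mean oscillation `(|g - (g)_D|)_D`. -/
def meanOsc {d n : ℕ} (D : Set (SpaceTime d)) (g : SpaceTime d → Val n) : ℝ :=
  ⨍ X in D, ‖g X - ⨍ Y in D, g Y‖

end

end ParabolicSystem

open ParabolicSystem

open ParabolicSystem

/-! The proof splits `u` in the large cylinder into a part driven by the data and a part solving the
homogeneous system.

Let `v` be the solution on all of space-time whose data are the `f_β` cut off to the large cylinder.
Gårding's inequality (Legendre-Hadamard plus Plancherel in `x`), interpolation of intermediate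
derivatives and a Lax-Milgram argument of Lions type give `v` together with its energy estimate
(`exists_inner_eq_of_coercive`, `exists_global_solution`). Only the `L₂` norms of `v` and `D^α v`
are needed. Passing from the large cylinder to the small one costs the square root of the volume
ratio, which is `κ^(m + d/2)`.

The difference `w = u - v` solves the homogeneous system in the large cylinder. Since the
coefficients do not depend on `x`, so does each `D^α w`, in the sense of distributions
(`exists_decomposition`). For `W = w` or `W = D^α w` it remains to show that the mean oscillation
over the small cylinder is at most `C κ⁻¹` times the `L₂` mean of `W` over the large one, with `C`
independent of `λ` (`exists_meanOsc_le`). After parabolic scaling the large cylinder is `Q_1`.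

Interior regularity is obtained on the Fourier side. Cut `W` off by a smooth `ζ` and take the
Fourier transform in `x` only. For fixed `ξ` this gives an ordinary differential equation `y' = F -
G` in `t`, starting from zero, where `G` is the symbol applied to `y` and is coercive with constant
`μ = δ|2πξ|^(2m) + λ`. The commutator `F` consists of terms of degree at most `2m - 1` in `ξ` times
Fourier transforms of other cutoffs of `W`. The estimate `(1 + μ)‖y‖ ≲ ‖F‖` in `L₂` of time
(`energy_estimate`) therefore gains one power of `1 + |ξ|`. Iterating over all cutoffs at once gives
decay of every order (`HasFourierDecay.exists_primitive`, `hasFourierDecay`). The same equation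
bounds `y` uniformly and Hölder continuously with exponent 1/2 in time. As `λ` enters only through
`μ`, no constant depends on it.

Fourier inversion then makes `W` Lipschitz in `x` and Hölder 1/2 in `t` near the origin
(`norm_sub_integral_le`). On `Q_ρ` the time differences are at most `ρ^(2m)`, so `W` differs from a
constant by `O(ρ)`, and `ρ = κ⁻¹` yields the decay in `κ`. -/

namespace ParabolicSystem

noncomputable section

/-! ### Iterated directional derivatives -/

section Derivatives

variable {E F G : Type*} [NormedAddCommGroup E] [NormedSpace ℝ E] [NormedAddCommGroup F]
  [NormedSpace ℝ F] [NormedAddCommGroup G] [NormedSpace ℝ G]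

/-- The derivative of `φ` in direction `v`. -/
def dirDeriv (v : E) (φ : E → F) : E → F := fun X => fderiv ℝ φ X v

/-- The iterated derivative of `φ` in the directions of the list `l`. -/
def listDeriv (l : List E) (φ : E → F) : E → F := l.foldr dirDeriv φ

@[simp] theorem listDeriv_nil (φ : E → F) : listDeriv [] φ = φ := rfl

@[simp] theorem listDeriv_cons (v : E) (l : List E) (φ : E → F) :
    listDeriv (v :: l) φ = dirDeriv v (listDeriv l φ) := rfl

theorem listDeriv_append (l l' : List E) (φ : E → F) :
    listDeriv (l ++ l') φ = listDeriv l (listDeriv l' φ) := List.foldr_append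

theorem contDiff_dirDeriv {φ : E → F} (h : ContDiff ℝ ∞ φ) (v : E) :
    ContDiff ℝ ∞ (dirDeriv v φ) := by
  have h1 : ContDiff ℝ ∞ (fderiv ℝ φ) := h.fderiv_right (by norm_cast)
  exact h1.clm_apply contDiff_const

theorem contDiff_listDeriv {φ : E → F} (h : ContDiff ℝ ∞ φ) (l : List E) :
    ContDiff ℝ ∞ (listDeriv l φ) := by
  induction l with
  | nil => exact h
  | cons v l ih => exact contDiff_dirDeriv ih v

theorem tsupport_dirDeriv_subset (v : E) (φ : E → F) :
    tsupport (dirDeriv v φ) ⊆ tsupport φ := tsupport_fderiv_apply_subset ℝ v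

theorem tsupport_listDeriv_subset (l : List E) (φ : E → F) :
    tsupport (listDeriv l φ) ⊆ tsupport φ := by
  induction l with
  | nil => exact subset_rfl
  | cons v l ih => exact (tsupport_dirDeriv_subset v _).trans ih

theorem hasCompactSupport_listDeriv {φ : E → F} (h : HasCompactSupport φ) (l : List E) :
    HasCompactSupport (listDeriv l φ) :=
  h.of_isClosed_subset (isClosed_tsupport _) (tsupport_listDeriv_subset l φ)

theorem hasCompactSupport_dirDeriv {φ : E → F} (h : HasCompactSupport φ) (v : E) :
    HasCompactSupport (dirDeriv v φ) :=
  h.of_isClosed_subset (isClosed_tsupport _) (tsupport_dirDeriv_subset v φ)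

theorem dirDeriv_comm {φ : E → F} (h : ContDiff ℝ ∞ φ) (v w : E) :
    dirDeriv v (dirDeriv w φ) = dirDeriv w (dirDeriv v φ) := by
  have h1 : ContDiff ℝ ∞ (fderiv ℝ φ) := h.fderiv_right (by norm_cast)
  have key (a b : E) (X : E) :
      dirDeriv a (dirDeriv b φ) X = fderiv ℝ (fderiv ℝ φ) X a b := by
    unfold dirDeriv
    rw [fderiv_clm_apply ((h1.differentiable (by simp)) X) (differentiableAt_const b)]
    simp
  funext X
  rw [key, key]
  have := (h.contDiffAt (x := X)).isSymmSndFDerivAt (by simp; norm_cast)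
  exact this v w

theorem dirDeriv_listDeriv_comm {φ : E → F} (h : ContDiff ℝ ∞ φ) (v : E) (l : List E) :
    dirDeriv v (listDeriv l φ) = listDeriv l (dirDeriv v φ) := by
  induction l with
  | nil => rfl
  | cons w l ih =>
    rw [listDeriv_cons, listDeriv_cons, ← ih, dirDeriv_comm (contDiff_listDeriv h l)]

theorem listDeriv_comm {φ : E → F} (h : ContDiff ℝ ∞ φ) (l l' : List E) :
    listDeriv l (listDeriv l' φ) = listDeriv l' (listDeriv l φ) := by
  induction l with
  | nil => rfl
  | cons w l ih =>
    rw [listDeriv_cons, listDeriv_cons, ih, dirDeriv_listDeriv_comm (contDiff_listDeriv h l)]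

theorem dirDeriv_clm_comp {φ : E → F} (h : ContDiff ℝ ∞ φ) (L : F →L[ℝ] G) (v : E) :
    dirDeriv v (fun X => L (φ X)) = fun X => L (dirDeriv v φ X) := by
  funext X
  unfold dirDeriv
  have := (L.hasFDerivAt (x := φ X)).comp X ((h.differentiable (by simp)) X).hasFDerivAt
  rw [show (fun X => L (φ X)) = L ∘ φ from rfl, this.fderiv]
  rfl

theorem listDeriv_clm_comp {φ : E → F} (h : ContDiff ℝ ∞ φ) (L : F →L[ℝ] G) (l : List E) :
    listDeriv l (fun X => L (φ X)) = fun X => L (listDeriv l φ X) := by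
  induction l with
  | nil => rfl
  | cons v l ih =>
    rw [listDeriv_cons, ih, dirDeriv_clm_comp (contDiff_listDeriv h l)]; rfl

theorem dirDeriv_add {φ ψ : E → F} (h : ContDiff ℝ ∞ φ) (h' : ContDiff ℝ ∞ ψ) (v : E) :
    dirDeriv v (φ + ψ) = dirDeriv v φ + dirDeriv v ψ := by
  funext X
  simp only [dirDeriv, Pi.add_apply]
  rw [fderiv_add ((h.differentiable (by simp)) X) ((h'.differentiable (by simp)) X)]
  rfl

theorem listDeriv_add {φ ψ : E → F} (h : ContDiff ℝ ∞ φ) (h' : ContDiff ℝ ∞ ψ) (l : List E) :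
    listDeriv l (φ + ψ) = listDeriv l φ + listDeriv l ψ := by
  induction l with
  | nil => rfl
  | cons v l ih =>
    rw [listDeriv_cons, ih, dirDeriv_add (contDiff_listDeriv h l) (contDiff_listDeriv h' l)]; rfl

/-- Derivatives of `φ ∘ T` for an affine map `T` with linear part `L`. -/
theorem dirDeriv_comp_affine {φ : F → G} (h : ContDiff ℝ ∞ φ) {T : E → F} {L : E →L[ℝ] F}
    (hT : ∀ X, HasFDerivAt T L X) (v : E) :
    dirDeriv v (fun X => φ (T X)) = fun X => dirDeriv (L v) φ (T X) := by
  funext X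
  have := (((h.differentiable (by simp)) (T X)).hasFDerivAt).comp X (hT X)
  simp only [dirDeriv]
  rw [show (fun X => φ (T X)) = φ ∘ T from rfl, this.fderiv]
  rfl

theorem listDeriv_comp_affine {φ : F → G} (h : ContDiff ℝ ∞ φ) {T : E → F} {L : E →L[ℝ] F}
    (hT : ∀ X, HasFDerivAt T L X) (l : List E) :
    listDeriv l (fun X => φ (T X)) = fun X => listDeriv (l.map L) φ (T X) := by
  induction l with
  | nil => rfl
  | cons v l ih =>
    rw [listDeriv_cons, ih, dirDeriv_comp_affine (contDiff_listDeriv h _) hT]; rfl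

theorem listDeriv_smul_dir (c : ℝ) {φ : E → F} (h : ContDiff ℝ ∞ φ) (l : List E) :
    listDeriv (l.map (c • ·)) φ = fun X => c ^ l.length • listDeriv l φ X := by
  induction l with
  | nil => simp
  | cons v l ih =>
    rw [List.map_cons, listDeriv_cons, ih]
    have := dirDeriv_clm_comp (contDiff_listDeriv h l)
      ((c ^ l.length) • ContinuousLinearMap.id ℝ F) (c • v)
    simp only [smul_apply, ContinuousLinearMap.id_apply] at this
    rw [this]
    funext X
    simp only [dirDeriv, map_smul, listDeriv_cons, List.length_cons]
    rw [smul_smul, pow_succ]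

end Derivatives

/-! ### Spatial derivatives -/

variable {d n m : ℕ}

/-- The unit vector in the `i`-th space direction. -/
def spaceVec (i : Fin d) : SpaceTime d := (0, EuclideanSpace.single i 1)

/-- The unit vector in the time direction. -/
def timeVec : SpaceTime d := (1, 0)

/-- The list of coordinates in which `D^α` differentiates. -/
def MultiIndex.toList (α : MultiIndex d) : List (Fin d) :=
  (List.finRange d).flatMap fun i => List.replicate (α i) i

theorem MultiIndex.length_toList (α : MultiIndex d) : α.toList.length = order α := by
  simp [MultiIndex.toList, List.length_flatMap, order, ← List.ofFn_eq_map, List.sum_ofFn]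

/-- Symbols computed one derivative at a time come out as products over a list; this turns them back
into monomials. -/
theorem MultiIndex.prod_toList {M : Type*} [CommMonoid M] (α : MultiIndex d) (g : Fin d → M) :
    (α.toList.map g).prod = ∏ i, g i ^ α i := by
  have h (L : List (Fin d)) : ((L.flatMap fun i => List.replicate (α i) i).map g).prod =
      (L.map fun i => g i ^ α i).prod := by
    induction L with
    | nil => rfl
    | cons i L ih => simp [ih]
  rw [MultiIndex.toList, h, ← List.ofFn_eq_map, List.prod_ofFn]

/-- The spatial derivative `D^α` of a vector-valued function. -/
def spaceDerivs {F : Type*} [NormedAddCommGroup F] [NormedSpace ℝ F] (α : MultiIndex d)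
    (φ : SpaceTime d → F) : SpaceTime d → F :=
  listDeriv (α.toList.map spaceVec) φ

theorem multiDeriv_eq_spaceDerivs (α : MultiIndex d) (φ : SpaceTime d → ℝ) :
    multiDeriv α φ = spaceDerivs α φ := by
  have h (L : List (Fin d)) :
      L.foldr (fun i g => (spaceDeriv i)^[α i] g) φ =
        listDeriv ((L.flatMap fun i => List.replicate (α i) i).map spaceVec) φ := by
    induction L with
    | nil => rfl
    | cons i L ih =>
      simp only [List.foldr_cons, ih, List.flatMap_cons, List.map_append, List.map_replicate,
        listDeriv_append]
      generalize listDeriv _ φ = g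
      induction α i with
      | zero => rfl
      | succ k ih =>
        rw [Function.iterate_succ', Function.comp, ih, List.replicate_succ, listDeriv_cons]
        rfl
  exact h _

theorem timeDeriv_eq_dirDeriv (φ : SpaceTime d → ℝ) : timeDeriv φ = dirDeriv timeVec φ := rfl

theorem spaceDerivs_zero {F : Type*} [NormedAddCommGroup F] [NormedSpace ℝ F]
    (φ : SpaceTime d → F) : spaceDerivs 0 φ = φ := by
  have : MultiIndex.toList (0 : MultiIndex d) = [] :=
    List.length_eq_zero_iff.mp (by simp [MultiIndex.length_toList, order])
  simp [spaceDerivs, this]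

section SpaceDerivs

variable {F G : Type*} [NormedAddCommGroup F] [NormedSpace ℝ F] [NormedAddCommGroup G]
  [NormedSpace ℝ G]

theorem contDiff_spaceDerivs {φ : SpaceTime d → F} (h : ContDiff ℝ ∞ φ) (α : MultiIndex d) :
    ContDiff ℝ ∞ (spaceDerivs α φ) := contDiff_listDeriv h _

theorem hasCompactSupport_spaceDerivs {φ : SpaceTime d → F} (h : HasCompactSupport φ)
    (α : MultiIndex d) : HasCompactSupport (spaceDerivs α φ) := hasCompactSupport_listDeriv h _

theorem spaceDerivs_comm {φ : SpaceTime d → F} (h : ContDiff ℝ ∞ φ) (α β : MultiIndex d) :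
    spaceDerivs α (spaceDerivs β φ) = spaceDerivs β (spaceDerivs α φ) := listDeriv_comm h _ _

theorem dirDeriv_spaceDerivs_comm {φ : SpaceTime d → F} (h : ContDiff ℝ ∞ φ) (v : SpaceTime d)
    (α : MultiIndex d) :
    dirDeriv v (spaceDerivs α φ) = spaceDerivs α (dirDeriv v φ) := dirDeriv_listDeriv_comm h _ _

theorem spaceDerivs_clm_comp {φ : SpaceTime d → F} (h : ContDiff ℝ ∞ φ) (L : F →L[ℝ] G)
    (α : MultiIndex d) :
    spaceDerivs α (fun X => L (φ X)) = fun X => L (spaceDerivs α φ X) :=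
  listDeriv_clm_comp h L _

/-- Functions of time alone pass through spatial derivatives. -/
theorem spaceDerivs_time_smul {φ : SpaceTime d → F} (h : ContDiff ℝ ∞ φ) {η : ℝ → ℝ}
    (hη : ContDiff ℝ ∞ η) (α : MultiIndex d) :
    spaceDerivs α (fun X => η X.1 • φ X) = fun X => η X.1 • spaceDerivs α φ X := by
  unfold spaceDerivs
  generalize α.toList = l
  induction l with
  | nil => rfl
  | cons i l ih =>
    rw [List.map_cons, listDeriv_cons, ih]
    funext X
    have h1 : HasFDerivAt (fun X : SpaceTime d => η X.1)
        (((fderiv ℝ η X.1)).comp (ContinuousLinearMap.fst ℝ ℝ (Space d))) X :=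
      ((hη.differentiable (by simp)) X.1).hasFDerivAt.comp X hasFDerivAt_fst
    have h2 := ((contDiff_listDeriv h (l.map spaceVec)).differentiable (by simp) X).hasFDerivAt
    have := h1.fun_smul h2
    simp only [dirDeriv]
    rw [this.fderiv]
    simp [spaceVec, dirDeriv]

theorem IsTestFunction.dirDeriv {U : Set (SpaceTime d)} {φ : SpaceTime d → ℝ}
    (h : IsTestFunction U φ) (v : SpaceTime d) : IsTestFunction U (dirDeriv v φ) :=
  ⟨contDiff_dirDeriv h.1 v, hasCompactSupport_dirDeriv h.2 v,
    (tsupport_dirDeriv_subset v φ).trans h.3⟩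

theorem IsTestFunction.spaceDerivs {U : Set (SpaceTime d)} {φ : SpaceTime d → ℝ}
    (h : IsTestFunction U φ) (α : MultiIndex d) : IsTestFunction U (spaceDerivs α φ) :=
  ⟨contDiff_spaceDerivs h.1 α, hasCompactSupport_spaceDerivs h.2 α,
    (tsupport_listDeriv_subset _ φ).trans h.3⟩

end SpaceDerivs

end

end ParabolicSystem

/-! ### Gårding's inequality on time slices, by Plancherel. -/

namespace ParabolicSystem

noncomputable section

open scoped FourierTransform InnerProductSpace LineDeriv SchwartzMap

variable {d n m : ℕ}

/-! ### The symbol of the system -/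

/-- The symbol `∑ ξ^α ξ^β ⟪w, A^{αβ} w⟫`. -/
theorem IsLegendreHadamard.le_re_sum_inner {δ : ℝ}
    {A : MultiIndex d → MultiIndex d → ℝ → Matrix (Fin n) (Fin n) ℂ}
    (hA : IsLegendreHadamard m δ A) (t : ℝ) (ξ : Space d) (w : Val n) :
    δ * ‖ξ‖ ^ (2 * m) * ‖w‖ ^ 2 ≤
      (∑ α ∈ ofOrder d m, ∑ β ∈ ofOrder d m,
        ((monomial ξ α * monomial ξ β : ℝ) : ℂ) * ⟪w, matVec (A α β t) w⟫_ℂ).re := by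
  -- The ellipticity condition conjugates the second vector, the inner product the first; testing
  -- with the conjugate of `w` reconciles them.
  have h := hA.elliptic t ξ (WithLp.toLp 2 fun i => (starRingEnd ℂ) (w i))
  have hn : ‖(WithLp.toLp 2 fun i => (starRingEnd ℂ) (w i) : Val n)‖ = ‖w‖ := by
    simp [EuclideanSpace.norm_eq]
  rw [hn] at h
  refine h.trans (le_of_eq ?_)
  congr 1
  refine Finset.sum_congr rfl fun α _ => Finset.sum_congr rfl fun β _ => ?_
  simp only [matVec, EuclideanSpace.inner_eq_star_dotProduct, Matrix.mulVec, dotProduct,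
    Finset.mul_sum, Finset.sum_mul, RingHomCompTriple.comp_apply, RingHom.id_apply, Pi.star_apply,
    RCLike.star_def]
  refine Finset.sum_congr rfl fun i _ => Finset.sum_congr rfl fun j _ => ?_
  ring

theorem monomial_smul (c : ℝ) (ξ : Space d) (α : MultiIndex d) :
    monomial (c • ξ) α = c ^ order α * monomial ξ α := by
  simp [monomial, order, mul_pow, Finset.prod_mul_distrib, Finset.prod_pow_eq_pow_sum]

theorem abs_monomial_le (ξ : Space d) (α : MultiIndex d) : |monomial ξ α| ≤ ‖ξ‖ ^ order α := by
  rw [monomial, Finset.abs_prod, order, ← Finset.prod_pow_eq_pow_sum]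
  refine Finset.prod_le_prod (fun _ _ => abs_nonneg _) fun i _ => ?_
  rw [abs_pow]
  gcongr
  simpa using PiLp.norm_apply_le ξ i

/-- The largest coordinate satisfies `|ξ|² ≤ d ξ_i²`, so the pure power `ξ_i^m` alone controls the
left side. The added 1 keeps the constant positive also for `d = 0`. -/
theorem norm_pow_le_sum_monomial (ξ : Space d) (m : ℕ) :
    ‖ξ‖ ^ (2 * m) ≤ (d ^ m + 1) * ∑ α ∈ ofOrder d m, monomial ξ α ^ 2 := by
  rcases Nat.eq_zero_or_pos m with rfl | hm
  · have h0 : (0 : MultiIndex d) ∈ ofOrder d 0 := by simp [mem_ofOrder, order]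
    have := Finset.single_le_sum (f := fun α => monomial ξ α ^ 2) (fun _ _ => sq_nonneg _) h0
    simp [monomial] at this ⊢
    nlinarith
  rcases Nat.eq_zero_or_pos d with rfl | hd
  · have : ξ = 0 := Subsingleton.elim _ _
    rw [this, norm_zero, zero_pow (by omega)]
    exact mul_nonneg (by positivity) (Finset.sum_nonneg fun _ _ => sq_nonneg _)
  have : Nonempty (Fin d) := ⟨⟨0, hd⟩⟩
  obtain ⟨i, -, hi⟩ := Finset.exists_max_image Finset.univ (fun i => ξ i ^ 2) Finset.univ_nonempty
  have h1 : ‖ξ‖ ^ 2 ≤ d * ξ i ^ 2 := by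
    rw [EuclideanSpace.real_norm_sq_eq]
    calc ∑ j, ξ j ^ 2 ≤ ∑ _j : Fin d, ξ i ^ 2 := Finset.sum_le_sum fun j _ => hi j (by simp)
      _ = _ := by simp
  have h2 : ‖ξ‖ ^ (2 * m) ≤ d ^ m * monomial ξ (Pi.single i m) ^ 2 := by
    rw [pow_mul]
    calc (‖ξ‖ ^ 2) ^ m ≤ (d * ξ i ^ 2) ^ m := by gcongr
      _ = _ := by
        rw [monomial, Finset.prod_eq_single i]
        · simp; ring
        · intro j _ hj; simp [hj]
        · simp
  have h3 := Finset.single_le_sum (s := ofOrder d m) (f := fun α => monomial ξ α ^ 2)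
    (fun _ _ => sq_nonneg _) (a := Pi.single i m) (by simp [mem_ofOrder, order])
  have h4 : (0 : ℝ) ≤ d ^ m := by positivity
  have h5 := Finset.sum_nonneg (s := ofOrder d m) (f := fun α => monomial ξ α ^ 2)
    (fun _ _ => sq_nonneg _)
  nlinarith

/-! ### Plancherel for test functions of the space variable -/

/-- The derivative `D^α` of a function of the space variable. -/
def sliceDerivs {F : Type*} [NormedAddCommGroup F] [NormedSpace ℝ F] (α : MultiIndex d)
    (ψ : Space d → F) : Space d → F :=
  listDeriv (α.toList.map fun i => EuclideanSpace.single i (1 : ℝ)) ψ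

theorem spaceDerivs_slice {F : Type*} [NormedAddCommGroup F] [NormedSpace ℝ F]
    {φ : SpaceTime d → F} (h : ContDiff ℝ ∞ φ) (α : MultiIndex d) (t : ℝ) :
    sliceDerivs α (fun x => φ (t, x)) = fun x => spaceDerivs α φ (t, x) := by
  have := listDeriv_comp_affine (E := Space d) h (T := fun x => (t, x))
    (L := ContinuousLinearMap.inr ℝ ℝ (Space d)) (fun x => hasFDerivAt_prodMk_right t x)
    (α.toList.map fun i => EuclideanSpace.single i (1 : ℝ))
  rw [sliceDerivs, this, List.map_map]
  rfl

variable {H : Type*} [NormedAddCommGroup H] [InnerProductSpace ℂ H]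

theorem fourier_dirDeriv (f : 𝓢(Space d, H)) (v ξ : Space d) :
    𝓕 (dirDeriv v (f : Space d → H)) ξ =
      (2 * Real.pi * Complex.I * (inner ℝ ξ v : ℝ)) • 𝓕 (f : Space d → H) ξ := by
  have h := congrArg (fun g : 𝓢(Space d, H) => g ξ) (SchwartzMap.fourier_lineDerivOp_eq f v)
  have hg : (inner ℝ · v : Space d → ℝ).HasTemperateGrowth :=
    ((innerSL ℝ).flip v).hasTemperateGrowth
  simp only [smul_apply, SchwartzMap.smulLeftCLM_apply_apply hg,
    SchwartzMap.fourier_coe] at h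
  rw [mul_smul]
  refine Eq.trans ?_ (h.trans ?_)
  · rfl
  · congr 1

theorem fourier_listDeriv {ψ : Space d → H} (h : ContDiff ℝ ∞ ψ) (hc : HasCompactSupport ψ)
    (l : List (Fin d)) (ξ : Space d) :
    𝓕 (listDeriv (l.map fun i => EuclideanSpace.single i (1 : ℝ)) ψ) ξ =
      (l.map fun i => (2 * Real.pi * Complex.I * (ξ i : ℂ))).prod • 𝓕 ψ ξ := by
  induction l with
  | nil => simp
  | cons i l ih =>
    have := fourier_dirDeriv ((hasCompactSupport_listDeriv hc
      (l.map fun i => EuclideanSpace.single i (1 : ℝ))).toSchwartzMap (contDiff_listDeriv h _))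
      (EuclideanSpace.single i (1 : ℝ)) ξ
    rw [List.map_cons, listDeriv_cons]
    refine this.trans ?_
    have e : (((hasCompactSupport_listDeriv hc
      (l.map fun i => EuclideanSpace.single i (1 : ℝ))).toSchwartzMap (contDiff_listDeriv h _)
        : 𝓢(Space d, H)) : Space d → H) =
      listDeriv (l.map fun i => EuclideanSpace.single i (1 : ℝ)) ψ := rfl
    rw [e, ih, smul_smul, List.map_cons, List.prod_cons]
    congr 2
    simp [EuclideanSpace.inner_single_right]

theorem fourier_sliceDerivs {ψ : Space d → H} (h : ContDiff ℝ ∞ ψ) (hc : HasCompactSupport ψ)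
    (α : MultiIndex d) (ξ : Space d) :
    𝓕 (sliceDerivs α ψ) ξ =
      (Complex.I ^ order α * (monomial ((2 * Real.pi) • ξ) α : ℝ)) • 𝓕 ψ ξ := by
  rw [sliceDerivs, fourier_listDeriv h hc, MultiIndex.prod_toList, monomial_smul]
  congr 1
  push_cast [monomial]
  simp_rw [mul_pow, Finset.prod_mul_distrib, Finset.prod_pow_eq_pow_sum]
  rw [← order]
  ring

theorem integrable_pow_mul_fourier {ψ : Space d → H} (h : ContDiff ℝ ∞ ψ)
    (hc : HasCompactSupport ψ) (k : ℕ) :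
    Integrable fun ξ => ‖(2 * Real.pi) • ξ‖ ^ k * ‖𝓕 ψ ξ‖ ^ 2 := by
  let f : 𝓢(Space d, H) := hc.toSchwartzMap h
  have h1 := (𝓕 f).integrable_pow_mul volume k
  obtain ⟨C, hC⟩ : ∃ C, ∀ ξ, ‖𝓕 f ξ‖ ≤ C := by
    obtain ⟨C, hC⟩ := (𝓕 f).decay 0 0
    exact ⟨C, fun x => by simpa using hC.2 x⟩
  have h2 : Integrable fun ξ => (‖ξ‖ ^ k * ‖𝓕 f ξ‖) * ‖𝓕 f ξ‖ :=
    h1.mul_bdd (c := C) ((𝓕 f).continuous.norm.aestronglyMeasurable)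
      (Filter.Eventually.of_forall fun x => by simpa using hC x)
  have h3 := h2.const_mul ((2 * Real.pi) ^ k)
  refine h3.congr (Filter.Eventually.of_forall fun ξ => ?_)
  have : 𝓕 ψ ξ = 𝓕 f ξ := rfl
  simp only [norm_smul, Real.norm_eq_abs, abs_of_pos Real.two_pi_pos, this]
  ring

theorem integral_norm_sliceDerivs_sq [CompleteSpace H] {ψ : Space d → H} (h : ContDiff ℝ ∞ ψ)
    (hc : HasCompactSupport ψ) (α : MultiIndex d) :
    ∫ x, ‖sliceDerivs α ψ x‖ ^ 2 =
      ∫ ξ, monomial ((2 * Real.pi) • ξ) α ^ 2 * ‖𝓕 ψ ξ‖ ^ 2 := by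
  have := SchwartzMap.integral_norm_sq_fourier ((hasCompactSupport_listDeriv hc
      (α.toList.map fun i => EuclideanSpace.single i (1 : ℝ))).toSchwartzMap
        (contDiff_listDeriv h _))
  refine this.symm.trans (integral_congr_ae (Filter.Eventually.of_forall fun ξ => ?_))
  have e := fourier_sliceDerivs h hc α ξ
  simp only
  change ‖𝓕 (sliceDerivs α ψ) ξ‖ ^ 2 = _
  rw [e, norm_smul]
  simp [mul_pow]

theorem integrable_monomial_mul_fourier {ψ : Space d → H} (h : ContDiff ℝ ∞ ψ)
    (hc : HasCompactSupport ψ) (α : MultiIndex d) :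
    Integrable fun ξ => monomial ((2 * Real.pi) • ξ) α ^ 2 * ‖𝓕 ψ ξ‖ ^ 2 := by
  have hcont : Continuous fun ξ => ‖𝓕 ψ ξ‖ := (𝓕 (hc.toSchwartzMap h : 𝓢(Space d, H))).continuous.norm
  refine (integrable_pow_mul_fourier h hc (2 * order α)).mono' ?_
    (Filter.Eventually.of_forall fun ξ => ?_)
  · refine Continuous.aestronglyMeasurable ?_
    have : Continuous fun ξ : Space d => monomial ((2 * Real.pi) • ξ) α := by
      unfold monomial; fun_prop
    fun_prop
  · rw [Real.norm_eq_abs, abs_mul, abs_of_nonneg (sq_nonneg ‖𝓕 ψ ξ‖), abs_pow, mul_comm 2 (order α), pow_mul]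
    gcongr
    exact abs_monomial_le _ _

/-- Gårding's inequality for coefficients independent of `x`. -/
theorem IsLegendreHadamard.garding {δ : ℝ}
    {A : MultiIndex d → MultiIndex d → ℝ → Matrix (Fin n) (Fin n) ℂ}
    (hA : IsLegendreHadamard m δ A) (t : ℝ) {ψ : Space d → Val n} (h : ContDiff ℝ ∞ ψ)
    (hc : HasCompactSupport ψ) :
    δ * ∫ ξ, ‖(2 * Real.pi) • ξ‖ ^ (2 * m) * ‖𝓕 ψ ξ‖ ^ 2 ≤
      (∑ α ∈ ofOrder d m, ∑ β ∈ ofOrder d m,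
        ∫ x, ⟪sliceDerivs α ψ x, matVec (A α β t) (sliceDerivs β ψ x)⟫_ℂ).re := by
  let S (α : MultiIndex d) : 𝓢(Space d, Val n) := (hasCompactSupport_listDeriv hc
      (α.toList.map fun i => EuclideanSpace.single i (1 : ℝ))).toSchwartzMap
        (contDiff_listDeriv h _)
  -- The form `(v, w) ↦ ⟪v, B w⟫` as a continuous sesquilinear map, to which Plancherel applies
  -- directly.
  let M (B : Matrix (Fin n) (Fin n) ℂ) : Val n →L⋆[ℂ] Val n →L[ℂ] ℂ :=
    ((ContinuousLinearMap.compL ℂ (Val n) (Val n) ℂ).flip (Matrix.toEuclideanCLM (𝕜 := ℂ) B)).comp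
      (innerSL ℂ)
  have hM (B : Matrix (Fin n) (Fin n) ℂ) (v w : Val n) : M B v w = ⟪v, matVec B w⟫_ℂ := rfl
  have hcont : Continuous (𝓕 ψ) := (𝓕 (hc.toSchwartzMap h : 𝓢(Space d, Val n))).continuous
  have hS (α : MultiIndex d) (hα : α ∈ ofOrder d m) (ξ : Space d) : 𝓕 (S α) ξ =
      (Complex.I ^ m * (monomial ((2 * Real.pi) • ξ) α : ℝ)) • 𝓕 ψ ξ := by
    rw [← mem_ofOrder.mp hα]
    exact fourier_sliceDerivs h hc α ξ
  have hpt (α : MultiIndex d) (hα : α ∈ ofOrder d m) (β : MultiIndex d) (hβ : β ∈ ofOrder d m)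
      (ξ : Space d) : M (A α β t) (𝓕 (S α) ξ) (𝓕 (S β) ξ) =
        ((monomial ((2 * Real.pi) • ξ) α * monomial ((2 * Real.pi) • ξ) β : ℝ) : ℂ) *
          ⟪𝓕 ψ ξ, matVec (A α β t) (𝓕 ψ ξ)⟫_ℂ := by
    rw [hS α hα, hS β hβ, (M (A α β t)).map_smulₛₗ, map_smul, smul_apply, hM]
    -- Both derivatives have order `m`, so the phases `i^m` cancel and only the real monomials
    -- remain.
    have hI : (starRingEnd ℂ) (Complex.I ^ m) * Complex.I ^ m = 1 := by
      rw [← Complex.normSq_eq_conj_mul_self]; simp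
    simp only [map_mul, Complex.conj_ofReal, smul_eq_mul, Complex.ofReal_mul]
    linear_combination (((monomial ((2 * Real.pi) • ξ) α : ℂ) * (monomial ((2 * Real.pi) • ξ) β : ℂ)) *
          ⟪𝓕 ψ ξ, matVec (A α β t) (𝓕 ψ ξ)⟫_ℂ) * hI
  have hint (α : MultiIndex d) (β : MultiIndex d) :
      Integrable fun ξ => M (A α β t) (𝓕 (S α) ξ) (𝓕 (S β) ξ) := by
    obtain ⟨C, hC⟩ : ∃ C, ∀ ξ, ‖𝓕 (S β) ξ‖ ≤ C := by
      obtain ⟨C, hC⟩ := (𝓕 (S β)).decay 0 0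
      exact ⟨C, fun x => by simpa using hC.2 x⟩
    have c1 := (𝓕 (S α)).continuous
    have c2 := (𝓕 (S β)).continuous
    refine ((((𝓕 (S α)).integrable (μ := volume)).norm.const_mul ‖M (A α β t)‖).mul_const C).mono'
      (Continuous.aestronglyMeasurable (by fun_prop)) (Filter.Eventually.of_forall fun ξ => ?_)
    refine ((M (A α β t)).le_opNorm₂ _ _).trans ?_
    gcongr
    exact hC ξ
  have heq : ∑ α ∈ ofOrder d m, ∑ β ∈ ofOrder d m,
        ∫ x, ⟪sliceDerivs α ψ x, matVec (A α β t) (sliceDerivs β ψ x)⟫_ℂ =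
      ∫ ξ, ∑ α ∈ ofOrder d m, ∑ β ∈ ofOrder d m, M (A α β t) (𝓕 (S α) ξ) (𝓕 (S β) ξ) := by
    rw [integral_finsetSum _ fun α _ => integrable_finsetSum _ fun β _ => hint α β]
    refine Finset.sum_congr rfl fun α _ => ?_
    rw [integral_finsetSum _ fun β _ => hint α β]
    refine Finset.sum_congr rfl fun β _ => ?_
    exact (SchwartzMap.integral_sesq_fourier_fourier (S α) (S β) (M (A α β t))).symm
  have hI := integrable_finsetSum (ofOrder d m) fun α _ =>
    integrable_finsetSum (ofOrder d m) fun β _ => hint α β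
  rw [heq, ← RCLike.re_eq_complex_re, ← integral_re hI, ← integral_const_mul]
  refine integral_mono ((integrable_pow_mul_fourier h hc _).const_mul _) hI.re fun ξ => ?_
  have := hA.le_re_sum_inner t ((2 * Real.pi) • ξ) (𝓕 ψ ξ)
  simp only [← mul_assoc]
  refine this.trans (le_of_eq ?_)
  rw [RCLike.re_eq_complex_re]
  congr 1
  exact Finset.sum_congr rfl fun α hα => Finset.sum_congr rfl fun β hβ => (hpt α hα β hβ ξ).symm

end

end ParabolicSystem

namespace ParabolicSystem

noncomputable section

open scoped FourierTransform InnerProductSpace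

variable {d n m : ℕ}

/-! ### Solvability of coercive problems on a dense class of test functions -/

/-- Lions' form of Lax-Milgram, in which `E` need not be bounded in terms of `J`. Coercivity makes
the projection `T` of `E` onto the closure `X` of the range of `J` bounded below, `c‖Jφ‖ ≤ ‖Tφ‖`.
Hence `F ∘ T⁻¹` is bounded by `N / c` on the range of `T`; Hahn-Banach extends it and Riesz
represents it. Projecting first places the solution in `X`, so that it inherits every closed linear
relation valid on the range of `J`. -/
theorem exists_inner_eq_of_coercive {V H : Type*} [AddCommGroup V] [Module ℂ V]
    [NormedAddCommGroup H] [InnerProductSpace ℂ H] [CompleteSpace H] (J E : V →ₗ[ℂ] H)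
    (hJ : Function.Injective J) (F : V →ₗ[ℂ] ℂ) {c N : ℝ} (hc : 0 < c)
    (hcoer : ∀ φ, c * ‖J φ‖ ^ 2 ≤ (⟪J φ, E φ⟫_ℂ).re) (hN : 0 ≤ N)
    (hF : ∀ φ, ‖F φ‖ ≤ N * ‖J φ‖) :
    ∃ x ∈ J.range.topologicalClosure, ‖x‖ ≤ N / c ∧ ∀ φ, ⟪x, E φ⟫_ℂ = F φ := by
  set X := J.range.topologicalClosure with hX
  have : CompleteSpace X := J.range.isClosed_topologicalClosure.completeSpace_coe
  let T : V →ₗ[ℂ] X := (X.orthogonalProjectionOnto : H →ₗ[ℂ] X).comp E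
  have hT (x : X) (φ : V) : ⟪x, T φ⟫_ℂ = ⟪(x : H), E φ⟫_ℂ :=
    Submodule.inner_orthogonalProjectionOnto_eq_of_mem_left x (E φ)
  have hmem (φ : V) : J φ ∈ X := J.range.le_topologicalClosure ⟨φ, rfl⟩
  have hlow (φ : V) : c * ‖J φ‖ ≤ ‖T φ‖ := by
    have h1 := hcoer φ
    rw [← hT ⟨J φ, hmem φ⟩ φ] at h1
    have h2 : (⟪(⟨J φ, hmem φ⟩ : X), T φ⟫_ℂ).re ≤ ‖J φ‖ * ‖T φ‖ :=
      (Complex.re_le_norm _).trans (norm_inner_le_norm (𝕜 := ℂ) (⟨J φ, hmem φ⟩ : X) (T φ))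
    rcases (norm_nonneg (J φ)).eq_or_lt with h0 | h0
    · rw [← h0]; simp
    · nlinarith
  have hinj : Function.Injective T := by
    refine (injective_iff_map_eq_zero T).mpr fun φ h0 => hJ ?_
    have := hlow φ
    rw [h0, norm_zero] at this
    rw [map_zero]
    exact norm_le_zero_iff.mp (by nlinarith [norm_nonneg (J φ)])
  let e := LinearEquiv.ofInjective T hinj
  let g : T.range →L[ℂ] ℂ := (F.comp (e.symm : T.range →ₗ[ℂ] V)).mkContinuous (N / c) (by
    intro y
    obtain ⟨φ, rfl⟩ := e.surjective y
    simp only [LinearMap.comp_apply, LinearEquiv.coe_coe, LinearEquiv.symm_apply_apply]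
    refine (hF φ).trans ?_
    have h1 : ‖e φ‖ = ‖T φ‖ := rfl
    rw [h1, div_mul_eq_mul_div, le_div_iff₀ hc]
    nlinarith [hlow φ])
  obtain ⟨G, hG, hGn⟩ := exists_extension_norm_eq T.range g
  let x := (InnerProductSpace.toDual ℂ X).symm G
  refine ⟨x, x.2, ?_, fun φ => ?_⟩
  · have : ‖(x : H)‖ = ‖G‖ := (InnerProductSpace.toDual ℂ X).symm.norm_map G
    rw [this, hGn]
    exact LinearMap.mkContinuous_norm_le _ (by positivity) _
  · rw [← hT x φ, InnerProductSpace.toDual_symm_apply]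
    refine (hG (e φ)).trans ?_
    simp [g]

/-! ### Multiplication by the coefficients -/

theorem matVec_eq (B : Matrix (Fin n) (Fin n) ℂ) (v : Val n) :
    matVec B v = Matrix.toEuclideanCLM (𝕜 := ℂ) B v := rfl

theorem matVec_apply (B : Matrix (Fin n) (Fin n) ℂ) (v : Val n) (i : Fin n) :
    matVec B v i = ∑ j, B i j * v j := rfl

theorem inner_matVec_conjTranspose (B : Matrix (Fin n) (Fin n) ℂ) (v w : Val n) :
    ⟪matVec B.conjTranspose v, w⟫_ℂ = ⟪v, matVec B w⟫_ℂ := by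
  simp only [PiLp.inner_apply, matVec_apply, RCLike.inner_apply, map_sum, map_mul,
    Matrix.conjTranspose_apply, RCLike.star_def, Finset.mul_sum, Finset.sum_mul]
  rw [Finset.sum_comm]
  refine Finset.sum_congr rfl fun i _ => Finset.sum_congr rfl fun j _ => ?_
  simp only [Complex.conj_conj]
  ring

theorem norm_matVec_le {B : Matrix (Fin n) (Fin n) ℂ} {K : ℝ} (hB : ∀ i j, ‖B i j‖ ≤ K)
    (v : Val n) : ‖matVec B v‖ ≤ n * K * ‖v‖ := by
  rcases Nat.eq_zero_or_pos n with rfl | hn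
  · simp [Subsingleton.elim (matVec B v) 0]
  have hK : 0 ≤ K := (norm_nonneg _).trans (hB ⟨0, hn⟩ ⟨0, hn⟩)
  rw [EuclideanSpace.norm_eq, EuclideanSpace.norm_eq, Real.sqrt_le_left (by positivity)]
  have h1 (i : Fin n) : ‖matVec B v i‖ ^ 2 ≤ n * K ^ 2 * ∑ j, ‖v j‖ ^ 2 := by
    rw [matVec_apply]
    calc ‖∑ j, B i j * v j‖ ^ 2 ≤ (∑ j, K * ‖v j‖) ^ 2 := by
          gcongr
          refine (norm_sum_le _ _).trans (Finset.sum_le_sum fun j _ => ?_)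
          rw [norm_mul]
          gcongr
          exact hB i j
      _ = K ^ 2 * (∑ j, ‖v j‖) ^ 2 := by rw [← Finset.mul_sum, mul_pow]
      _ ≤ K ^ 2 * (n * ∑ j, ‖v j‖ ^ 2) := by
          gcongr
          simpa using sq_sum_le_card_mul_sum_sq (s := Finset.univ) (f := fun j => ‖v j‖)
      _ = _ := by ring
  calc ∑ i, ‖matVec B v i‖ ^ 2 ≤ ∑ _i : Fin n, n * K ^ 2 * ∑ j, ‖v j‖ ^ 2 :=
        Finset.sum_le_sum fun i _ => h1 i
    _ = _ := by
        rw [mul_pow, Real.sq_sqrt (by positivity)]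
        simp; ring

theorem measurable_matVec {X : Type*} [MeasurableSpace X] {B : X → Matrix (Fin n) (Fin n) ℂ}
    (hB : ∀ i j, Measurable fun t => B t i j) {μ : Measure X} {g : X → Val n}
    (hg : AEStronglyMeasurable g μ) : AEStronglyMeasurable (fun t => matVec (B t) (g t)) μ := by
  have h (i : Fin n) : AEMeasurable (fun t => matVec (B t) (g t) i) μ := by
    simp only [matVec_apply]
    refine Finset.aemeasurable_fun_sum _ fun j _ => ((hB i j).aemeasurable).mul ?_
    exact ((EuclideanSpace.proj (𝕜 := ℂ) j).continuous.measurable).comp_aemeasurable hg.aemeasurable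
  have h2 : AEMeasurable (fun t => (matVec (B t) (g t)).ofLp) μ := aemeasurable_pi_lambda _ h
  exact ((PiLp.continuous_toLp 2 _).measurable.comp_aemeasurable h2).aestronglyMeasurable

theorem memLp_matVec {X : Type*} [MeasurableSpace X] {B : X → Matrix (Fin n) (Fin n) ℂ}
    (hB : ∀ i j, Measurable fun t => B t i j) {K : ℝ} (hK : ∀ i j t, ‖B t i j‖ ≤ K)
    {μ : Measure X} {p : ENNReal} {g : X → Val n} (hg : MemLp g p μ) :
    MemLp (fun t => matVec (B t) (g t)) p μ :=
  hg.of_le_mul (measurable_matVec hB hg.1)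
    (Filter.Eventually.of_forall fun t => norm_matVec_le (fun i j => hK i j t) (g t))

/-! ### Vector-valued test functions -/

/-- `C₀^∞(ℝ^{d+1}; ℂ^n)` as a vector space. -/
def testSpace (d n : ℕ) : Submodule ℂ (SpaceTime d → Val n) where
  carrier := {φ | ContDiff ℝ ∞ φ ∧ HasCompactSupport φ}
  add_mem' h h' := ⟨h.1.add h'.1, h.2.add h'.2⟩
  zero_mem' := ⟨contDiff_const, HasCompactSupport.zero⟩
  smul_mem' c _ h := ⟨contDiff_const.smul h.1, h.2.smul_left (f := fun _ => c)⟩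

theorem memLp_of_smooth {F : Type*} [NormedAddCommGroup F] [NormedSpace ℝ F] {E : Type*}
    [NormedAddCommGroup E] [NormedSpace ℝ E] [FiniteDimensional ℝ E] [MeasurableSpace E]
    [BorelSpace E] {μ : Measure E} [IsFiniteMeasureOnCompacts μ]
    {φ : E → F} (h : ContDiff ℝ ∞ φ) (hc : HasCompactSupport φ) (p : ENNReal) : MemLp φ p μ :=
  h.continuous.memLp_of_hasCompactSupport hc

theorem spaceDerivs_const_smul {φ : SpaceTime d → Val n} (h : ContDiff ℝ ∞ φ) (c : ℂ)
    (α : MultiIndex d) : spaceDerivs α (c • φ) = c • spaceDerivs α φ :=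
  spaceDerivs_clm_comp h ((c • ContinuousLinearMap.id ℂ (Val n)).restrictScalars ℝ) α

theorem dirDeriv_const_smul {φ : SpaceTime d → Val n} (h : ContDiff ℝ ∞ φ) (c : ℂ)
    (v : SpaceTime d) : dirDeriv v (c • φ) = c • dirDeriv v φ :=
  dirDeriv_clm_comp h ((c • ContinuousLinearMap.id ℂ (Val n)).restrictScalars ℝ) v

/-- `φ ↦ D^α φ` as a map into `L₂`. -/
def derivLp (α : MultiIndex d) : testSpace d n →ₗ[ℂ] Lp (Val n) 2 (volume : Measure (SpaceTime d))
    where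
  toFun φ := (memLp_of_smooth (contDiff_spaceDerivs φ.2.1 α)
    (hasCompactSupport_spaceDerivs φ.2.2 α) 2).toLp _
  map_add' φ ψ := by
    rw [← MemLp.toLp_add, MemLp.toLp_eq_toLp_iff]
    exact .of_forall fun X => congrFun (listDeriv_add φ.2.1 ψ.2.1 _) X
  map_smul' c φ := by
    rw [RingHom.id_apply, ← MemLp.toLp_const_smul, MemLp.toLp_eq_toLp_iff]
    exact .of_forall fun X => congrFun (spaceDerivs_const_smul φ.2.1 c α) X

/-- `φ ↦ φ_t` as a map into `L₂`. -/
def timeLp : testSpace d n →ₗ[ℂ] Lp (Val n) 2 (volume : Measure (SpaceTime d)) where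
  toFun φ := (memLp_of_smooth (contDiff_dirDeriv φ.2.1 timeVec)
    (hasCompactSupport_dirDeriv φ.2.2 timeVec) 2).toLp _
  map_add' φ ψ := by
    rw [← MemLp.toLp_add, MemLp.toLp_eq_toLp_iff]
    exact .of_forall fun X => congrFun (dirDeriv_add φ.2.1 ψ.2.1 _) X
  map_smul' c φ := by
    rw [RingHom.id_apply, ← MemLp.toLp_const_smul, MemLp.toLp_eq_toLp_iff]
    exact .of_forall fun X => congrFun (dirDeriv_const_smul φ.2.1 c _) X

theorem coeFn_derivLp (α : MultiIndex d) (φ : testSpace d n) :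
    derivLp α φ =ᵐ[volume] spaceDerivs α (φ : SpaceTime d → Val n) :=
  MemLp.coeFn_toLp (memLp_of_smooth (contDiff_spaceDerivs φ.2.1 α)
    (hasCompactSupport_spaceDerivs φ.2.2 α) 2)

theorem coeFn_timeLp (φ : testSpace d n) :
    timeLp φ =ᵐ[volume] dirDeriv timeVec (φ : SpaceTime d → Val n) :=
  MemLp.coeFn_toLp (memLp_of_smooth (contDiff_dirDeriv φ.2.1 timeVec)
    (hasCompactSupport_dirDeriv φ.2.2 timeVec) 2)

/-- Multiplication of `L₂` functions by a bounded measurable matrix function of time. -/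
def matLp (B : ℝ → Matrix (Fin n) (Fin n) ℂ) (hB : ∀ i j, Measurable fun t => B t i j) {K : ℝ}
    (hK : ∀ i j t, ‖B t i j‖ ≤ K) : Lp (Val n) 2 (volume : Measure (SpaceTime d)) →ₗ[ℂ]
      Lp (Val n) 2 (volume : Measure (SpaceTime d)) where
  toFun g := (memLp_matVec (B := fun X : SpaceTime d => B X.1)
    (fun i j => (hB i j).comp measurable_fst) (fun i j X => hK i j X.1) (Lp.memLp g)).toLp _
  map_add' g g' := by
    rw [← MemLp.toLp_add, MemLp.toLp_eq_toLp_iff]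
    filter_upwards [Lp.coeFn_add g g'] with X hX
    rw [hX, Pi.add_apply, Pi.add_apply, matVec_eq, map_add]; rfl
  map_smul' c g := by
    rw [RingHom.id_apply, ← MemLp.toLp_const_smul, MemLp.toLp_eq_toLp_iff]
    filter_upwards [Lp.coeFn_smul c g] with X hX
    rw [hX, Pi.smul_apply, Pi.smul_apply, matVec_eq, map_smul]; rfl

theorem coeFn_matLp (B : ℝ → Matrix (Fin n) (Fin n) ℂ) (hB : ∀ i j, Measurable fun t => B t i j)
    {K : ℝ} (hK : ∀ i j t, ‖B t i j‖ ≤ K) (g : Lp (Val n) 2 (volume : Measure (SpaceTime d))) :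
    matLp B hB hK g =ᵐ[volume] fun X => matVec (B X.1) (g X) :=
  MemLp.coeFn_toLp (memLp_matVec (B := fun X : SpaceTime d => B X.1)
    (fun i j => (hB i j).comp measurable_fst) (fun i j X => hK i j X.1) (Lp.memLp g))

/-! ### Energy inequalities for test functions -/

instance : (volume : Measure (SpaceTime d)).IsAddHaarMeasure :=
  inferInstanceAs ((volume : Measure ℝ).prod (volume : Measure (Space d))).IsAddHaarMeasure

/-- The integrand is half the time derivative of `|φ|²`, which has compact support. This removes the
time derivative from the energy identity. -/
theorem re_inner_timeLp (φ : testSpace d n) : (⟪derivLp 0 φ, timeLp φ⟫_ℂ).re = 0 := by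
  have hφ := φ.2.1
  have hc := φ.2.2
  have e : ⟪derivLp 0 φ, timeLp φ⟫_ℂ =
      ∫ X, ⟪(φ : SpaceTime d → Val n) X, dirDeriv timeVec (φ : SpaceTime d → Val n) X⟫_ℂ := by
    rw [L2.inner_def]
    refine integral_congr_ae ?_
    filter_upwards [coeFn_derivLp 0 φ, coeFn_timeLp φ] with X h1 h2
    rw [h1, h2, spaceDerivs_zero]
  have hdc : Continuous (dirDeriv timeVec (φ : SpaceTime d → Val n)) :=
    (contDiff_dirDeriv hφ timeVec).continuous
  have i1 : Integrable fun X =>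
      ⟪(φ : SpaceTime d → Val n) X, dirDeriv timeVec (φ : SpaceTime d → Val n) X⟫_ℂ :=
    (hφ.continuous.inner hdc).integrable_of_hasCompactSupport
      (hc.mono fun X hX => by
        contrapose! hX
        simp [Function.notMem_support.mp hX])
  rw [e, ← RCLike.re_eq_complex_re, ← integral_re i1]
  have hre (X) : RCLike.re ⟪(φ : SpaceTime d → Val n) X,
      dirDeriv timeVec (φ : SpaceTime d → Val n) X⟫_ℂ =
      innerSL ℝ ((φ : SpaceTime d → Val n) X) (fderiv ℝ (φ : SpaceTime d → Val n) X timeVec) := by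
    simp [innerSL_apply_apply, PiLp.inner_apply, Complex.inner, dirDeriv]
  have hre' (X) : RCLike.re ⟪(φ : SpaceTime d → Val n) X,
      dirDeriv timeVec (φ : SpaceTime d → Val n) X⟫_ℂ =
      innerSL ℝ (fderiv ℝ (φ : SpaceTime d → Val n) X timeVec) ((φ : SpaceTime d → Val n) X) := by
    rw [hre, innerSL_apply_apply, innerSL_apply_apply, real_inner_comm]
  have i2 : Integrable fun X => innerSL ℝ ((φ : SpaceTime d → Val n) X)
      ((φ : SpaceTime d → Val n) X) :=
    (hφ.continuous.inner hφ.continuous).integrable_of_hasCompactSupport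
      (hc.mono fun X hX => by
        contrapose! hX
        simp [Function.notMem_support.mp hX])
  have key := integral_bilinear_fderiv_right_eq_neg_left_of_integrable (μ := volume)
    (f := (φ : SpaceTime d → Val n)) (g := (φ : SpaceTime d → Val n)) (v := timeVec)
    (B := innerSL ℝ) (by simpa only [← hre'] using i1.re) (by simpa only [← hre] using i1.re)
    i2
    (fun X _ => hφ.differentiable (by simp) X) (fun X _ => hφ.differentiable (by simp) X)
  simp only [← hre, ← hre'] at key
  linarith

theorem norm_derivLp_sq (α : MultiIndex d) (φ : testSpace d n) :
    ‖derivLp α φ‖ ^ 2 = ∫ X, ‖spaceDerivs α (φ : SpaceTime d → Val n) X‖ ^ 2 := by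
  have h : ((‖derivLp α φ‖ ^ 2 : ℝ) : ℂ) =
      ((∫ X, ‖spaceDerivs α (φ : SpaceTime d → Val n) X‖ ^ 2 : ℝ) : ℂ) := by
    have := inner_self_eq_norm_sq_to_K (𝕜 := ℂ) (derivLp α φ)
    push_cast
    refine (this.symm.trans ?_)
    rw [L2.inner_def, ← integral_complex_ofReal]
    refine integral_congr_ae ?_
    filter_upwards [coeFn_derivLp α φ] with X h1
    rw [h1, inner_self_eq_norm_sq_to_K]
    simp
  exact_mod_cast h

theorem hasCompactSupport_slice {F : Type*} [NormedAddCommGroup F] {φ : SpaceTime d → F}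
    (h : HasCompactSupport φ) (t : ℝ) : HasCompactSupport fun x => φ (t, x) := by
  refine HasCompactSupport.intro (h.isCompact.image continuous_snd) fun x hx => ?_
  by_contra h0
  exact hx ⟨(t, x), subset_tsupport _ h0, rfl⟩

theorem contDiff_slice {F : Type*} [NormedAddCommGroup F] [NormedSpace ℝ F] {φ : SpaceTime d → F}
    (h : ContDiff ℝ ∞ φ) (t : ℝ) : ContDiff ℝ ∞ fun x => φ (t, x) :=
  h.comp (contDiff_const.prodMk contDiff_id)

theorem integrable_norm_sq_spaceDerivs (α : MultiIndex d) (φ : testSpace d n) :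
    Integrable fun X => ‖spaceDerivs α (φ : SpaceTime d → Val n) X‖ ^ 2 :=
  (memLp_two_iff_integrable_sq_norm
    (contDiff_spaceDerivs φ.2.1 α).continuous.aestronglyMeasurable).mp
    (memLp_of_smooth (contDiff_spaceDerivs φ.2.1 α) (hasCompactSupport_spaceDerivs φ.2.2 α) 2)

theorem norm_derivLp_sq_eq_slices (α : MultiIndex d) (φ : testSpace d n) :
    ‖derivLp α φ‖ ^ 2 = ∫ t, ∫ x, ‖sliceDerivs α (fun y => (φ : SpaceTime d → Val n) (t, y)) x‖ ^ 2 ∧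
    Integrable fun t => ∫ x, ‖sliceDerivs α (fun y => (φ : SpaceTime d → Val n) (t, y)) x‖ ^ 2 := by
  have hI := integrable_norm_sq_spaceDerivs α φ
  simp only [spaceDerivs_slice φ.2.1]
  rw [norm_derivLp_sq]
  exact ⟨integral_prod _ hI, hI.integral_prod_left⟩

/-- The interpolation inequality `‖D^β φ‖² ≲ μ^{|β|-m} (μ^m ‖φ‖² + ∑ ‖D^α φ‖²)`. -/
theorem norm_derivLp_interpolation {μ : ℝ} (hμ : 0 < μ) {β : MultiIndex d} (hβ : order β ≤ m)
    (φ : testSpace d n) :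
    μ ^ (m - order β) * ‖derivLp β φ‖ ^ 2 ≤
      (d ^ m + 1) * (μ ^ m * ‖derivLp 0 φ‖ ^ 2 + ∑ α ∈ ofOrder d m, ‖derivLp α φ‖ ^ 2) := by
  have hφ := φ.2.1
  have hc := φ.2.2
  simp only [(norm_derivLp_sq_eq_slices _ φ).1]
  have hI (α : MultiIndex d) := (norm_derivLp_sq_eq_slices α φ).2
  rw [← integral_finsetSum _ fun α _ => hI α, ← integral_const_mul, ← integral_const_mul,
    ← integral_add ((hI 0).const_mul _) (integrable_finsetSum _ fun α _ => hI α),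
    ← integral_const_mul]
  refine integral_mono ((hI β).const_mul _) ((((hI 0).const_mul _).add
    (integrable_finsetSum _ fun α _ => hI α)).const_mul _) fun t => ?_
  have hs := contDiff_slice hφ t
  have hsc := hasCompactSupport_slice hc t
  have hJ (α : MultiIndex d) := integrable_monomial_mul_fourier hs hsc α
  simp only [integral_norm_sliceDerivs_sq hs hsc]
  rw [← integral_finsetSum _ fun α _ => hJ α, ← integral_const_mul, ← integral_const_mul,
    ← integral_add ((hJ 0).const_mul _) (integrable_finsetSum _ fun α _ => hJ α),
    ← integral_const_mul]
  refine integral_mono ((hJ β).const_mul _) ((((hJ 0).const_mul _).add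
    (integrable_finsetSum _ fun α _ => hJ α)).const_mul _) fun ξ => ?_
  simp only
  set η := (2 * Real.pi) • ξ
  rw [← Finset.sum_mul, ← mul_assoc, ← mul_assoc, ← add_mul, ← mul_assoc]
  refine mul_le_mul_of_nonneg_right ?_ (sq_nonneg _)
  have h0 : monomial η 0 = 1 := by simp [monomial]
  rw [h0, one_pow, mul_one]
  have h1 : monomial η β ^ 2 ≤ (‖η‖ ^ 2) ^ order β := by
    rw [← pow_mul, mul_comm 2, pow_mul, ← sq_abs]
    gcongr
    exact abs_monomial_le η β
  have h2 := norm_pow_le_sum_monomial η m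
  -- Replacing the smaller of the bases `μ` and `|η|²` by the larger one gives an `m`-th power of
  -- the larger.
  have h3 : μ ^ (m - order β) * (‖η‖ ^ 2) ^ order β ≤ μ ^ m + (‖η‖ ^ 2) ^ m := by
    have e (s : ℝ) : s ^ (m - order β) * s ^ order β = s ^ m := by
      rw [← pow_add, Nat.sub_add_cancel hβ]
    rcases le_total (‖η‖ ^ 2) μ with h | h
    · calc μ ^ (m - order β) * (‖η‖ ^ 2) ^ order β ≤ μ ^ (m - order β) * μ ^ order β := by gcongr
        _ ≤ _ := by rw [e]; exact le_add_of_nonneg_right (by positivity)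
    · calc μ ^ (m - order β) * (‖η‖ ^ 2) ^ order β
            ≤ (‖η‖ ^ 2) ^ (m - order β) * (‖η‖ ^ 2) ^ order β := by gcongr
        _ ≤ _ := by rw [e]; exact le_add_of_nonneg_left (by positivity)
  rw [pow_mul] at h2
  have h4 : (0 : ℝ) ≤ d ^ m := by positivity
  have h5 : 0 < μ ^ m := by positivity
  calc μ ^ (m - order β) * monomial η β ^ 2 ≤ μ ^ (m - order β) * (‖η‖ ^ 2) ^ order β := by gcongr
    _ ≤ _ := by nlinarith

/-- Gårding's inequality in `L₂(ℝ^{d+1})`. -/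
theorem IsLegendreHadamard.coercive {δ : ℝ} (hδ : 0 < δ)
    {A : MultiIndex d → MultiIndex d → ℝ → Matrix (Fin n) (Fin n) ℂ}
    (hA : IsLegendreHadamard m δ A) (φ : testSpace d n) :
    δ / ((ofOrder d m).card + 1) * ∑ α ∈ ofOrder d m, ‖derivLp α φ‖ ^ 2 ≤
      (∑ α ∈ ofOrder d m, ∑ β ∈ ofOrder d m,
        ∫ X, ⟪spaceDerivs α (φ : SpaceTime d → Val n) X,
          matVec (A α β X.1) (spaceDerivs β (φ : SpaceTime d → Val n) X)⟫_ℂ).re := by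
  have hφ := φ.2.1
  have hc := φ.2.2
  have hI (α : MultiIndex d) := (norm_derivLp_sq_eq_slices α φ).2
  have hcross (α) (hα : α ∈ ofOrder d m) (β) (hβ : β ∈ ofOrder d m) :
      Integrable fun X => ⟪spaceDerivs α (φ : SpaceTime d → Val n) X,
          matVec (A α β X.1) (spaceDerivs β (φ : SpaceTime d → Val n) X)⟫_ℂ := by
    have m1 := memLp_of_smooth (μ := volume) (contDiff_spaceDerivs hφ α)
      (hasCompactSupport_spaceDerivs hc α) 2
    have m2 := memLp_matVec (B := fun X : SpaceTime d => A α β X.1)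
      (fun i j => (hA.measurable α hα β hβ i j).comp measurable_fst)
      (fun i j X => hA.bound α hα β hβ i j X.1)
      (memLp_of_smooth (μ := volume) (contDiff_spaceDerivs hφ β)
      (hasCompactSupport_spaceDerivs hc β) 2)
    have := L2.integrable_inner (𝕜 := ℂ) (m1.toLp _) (m2.toLp _)
    refine this.congr ?_
    filter_upwards [m1.coeFn_toLp, m2.coeFn_toLp] with X h1 h2
    rw [h1, h2]
  simp only [(norm_derivLp_sq_eq_slices _ φ).1]
  have hsl (α) (hα : α ∈ ofOrder d m) (β) (hβ : β ∈ ofOrder d m) : Integrable fun t =>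
        ∫ x, ⟪sliceDerivs α (fun y => (φ : SpaceTime d → Val n) (t, y)) x,
          matVec (A α β t) (sliceDerivs β (fun y => (φ : SpaceTime d → Val n) (t, y)) x)⟫_ℂ := by
    simp only [spaceDerivs_slice hφ]
    exact (hcross α hα β hβ).integral_prod_left
  have e : ∑ α ∈ ofOrder d m, ∑ β ∈ ofOrder d m,
        ∫ X, ⟪spaceDerivs α (φ : SpaceTime d → Val n) X,
          matVec (A α β X.1) (spaceDerivs β (φ : SpaceTime d → Val n) X)⟫_ℂ =
      ∫ t, ∑ α ∈ ofOrder d m, ∑ β ∈ ofOrder d m,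
        ∫ x, ⟪sliceDerivs α (fun y => (φ : SpaceTime d → Val n) (t, y)) x,
          matVec (A α β t) (sliceDerivs β (fun y => (φ : SpaceTime d → Val n) (t, y)) x)⟫_ℂ := by
    rw [integral_finsetSum _ fun α hα => integrable_finsetSum _ fun β hβ => hsl α hα β hβ]
    refine Finset.sum_congr rfl fun α hα => ?_
    rw [integral_finsetSum _ fun β hβ => hsl α hα β hβ]
    refine Finset.sum_congr rfl fun β hβ => ?_
    simp only [spaceDerivs_slice hφ]
    exact integral_prod _ (hcross α hα β hβ)
  have hint := integrable_finsetSum (ofOrder d m) fun α hα =>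
    integrable_finsetSum (ofOrder d m) fun β hβ => hsl α hα β hβ
  rw [e, ← RCLike.re_eq_complex_re, ← integral_re hint, ← integral_finsetSum _ fun α _ => hI α,
    ← integral_const_mul]
  refine integral_mono ((integrable_finsetSum _ fun α _ => hI α).const_mul _) hint.re fun t => ?_
  have hs := contDiff_slice hφ t
  have hsc := hasCompactSupport_slice hc t
  have hg := hA.garding t hs hsc
  refine le_trans ?_ hg
  -- Each `D^α` of order `m` is dominated by the full symbol `|2πξ|^(2m)`, so the sum costs a factor
  -- equal to the number of multi-indices. This is absorbed by the division by that number plus 1,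
  -- which also keeps the denominator nonzero.
  have hle (α) (hα : α ∈ ofOrder d m) :
      ∫ x, ‖sliceDerivs α (fun y => (φ : SpaceTime d → Val n) (t, y)) x‖ ^ 2 ≤
      ∫ ξ, ‖(2 * Real.pi) • ξ‖ ^ (2 * m) * ‖𝓕 (fun y => (φ : SpaceTime d → Val n) (t, y)) ξ‖ ^ 2 := by
    rw [integral_norm_sliceDerivs_sq hs hsc]
    refine integral_mono (integrable_monomial_mul_fourier hs hsc α)
      (integrable_pow_mul_fourier hs hsc _) fun ξ => ?_
    simp only
    gcongr
    have := abs_monomial_le ((2 * Real.pi) • ξ) α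
    rw [mem_ofOrder.mp hα] at this
    rw [← sq_abs, mul_comm 2 m, pow_mul]
    gcongr
  set I := ∫ ξ, ‖(2 * Real.pi) • ξ‖ ^ (2 * m) *
    ‖𝓕 (fun y => (φ : SpaceTime d → Val n) (t, y)) ξ‖ ^ 2 with hIdef
  have hI0 : 0 ≤ I := integral_nonneg fun ξ => by positivity
  calc _ ≤ δ / ((ofOrder d m).card + 1) * ∑ α ∈ ofOrder d m, I := by
        gcongr with α hα
        exact hle α hα
    _ = δ * I * ((ofOrder d m).card / ((ofOrder d m).card + 1)) := by
        rw [Finset.sum_const, nsmul_eq_mul]; ring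
    _ ≤ δ * I * 1 := by
        gcongr
        rw [div_le_one (by positivity)]
        linarith
    _ = δ * I := mul_one _

end

end ParabolicSystem

/-! ### Existence and energy estimate on the whole space. -/

namespace ParabolicSystem

noncomputable section

open scoped InnerProductSpace

variable {d n m : ℕ}

/-! ### Integration by parts -/

/-- The Hermitian inner product as a real bilinear map. -/
def innerBilin (n : ℕ) : Val n →L[ℝ] Val n →L[ℝ] ℂ :=
  LinearMap.mkContinuous₂
    (LinearMap.mk₂ ℝ (fun v w : Val n => ⟪v, w⟫_ℂ) (fun _ _ _ => inner_add_left _ _ _)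
      (fun c v w => by rw [← Complex.coe_smul, inner_smul_left]; simp)
      (fun _ _ _ => inner_add_right _ _ _)
      (fun c v w => by rw [← Complex.coe_smul, inner_smul_right]; simp))
    1 (fun v w => by simpa using norm_inner_le_norm (𝕜 := ℂ) v w)

theorem integrable_inner_smooth {φ ψ : SpaceTime d → Val n} (h : Continuous φ)
    (hc : HasCompactSupport φ) (h' : Continuous ψ) :
    Integrable fun X => ⟪φ X, ψ X⟫_ℂ :=
  (h.inner h').integrable_of_hasCompactSupport (hc.mono fun X hX => by
    contrapose! hX
    simp [Function.notMem_support.mp hX])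

theorem integral_inner_listDeriv {φ ψ : SpaceTime d → Val n} (h : ContDiff ℝ ∞ φ)
    (hc : HasCompactSupport φ) (h' : ContDiff ℝ ∞ ψ) (l : List (SpaceTime d)) :
    ∫ X, ⟪listDeriv l φ X, ψ X⟫_ℂ = (-1) ^ l.length * ∫ X, ⟪φ X, listDeriv l ψ X⟫_ℂ := by
  induction l generalizing ψ with
  | nil => simp
  | cons v l ih =>
    have hl := contDiff_listDeriv h l
    have hlc := hasCompactSupport_listDeriv hc l
    have hv := contDiff_dirDeriv h' v
    have key := integral_bilinear_fderiv_right_eq_neg_left_of_integrable (μ := volume)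
      (f := listDeriv l φ) (g := ψ) (v := v) (B := innerBilin n)
      (integrable_inner_smooth (contDiff_dirDeriv hl v).continuous (hasCompactSupport_dirDeriv hlc v)
        h'.continuous)
      (integrable_inner_smooth hl.continuous hlc hv.continuous)
      (integrable_inner_smooth hl.continuous hlc h'.continuous)
      (fun X _ => hl.differentiable (by simp) X) (fun X _ => h'.differentiable (by simp) X)
    have k2 : ∫ X, ⟪listDeriv l φ X, dirDeriv v ψ X⟫_ℂ =
      - ∫ X, ⟪dirDeriv v (listDeriv l φ) X, ψ X⟫_ℂ := key
    rw [listDeriv_cons, listDeriv_cons, dirDeriv_listDeriv_comm h', List.length_cons, pow_succ,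
      mul_neg_one, neg_mul, ← ih hv, k2, neg_neg]

theorem inner_derivLp (α : MultiIndex d) (φ ψ : testSpace d n) :
    ⟪derivLp α φ, derivLp 0 ψ⟫_ℂ = (-1) ^ order α * ⟪derivLp 0 φ, derivLp α ψ⟫_ℂ := by
  have h := integral_inner_listDeriv φ.2.1 φ.2.2 ψ.2.1 (α.toList.map spaceVec)
  rw [List.length_map, MultiIndex.length_toList] at h
  rw [L2.inner_def, L2.inner_def]
  refine Eq.trans ?_ (h.trans ?_)
  · refine integral_congr_ae ?_
    filter_upwards [coeFn_derivLp α φ, coeFn_derivLp 0 ψ] with X h1 h2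
    rw [h1, h2, spaceDerivs_zero]; rfl
  · congr 1
    refine integral_congr_ae ?_
    filter_upwards [coeFn_derivLp 0 φ, coeFn_derivLp α ψ] with X h1 h2
    rw [h1, h2, spaceDerivs_zero]; rfl

/-! ### The variational problem -/

/-- The Hilbert space of the unknown `(λ^{1/2} u, (D^α u)_{|α| = m})`. -/
abbrev EnergySpace (d n m : ℕ) :=
  PiLp 2 fun _ : Option (ofOrder d m) => Lp (Val n) 2 (volume : Measure (SpaceTime d))

/-- `φ ↦ (λ^{1/2} φ, (D^α φ)_{|α| = m})`. -/
def energyMap (m : ℕ) (lam : ℝ) : testSpace d n →ₗ[ℂ] EnergySpace d n m where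
  toFun φ := WithLp.toLp 2 fun o =>
    o.elim (((√lam : ℝ) : ℂ) • derivLp 0 φ) fun α => derivLp (α : MultiIndex d) φ
  map_add' φ ψ := by ext1 o; cases o <;> simp
  map_smul' c φ := by
    ext1 o; cases o
    · change ((√lam : ℝ) : ℂ) • derivLp 0 (c • φ) = c • ((√lam : ℝ) : ℂ) • derivLp 0 φ
      rw [map_smul, smul_comm]
    · simp

theorem IsLegendreHadamard.measurable_conj {δ : ℝ}
    {A : MultiIndex d → MultiIndex d → ℝ → Matrix (Fin n) (Fin n) ℂ}
    (hA : IsLegendreHadamard m δ A) (α β : ofOrder d m) (i j : Fin n) :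
    Measurable fun t => (A α β t).conjTranspose i j :=
  Complex.continuous_conj.measurable.comp (hA.measurable α α.2 β β.2 j i)

theorem IsLegendreHadamard.bound_conj {δ : ℝ}
    {A : MultiIndex d → MultiIndex d → ℝ → Matrix (Fin n) (Fin n) ℂ}
    (hA : IsLegendreHadamard m δ A) (α β : ofOrder d m) (i j : Fin n) (t : ℝ) :
    ‖(A α β t).conjTranspose i j‖ ≤ δ⁻¹ := by
  rw [Matrix.conjTranspose_apply, norm_star]
  exact hA.bound α α.2 β β.2 j i t

/-- The adjoint operator `φ ↦ (λ^{1/2} φ - λ^{-1/2} φ_t, (∑_α (A^{αβ})^* D^α φ)_β)`. -/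
def adjointMap {δ : ℝ} {A : MultiIndex d → MultiIndex d → ℝ → Matrix (Fin n) (Fin n) ℂ}
    (hA : IsLegendreHadamard m δ A) (lam : ℝ) : testSpace d n →ₗ[ℂ] EnergySpace d n m where
  toFun φ := WithLp.toLp 2 fun o =>
    -- Paired with the first unknown `√λ v`, this entry produces `λ⟪φ, v⟫ - ⟪φ_t, v⟫`.
    o.elim (((√lam : ℝ) : ℂ) • derivLp 0 φ - (((√lam)⁻¹ : ℝ) : ℂ) • timeLp φ) fun β =>
      ∑ α : ofOrder d m, matLp (fun t => (A α β t).conjTranspose) (hA.measurable_conj α β)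
        (hA.bound_conj α β) (derivLp (α : MultiIndex d) φ)
  map_add' φ ψ := by
    ext1 o; cases o
    · simp only [map_add, smul_add, PiLp.add_apply, Option.elim]; abel
    · simp [Finset.sum_add_distrib]
  map_smul' c φ := by
    ext1 o; cases o
    · change ((√lam : ℝ) : ℂ) • derivLp 0 (c • φ) - (((√lam)⁻¹ : ℝ) : ℂ) • timeLp (c • φ) =
        c • (((√lam : ℝ) : ℂ) • derivLp 0 φ - (((√lam)⁻¹ : ℝ) : ℂ) • timeLp φ)
      rw [map_smul, map_smul, smul_sub, smul_comm c, smul_comm c]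
    · simp [Finset.smul_sum]

theorem norm_energyMap_sq {lam : ℝ} (hl : 0 < lam) (φ : testSpace d n) :
    ‖energyMap m lam φ‖ ^ 2 = lam * ‖derivLp 0 φ‖ ^ 2 + ∑ α ∈ ofOrder d m, ‖derivLp α φ‖ ^ 2 := by
  rw [PiLp.norm_sq_eq_of_L2, Fintype.sum_option]
  congr 1
  · simp only [energyMap, LinearMap.coe_mk, AddHom.coe_mk, Option.elim, norm_smul, mul_pow]
    rw [Complex.norm_real, Real.norm_eq_abs, sq_abs, Real.sq_sqrt hl.le]
  · exact Finset.sum_coe_sort (ofOrder d m) fun α => ‖derivLp α φ‖ ^ 2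

theorem energyMap_injective {lam : ℝ} (hl : 0 < lam) :
    Function.Injective (energyMap (d := d) (n := n) m lam) := by
  refine (injective_iff_map_eq_zero _).mpr fun φ h0 => ?_
  have h1 := norm_energyMap_sq (m := m) hl φ
  rw [h0, norm_zero] at h1
  have h2 : 0 ≤ ∑ α ∈ ofOrder d m, ‖derivLp α φ‖ ^ 2 := Finset.sum_nonneg fun _ _ => sq_nonneg _
  have h3 : ‖derivLp 0 φ‖ ^ 2 = 0 := by
    have := sq_nonneg ‖derivLp 0 φ‖
    nlinarith [mul_nonneg hl.le this]
  have h4 : derivLp 0 φ = 0 := norm_eq_zero.mp (pow_eq_zero_iff (by norm_num) |>.mp h3)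
  have h5 : (φ : SpaceTime d → Val n) =ᵐ[volume] 0 := by
    filter_upwards [coeFn_derivLp 0 φ, Lp.coeFn_zero (Val n) 2 (volume : Measure (SpaceTime d))]
      with X hX h0
    rw [h4, h0, spaceDerivs_zero] at hX
    exact hX.symm
  exact Subtype.ext ((Continuous.ae_eq_iff_eq volume φ.2.1.continuous continuous_const).mp h5)

theorem inner_matLp_conjTranspose (B : ℝ → Matrix (Fin n) (Fin n) ℂ)
    (hB : ∀ i j, Measurable fun t => (B t).conjTranspose i j) {K : ℝ}
    (hK : ∀ i j t, ‖(B t).conjTranspose i j‖ ≤ K)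
    (g h : Lp (Val n) 2 (volume : Measure (SpaceTime d))) :
    ⟪matLp (fun t => (B t).conjTranspose) hB hK g, h⟫_ℂ = ∫ X, ⟪g X, matVec (B X.1) (h X)⟫_ℂ := by
  rw [L2.inner_def]
  refine integral_congr_ae ?_
  filter_upwards [coeFn_matLp (fun t => (B t).conjTranspose) hB hK g] with X hX
  rw [hX, inner_matVec_conjTranspose]

/-- The time derivative drops out of the real part, the zeroth component gives `λ‖φ‖²` exactly, and
Gårding's inequality handles the derivatives of order `m`. -/
theorem coercive_energyMap {δ : ℝ} (hδ : 0 < δ)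
    {A : MultiIndex d → MultiIndex d → ℝ → Matrix (Fin n) (Fin n) ℂ}
    (hA : IsLegendreHadamard m δ A) {lam : ℝ} (hl : 0 < lam) (φ : testSpace d n) :
    min 1 (δ / ((ofOrder d m).card + 1)) * ‖energyMap m lam φ‖ ^ 2 ≤
      (⟪energyMap m lam φ, adjointMap hA lam φ⟫_ℂ).re := by
  have hco := hA.coercive hδ φ
  have e1 : (∑ β : ofOrder d m, ⟪derivLp (β : MultiIndex d) φ,
      ∑ α : ofOrder d m, matLp (fun t => (A α β t).conjTranspose) (hA.measurable_conj α β)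
        (hA.bound_conj α β) (derivLp (α : MultiIndex d) φ)⟫_ℂ).re =
      (∑ α ∈ ofOrder d m, ∑ β ∈ ofOrder d m,
        ∫ X, ⟪spaceDerivs α (φ : SpaceTime d → Val n) X,
          matVec (A α β X.1) (spaceDerivs β (φ : SpaceTime d → Val n) X)⟫_ℂ).re := by
    -- A number and its conjugate have the same real part; conjugating swaps the slots and lets the
    -- adjoint matrices move across the inner product.
    rw [← Complex.conj_re, map_sum]
    simp_rw [inner_conj_symm, sum_inner]
    rw [Finset.sum_comm, ← Finset.sum_coe_sort (ofOrder d m)]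
    congr 1
    refine Finset.sum_congr rfl fun α _ => ?_
    rw [← Finset.sum_coe_sort (ofOrder d m)]
    refine Finset.sum_congr rfl fun β _ => ?_
    rw [inner_matLp_conjTranspose]
    refine integral_congr_ae ?_
    filter_upwards [coeFn_derivLp (α : MultiIndex d) φ, coeFn_derivLp (β : MultiIndex d) φ]
      with X h1 h2
    rw [h1, h2]
  have e2 : (⟪((√lam : ℝ) : ℂ) • derivLp 0 φ,
      ((√lam : ℝ) : ℂ) • derivLp 0 φ - (((√lam)⁻¹ : ℝ) : ℂ) • timeLp φ⟫_ℂ).re =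
      lam * ‖derivLp 0 φ‖ ^ 2 := by
    rw [inner_sub_right, inner_smul_left, inner_smul_right, inner_smul_left, inner_smul_right,
      Complex.conj_ofReal, ← mul_assoc, ← mul_assoc, ← Complex.ofReal_mul, ← Complex.ofReal_mul,
      Complex.sub_re, Complex.re_ofReal_mul, Complex.re_ofReal_mul, re_inner_timeLp,
      Real.mul_self_sqrt hl.le, mul_zero, sub_zero]
    congr 1
    exact inner_self_eq_norm_sq (𝕜 := ℂ) _
  rw [PiLp.inner_apply, Fintype.sum_option, norm_energyMap_sq hl, Complex.add_re]
  refine le_trans ?_ (le_of_eq (congrArg₂ (· + ·) e2.symm e1.symm))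
  have h1 : 0 ≤ ∑ α ∈ ofOrder d m, ‖derivLp α φ‖ ^ 2 := Finset.sum_nonneg fun _ _ => sq_nonneg _
  have h2 : 0 ≤ lam * ‖derivLp 0 φ‖ ^ 2 := by positivity
  rw [mul_add]
  refine add_le_add ?_ (le_trans ?_ hco)
  · calc _ ≤ 1 * (lam * ‖derivLp 0 φ‖ ^ 2) := by gcongr; exact min_le_left _ _
      _ = _ := one_mul _
  · gcongr
    exact min_le_right _ _

/-- Interpolation with `μ = λ^(1/m)`, the choice for which `μ^m ‖φ‖²` is the zeroth part of the
energy. It is the source of the weights `λ^(|β|/(2m) - 1/2)` on the data. -/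
theorem norm_derivLp_le {lam : ℝ} (hl : 0 < lam) (hm : 1 ≤ m) {β : MultiIndex d} (hβ : order β ≤ m)
    (φ : testSpace d n) :
    ‖derivLp β φ‖ ≤ √(d ^ m + 1) * lam ^ ((order β : ℝ) / (2 * (m : ℝ)) - (1 / 2 : ℝ)) *
      ‖energyMap m lam φ‖ := by
  have hm0 : (m : ℝ) ≠ 0 := by positivity
  set μ := lam ^ (1 / (m : ℝ)) with hμ
  have hμ0 : 0 < μ := Real.rpow_pos_of_pos hl _
  have hμm : μ ^ m = lam := by
    rw [hμ, ← Real.rpow_natCast, ← Real.rpow_mul hl.le, one_div_mul_cancel hm0, Real.rpow_one]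
  have h := norm_derivLp_interpolation hμ0 hβ φ
  rw [hμm, ← norm_energyMap_sq hl] at h
  refine (sq_le_sq₀ (norm_nonneg _) (by positivity)).mp ?_
  rw [mul_pow, mul_pow, Real.sq_sqrt (by positivity)]
  have e : (lam ^ ((order β : ℝ) / (2 * (m : ℝ)) - (1 / 2 : ℝ))) ^ 2 = (μ ^ (m - order β))⁻¹ := by
    rw [hμ, ← Real.rpow_natCast, ← Real.rpow_natCast, ← Real.rpow_mul hl.le, ← Real.rpow_mul hl.le,
      ← Real.rpow_neg hl.le, Nat.cast_sub hβ]
    congr 1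
    field_simp
    push_cast
    ring
  rw [e, mul_assoc, mul_comm _⁻¹, ← mul_assoc, ← div_eq_mul_inv, le_div_iff₀ (by positivity)]
  linarith

/-! ### Global weak solutions -/

/-- The vector-valued test function `φ e`. -/
def testVec {φ : SpaceTime d → ℝ} {U : Set (SpaceTime d)} (h : IsTestFunction U φ) (e : Val n) :
    testSpace d n :=
  ⟨fun X => φ X • e, h.smooth.smul contDiff_const, h.compact.smul_right⟩

theorem derivLp_testVec {φ : SpaceTime d → ℝ} {U : Set (SpaceTime d)} (h : IsTestFunction U φ)
    (e : Val n) (α : MultiIndex d) :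
    derivLp α (testVec h e) =ᵐ[volume] fun X => spaceDerivs α φ X • e := by
  refine (coeFn_derivLp α _).trans (.of_forall fun X => ?_)
  exact congrFun (spaceDerivs_clm_comp h.smooth
    ((ContinuousLinearMap.id ℝ ℝ).smulRight e) α) X

theorem timeLp_testVec {φ : SpaceTime d → ℝ} {U : Set (SpaceTime d)} (h : IsTestFunction U φ)
    (e : Val n) :
    timeLp (testVec h e) =ᵐ[volume] fun X => dirDeriv timeVec φ X • e := by
  refine (coeFn_timeLp _).trans (.of_forall fun X => ?_)
  exact congrFun (dirDeriv_clm_comp h.smooth ((ContinuousLinearMap.id ℝ ℝ).smulRight e) timeVec) X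

theorem inner_real_smul (r : ℝ) (e w : Val n) : ⟪r • e, w⟫_ℂ = ⟪e, r • w⟫_ℂ := by
  rw [← Complex.coe_smul, ← Complex.coe_smul, inner_smul_left, inner_smul_right,
    Complex.conj_ofReal]

theorem integrable_smul_of_memLp {θ : SpaceTime d → ℝ} (hθ : Continuous θ)
    (hc : HasCompactSupport θ) {g : SpaceTime d → Val n} (hg : MemLp g 2) :
    Integrable fun X => θ X • g X :=
  (hg.locallyIntegrable one_le_two).integrable_smul_left_of_hasCompactSupport hθ hc

theorem inner_eq_inner_integral {θ : SpaceTime d → ℝ} (hθ : Continuous θ)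
    (hc : HasCompactSupport θ) (e : Val n)
    (f g : Lp (Val n) 2 (volume : Measure (SpaceTime d))) (hf : f =ᵐ[volume] fun X => θ X • e) :
    ⟪f, g⟫_ℂ = ⟪e, ∫ X, θ X • g X⟫_ℂ := by
  rw [L2.inner_def, ← integral_inner (integrable_smul_of_memLp hθ hc (Lp.memLp g))]
  refine integral_congr_ae ?_
  filter_upwards [hf] with X hX
  rw [hX, inner_real_smul]

/-- Solvability of the system in the whole space, with the energy estimate. -/
theorem exists_global_solution (d n m : ℕ) (hm : 1 ≤ m) {δ : ℝ} (hδ : 0 < δ) :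
    ∃ C : ℝ, 0 < C ∧ ∀ A : MultiIndex d → MultiIndex d → ℝ → Matrix (Fin n) (Fin n) ℂ,
      IsLegendreHadamard m δ A → ∀ lam : ℝ, 0 < lam →
      ∀ G : MultiIndex d → Lp (Val n) 2 (volume : Measure (SpaceTime d)),
      ∃ (v : Lp (Val n) 2 (volume : Measure (SpaceTime d)))
        (V : MultiIndex d → Lp (Val n) 2 (volume : Measure (SpaceTime d))),
        √lam * ‖v‖ ≤ C * ∑ β ∈ ofOrderLE d m,
          lam ^ ((order β : ℝ) / (2 * (m : ℝ)) - (1 / 2 : ℝ)) * ‖G β‖ ∧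
        (∀ α ∈ ofOrder d m, ‖V α‖ ≤ C * ∑ β ∈ ofOrderLE d m,
          lam ^ ((order β : ℝ) / (2 * (m : ℝ)) - (1 / 2 : ℝ)) * ‖G β‖) ∧
        (∀ α ∈ ofOrder d m, ∀ φ : SpaceTime d → ℝ, IsTestFunction Set.univ φ →
          ∫ X, spaceDerivs α φ X • v X = (-1 : ℝ) ^ m • ∫ X, φ X • V α X) ∧
        ∀ φ : SpaceTime d → ℝ, IsTestFunction Set.univ φ →
          -(∫ X, dirDeriv timeVec φ X • v X) +
            (∑ α ∈ ofOrder d m, ∑ β ∈ ofOrder d m,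
              ∫ X, spaceDerivs α φ X • matVec (A α β X.1) (V β X)) +
            lam • ∫ X, φ X • v X =
          ∑ β ∈ ofOrderLE d m, (-1 : ℝ) ^ order β • ∫ X, spaceDerivs β φ X • G β X := by
  set c := min 1 (δ / ((ofOrder d m).card + 1)) with hc
  have hc0 : 0 < c := lt_min one_pos (by positivity)
  refine ⟨√(d ^ m + 1) / c, by positivity, fun A hA lam hl G => ?_⟩
  have hsl : 0 < √lam := Real.sqrt_pos.mpr hl
  -- The right-hand side `∑ D^β G_β`, with all derivatives moved onto the test function.
  let F : testSpace d n →ₗ[ℂ] ℂ := ∑ β ∈ ofOrderLE d m,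
    ((-1 : ℂ) ^ order β) • ((innerSL ℂ (G β) : _ →ₗ[ℂ] ℂ).comp (derivLp β))
  have hFa (φ : testSpace d n) :
      F φ = ∑ β ∈ ofOrderLE d m, (-1 : ℂ) ^ order β * ⟪G β, derivLp β φ⟫_ℂ := by
    simp [F]
  set S := ∑ β ∈ ofOrderLE d m,
    lam ^ ((order β : ℝ) / (2 * (m : ℝ)) - (1 / 2 : ℝ)) * ‖G β‖ with hS
  have hS0 : 0 ≤ S := Finset.sum_nonneg fun β _ => by positivity
  obtain ⟨x, hxX, hxn, hx⟩ := exists_inner_eq_of_coercive (energyMap m lam) (adjointMap hA lam)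
    (energyMap_injective hl) F hc0 (coercive_energyMap hδ hA hl) (N := √(d ^ m + 1) * S)
    (by positivity) (fun φ => by
      rw [hFa]
      refine (norm_sum_le _ _).trans ?_
      rw [hS, Finset.mul_sum, Finset.sum_mul]
      refine Finset.sum_le_sum fun β hβ => ?_
      rw [norm_mul, norm_pow, norm_neg, norm_one, one_pow, one_mul]
      refine (norm_inner_le_norm _ _).trans ?_
      calc _ ≤ ‖G β‖ * _ := mul_le_mul_of_nonneg_left
              (norm_derivLp_le hl hm (mem_ofOrderLE.mp hβ) φ) (norm_nonneg _)
        _ = _ := by ring)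
  have hcomp (o : Option (ofOrder d m)) : ‖x o‖ ≤ √(d ^ m + 1) / c * S := by
    refine (PiLp.norm_apply_le x o).trans (hxn.trans (le_of_eq ?_))
    ring
  -- the weak derivatives
  have hweak (α : ofOrder d m) (ψ : testSpace d n) :
      ⟪derivLp (α : MultiIndex d) ψ, x none⟫_ℂ =
        (-1) ^ m * ((√lam : ℝ) : ℂ) * ⟪derivLp 0 ψ, x (some α)⟫_ℂ := by
    have hcont (o : Option (ofOrder d m)) : Continuous fun y : EnergySpace d n m => y o :=
      PiLp.continuous_apply 2 _ o
    -- On the range of `energyMap` the component at `α` is `D^α` of the zeroth one, up to `√λ`.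
    -- Tested against a fixed `ψ` this is a closed condition, so it survives on the closure, where
    -- the solution lies.
    have hclosed : IsClosed {y : EnergySpace d n m | ⟪derivLp (α : MultiIndex d) ψ, y none⟫_ℂ =
        (-1) ^ m * ((√lam : ℝ) : ℂ) * ⟪derivLp 0 ψ, y (some α)⟫_ℂ} :=
      isClosed_eq (continuous_const.inner (hcont none))
        (continuous_const.mul (continuous_const.inner (hcont (some α))))
    refine closure_minimal ?_ hclosed hxX
    rintro _ ⟨φ, rfl⟩
    simp only [Set.mem_ofPred_eq, energyMap, LinearMap.coe_mk, AddHom.coe_mk, Option.elim]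
    rw [inner_smul_right, inner_derivLp, mem_ofOrder.mp α.2]
    ring
  refine ⟨(((√lam)⁻¹ : ℝ) : ℂ) • x none,
    fun α => if h : α ∈ ofOrder d m then x (some ⟨α, h⟩) else 0, ?_, ?_, ?_, ?_⟩
  · rw [norm_smul, Complex.norm_real, Real.norm_eq_abs, abs_of_pos (inv_pos.mpr hsl), ← mul_assoc,
      mul_inv_cancel₀ hsl.ne', one_mul]
    exact hcomp none
  · intro α hα
    simp only [hα, dif_pos]
    exact hcomp _
  · intro α hα φ hφ
    simp only [hα, dif_pos]
    refine ext_inner_left ℂ fun e => ?_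
    have h1 := hweak ⟨α, hα⟩ (testVec hφ e)
    have t1 := inner_eq_inner_integral (contDiff_spaceDerivs hφ.smooth α).continuous
      (hasCompactSupport_spaceDerivs hφ.compact α) e _ ((((√lam)⁻¹ : ℝ) : ℂ) • x none)
      (derivLp_testVec hφ e α)
    have t2 := inner_eq_inner_integral hφ.smooth.continuous hφ.compact e _ (x (some ⟨α, hα⟩))
      (by simpa only [spaceDerivs_zero] using derivLp_testVec hφ e 0)
    rw [← t1, inner_smul_right, h1, t2, ← Complex.coe_smul, inner_smul_right]
    have : (((√lam)⁻¹ : ℝ) : ℂ) * ((√lam : ℝ) : ℂ) = 1 := by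
      rw [← Complex.ofReal_mul, inv_mul_cancel₀ hsl.ne', Complex.ofReal_one]
    push_cast at this ⊢
    linear_combination ((-1 : ℂ) ^ m * ⟪e, ∫ X, φ X • x (some ⟨α, hα⟩) X⟫_ℂ) * this
  · intro φ hφ
    refine ext_inner_left ℂ fun e => ?_
    set v : Lp (Val n) 2 (volume : Measure (SpaceTime d)) := (((√lam)⁻¹ : ℝ) : ℂ) • x none with hv
    have hxv : x none = ((√lam : ℝ) : ℂ) • v := by
      rw [hv, smul_smul, ← Complex.ofReal_mul, mul_inv_cancel₀ hsl.ne', Complex.ofReal_one, one_smul]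
    clear_value v
    have hφ0 : derivLp 0 (testVec hφ e) =ᵐ[volume] fun X => φ X • e := by
      simpa only [spaceDerivs_zero] using derivLp_testVec hφ e 0
    have t1 := inner_eq_inner_integral (contDiff_dirDeriv hφ.smooth timeVec).continuous
      (hasCompactSupport_dirDeriv hφ.compact timeVec) e _ v (timeLp_testVec hφ e)
    have t2 := inner_eq_inner_integral hφ.smooth.continuous hφ.compact e _ v hφ0
    have t3 (β : MultiIndex d) := inner_eq_inner_integral
      (contDiff_spaceDerivs hφ.smooth β).continuous
      (hasCompactSupport_spaceDerivs hφ.compact β) e _ (G β) (derivLp_testVec hφ e β)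
    have t4 (α β : ofOrder d m) :
        ⟪matLp (fun t => (A α β t).conjTranspose) (hA.measurable_conj α β)
          (hA.bound_conj α β) (derivLp (α : MultiIndex d) (testVec hφ e)), x (some β)⟫_ℂ =
        ⟪e, ∫ X, spaceDerivs α φ X • matVec (A α β X.1) (x (some β) X)⟫_ℂ := by
      have hm2 := memLp_matVec (B := fun X : SpaceTime d => A α β X.1)
        (fun i j => (hA.measurable α α.2 β β.2 i j).comp measurable_fst)
        (fun i j X => hA.bound α α.2 β β.2 i j X.1) (Lp.memLp (x (some β)))
      rw [inner_matLp_conjTranspose, ← integral_inner (integrable_smul_of_memLp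
        (contDiff_spaceDerivs hφ.smooth (α : MultiIndex d)).continuous
        (hasCompactSupport_spaceDerivs hφ.compact (α : MultiIndex d)) hm2)]
      refine integral_congr_ae ?_
      filter_upwards [derivLp_testVec hφ e (α : MultiIndex d)] with X hX
      rw [hX, inner_real_smul]
    have hE := hx (testVec hφ e)
    -- The abstract solution stands in the conjugate-linear slot; conjugating the identity moves it
    -- to the linear one, as in the integrals of the weak formulation.
    rw [← inner_conj_symm] at hE
    replace hE := congrArg (starRingEnd ℂ) hE
    rw [Complex.conj_conj, hFa, map_sum, PiLp.inner_apply, Fintype.sum_option] at hE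
    simp only [adjointMap, LinearMap.coe_mk, AddHom.coe_mk, Option.elim] at hE
    simp only [sum_inner, t4] at hE
    rw [hxv, inner_sub_left, inner_smul_left, inner_smul_left, inner_smul_right, inner_smul_right,
      t1, t2, Complex.conj_ofReal, Complex.conj_ofReal] at hE
    have hR : ∑ β ∈ ofOrderLE d m, (starRingEnd ℂ)
          ((-1 : ℂ) ^ order β * ⟪G β, derivLp β (testVec hφ e)⟫_ℂ) =
        ⟪e, ∑ β ∈ ofOrderLE d m, (-1 : ℝ) ^ order β • ∫ X, spaceDerivs β φ X • G β X⟫_ℂ := by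
      rw [inner_sum]
      refine Finset.sum_congr rfl fun β _ => ?_
      rw [map_mul, inner_conj_symm, t3, ← Complex.coe_smul, inner_smul_right]
      simp
    rw [hR] at hE
    rw [← hE, inner_add_right, inner_add_right, inner_neg_right, ← Complex.coe_smul lam,
      inner_smul_right]
    have hA2 : ⟪e, ∑ α ∈ ofOrder d m, ∑ β ∈ ofOrder d m, ∫ X, spaceDerivs α φ X • matVec (A α β X.1)
        ((if h : β ∈ ofOrder d m then x (some ⟨β, h⟩) else 0 :
          Lp (Val n) 2 (volume : Measure (SpaceTime d))) X)⟫_ℂ =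
        ∑ β : ofOrder d m, ∑ α : ofOrder d m,
          ⟪e, ∫ X, spaceDerivs α φ X • matVec (A α β X.1) (x (some β) X)⟫_ℂ := by
      rw [Finset.sum_comm, inner_sum, ← Finset.sum_coe_sort (ofOrder d m)]
      refine Finset.sum_congr rfl fun β _ => ?_
      rw [inner_sum, ← Finset.sum_coe_sort (ofOrder d m)]
      refine Finset.sum_congr rfl fun α _ => ?_
      simp only [β.2, dif_pos]
    rw [hA2]
    have h1 : ((√lam : ℝ) : ℂ) * ((√lam : ℝ) : ℂ) = (lam : ℂ) := by
      rw [← Complex.ofReal_mul, Real.mul_self_sqrt hl.le]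
    have h2 : (((√lam)⁻¹ : ℝ) : ℂ) * ((√lam : ℝ) : ℂ) = 1 := by
      rw [← Complex.ofReal_mul, inv_mul_cancel₀ hsl.ne', Complex.ofReal_one]
    linear_combination -⟪e, ∫ X, φ X • v X⟫_ℂ * h1 + ⟪e, ∫ X, dirDeriv timeVec φ X • v X⟫_ℂ * h2

end

end ParabolicSystem

namespace ParabolicSystem

noncomputable section

open scoped InnerProductSpace

variable {d n m : ℕ}

/-! ### Weak solutions of ordinary differential equations -/

/-- Cauchy-Schwarz against the constant 1, obtained by expanding `∫ (M f - I)² ≥ 0` with `M` the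
total mass and `I` the integral of `f`. -/
theorem sq_integral_le {X : Type*} [MeasurableSpace X] {μ : Measure X} [IsFiniteMeasure μ]
    {f : X → ℝ} (hf : MemLp f 2 μ) : (∫ x, f x ∂μ) ^ 2 ≤ μ.real Set.univ * ∫ x, f x ^ 2 ∂μ := by
  have h1 : Integrable f μ := hf.integrable one_le_two
  have h2 : Integrable (fun x => f x ^ 2) μ := hf.integrable_sq
  set I := ∫ x, f x ∂μ with hI
  set M := μ.real Set.univ with hM
  rcases (measureReal_nonneg : 0 ≤ M).eq_or_lt with h0 | h0
  · have hμ : μ = 0 := Measure.measure_univ_eq_zero.mp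
      ((measureReal_eq_zero_iff (measure_ne_top μ _)).mp h0.symm)
    have : I = 0 := by rw [hI, hμ]; simp
    rw [this, zero_pow two_ne_zero]
    exact mul_nonneg h0.le (integral_nonneg fun _ => sq_nonneg _)
  · have h3 : 0 ≤ ∫ x, (M * f x - I) ^ 2 ∂μ := integral_nonneg fun x => sq_nonneg _
    have h4 : ∫ x, (M * f x - I) ^ 2 ∂μ = M ^ 2 * ∫ x, f x ^ 2 ∂μ - M * I ^ 2 := by
      have : (fun x => (M * f x - I) ^ 2) =
          fun x => (M ^ 2 * f x ^ 2 - (2 * M * I) * f x) + I ^ 2 := by funext x; ring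
      have i1 : Integrable (fun x => M ^ 2 * f x ^ 2 - (2 * M * I) * f x) μ :=
        (h2.const_mul _).sub (h1.const_mul _)
      rw [this, integral_add i1 (integrable_const _), integral_sub (h2.const_mul _) (h1.const_mul _), integral_const_mul, integral_const_mul,
        integral_const, smul_eq_mul, ← hI, ← hM]
      ring
    rw [h4] at h3
    by_contra hlt
    push Not at hlt
    nlinarith

/-- The product rule for absolutely continuous functions: `f` is only integrable, so the primitive
is differentiable merely almost everywhere. -/
theorem sq_primitive {f : ℝ → ℝ} {a b : ℝ} (hf : IntervalIntegrable f volume a b) :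
    (∫ s in a..b, f s) ^ 2 = ∫ s in a..b, 2 * ((∫ r in a..s, f r) * f s) := by
  have hac := hf.absolutelyContinuousOnInterval_intervalIntegral (c := a) Set.left_mem_uIcc
  have h := hac.integral_deriv_mul_eq_sub hac
  simp only [intervalIntegral.integral_same, mul_zero, sub_zero] at h
  rw [sq, ← h]
  refine intervalIntegral.integral_congr_ae ?_
  filter_upwards [hf.ae_hasDerivAt_integral] with x hx hx'
  rw [(hx (Set.uIoc_subset_uIcc hx') a Set.left_mem_uIcc).deriv]
  ring

/-- The energy identity for `y' = h`, `y(a) = 0`. It is the sum of the scalar identities for the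
real and imaginary parts of the components. -/
theorem norm_sq_primitive {h : ℝ → Val n} {a b : ℝ} (hab : a ≤ b)
    (hh : IntervalIntegrable h volume a b) :
    ‖∫ s in a..b, h s‖ ^ 2 = ∫ s in a..b, 2 * (⟪∫ r in a..s, h r, h s⟫_ℂ).re := by
  have hsub (s : ℝ) (hs : s ∈ Set.Icc a b) : IntervalIntegrable h volume a s :=
    hh.mono_set (by rw [Set.uIcc_of_le hs.1, Set.uIcc_of_le hab]; exact Set.Icc_subset_Icc_right hs.2)
  let Lre (i : Fin n) : Val n →L[ℝ] ℝ :=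
    Complex.reCLM.comp ((EuclideanSpace.proj (𝕜 := ℂ) i).restrictScalars ℝ)
  let Lim (i : Fin n) : Val n →L[ℝ] ℝ :=
    Complex.imCLM.comp ((EuclideanSpace.proj (𝕜 := ℂ) i).restrictScalars ℝ)
  have hinner (v w : Val n) : (⟪v, w⟫_ℂ).re = ∑ i, (Lre i v * Lre i w + Lim i v * Lim i w) := by
    simp only [PiLp.inner_apply, RCLike.inner_apply, Complex.re_sum, Complex.mul_re,
      Complex.conj_re, Complex.conj_im]
    exact Finset.sum_congr rfl fun i _ => by simp [Lre, Lim]; ring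
  have hint (L : Val n →L[ℝ] ℝ) : IntervalIntegrable (fun s => L (h s)) volume a b :=
    ⟨L.integrable_comp hh.1, L.integrable_comp hh.2⟩
  have hL (L : Val n →L[ℝ] ℝ) (s : ℝ) (hs : s ∈ Set.Icc a b) :
      L (∫ r in a..s, h r) = ∫ r in a..s, L (h r) :=
    (L.intervalIntegral_comp_comm (hsub s hs)).symm
  have hbb : b ∈ Set.Icc a b := ⟨hab, le_rfl⟩
  have hii (L : Val n →L[ℝ] ℝ) :
      IntervalIntegrable (fun s => 2 * ((∫ r in a..s, L (h r)) * L (h s))) volume a b := by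
    refine ((hint L).continuousOn_mul ?_).const_mul 2
    exact intervalIntegral.continuousOn_primitive_interval' (hint L) Set.left_mem_uIcc
  have h1 : ‖∫ s in a..b, h s‖ ^ 2 = (⟪∫ s in a..b, h s, ∫ s in a..b, h s⟫_ℂ).re :=
    (inner_self_eq_norm_sq (𝕜 := ℂ) _).symm
  rw [h1, hinner]
  have h2 : ∫ s in a..b, 2 * (⟪∫ r in a..s, h r, h s⟫_ℂ).re =
      ∫ s in a..b, ∑ i, (2 * ((∫ r in a..s, Lre i (h r)) * Lre i (h s)) +
        2 * ((∫ r in a..s, Lim i (h r)) * Lim i (h s))) := by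
    refine intervalIntegral.integral_congr fun s hs => ?_
    rw [Set.uIcc_of_le hab] at hs
    simp only [hinner, hL _ s hs, Finset.mul_sum]
    exact Finset.sum_congr rfl fun i _ => by ring
  rw [h2, intervalIntegral.integral_finsetSum fun i _ => (hii (Lre i)).add (hii (Lim i))]
  refine Finset.sum_congr rfl fun i _ => ?_
  rw [intervalIntegral.integral_add (hii _) (hii _), ← sq_primitive (hint (Lre i)),
    ← sq_primitive (hint (Lim i)), hL _ b hbb, hL _ b hbb, sq, sq]

/-- A function on `(-1, 0)` with weak derivative `h` that vanishes near `-1` is the primitive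
of `h`. -/
theorem ae_eq_primitive {y h : ℝ → Val n} (hy : Integrable y) (hh : Integrable h)
    (hy0 : ∀ t ≤ -1, y t = 0) (hh0 : ∀ t ≤ -1, h t = 0)
    (H : ∀ η : ℝ → ℝ, ContDiff ℝ ∞ η → HasCompactSupport η → tsupport η ⊆ Set.Iio 0 →
      ∫ t, deriv η t • y t = -∫ t, η t • h t) :
    ∀ᵐ t, t ∈ Set.Iio (0 : ℝ) → y t = ∫ s in Set.Iic t, h s := by
  have hP : Continuous fun t => ∫ s in Set.Iic t, h s := by
    have e : (fun t => ∫ s in Set.Iic t, h s) =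
        fun t => (∫ s in Set.Iic 0, h s) + ∫ s in (0:ℝ)..t, h s := by
      funext t
      rw [← intervalIntegral.integral_Iic_sub_Iic hh.integrableOn hh.integrableOn]; abel
    rw [e]
    exact continuous_const.add (intervalIntegral.continuous_primitive
      (fun _ _ => hh.intervalIntegrable) 0)
  have key : ∀ᵐ t, t ∈ Set.Iio (0 : ℝ) → y t - ∫ s in Set.Iic t, h s = 0 := by
    refine isOpen_Iio.ae_eq_zero_of_integral_contDiff_smul_eq_zero
      ((hy.locallyIntegrable.sub hP.locallyIntegrable).locallyIntegrableOn _) ?_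
    intro ψ hψ hψc hψs
    have hψi : Integrable ψ := hψ.continuous.integrable_of_hasCompactSupport hψc
    -- the primitive of the test function
    set Ψ : ℝ → ℝ := fun t => ∫ s in (0:ℝ)..t, ψ s with hΨ
    have hΨd (t : ℝ) : HasDerivAt Ψ (ψ t) t := hψ.continuous.integral_hasStrictDerivAt 0 t |>.hasDerivAt
    have hΨs : ContDiff ℝ ∞ Ψ := by
      rw [contDiff_infty_iff_deriv]
      refine ⟨fun t => (hΨd t).differentiableAt, ?_⟩
      rwa [show deriv Ψ = ψ from funext fun t => (hΨd t).deriv]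
    obtain ⟨ε, hε, hεψ⟩ : ∃ ε > 0, ∀ t, -ε ≤ t → ψ t = 0 := by
      rcases (tsupport ψ).eq_empty_or_nonempty with he | hne
      · exact ⟨1, one_pos, fun t _ => by
          by_contra h0
          have := subset_tsupport ψ h0
          rw [he] at this
          exact this⟩
      · obtain ⟨b, hb, hbm⟩ := IsCompact.exists_isMaxOn hψc hne continuousOn_id
        have hb0 : b < 0 := hψs hb
        refine ⟨-b / 2, by linarith, fun t ht => ?_⟩
        by_contra h0
        have : t ≤ b := hbm (subset_tsupport ψ h0)
        linarith
    have hΨ0 (t : ℝ) (ht : -ε ≤ t) : Ψ t = 0 := by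
      rw [hΨ]
      refine (intervalIntegral.integral_congr (g := fun _ => (0:ℝ)) fun s hs => ?_).trans (by simp)
      refine hεψ s ?_
      rcases Set.mem_uIcc.mp hs with h | h <;> linarith [h.1, h.2]
    have hΨI (s : ℝ) : ∫ t in Set.Ici s, ψ t = -Ψ s := by
      have h1 : ∫ t in Set.Ioi (0:ℝ), ψ t = 0 :=
        setIntegral_eq_zero_of_forall_eq_zero fun t ht => hεψ t (by
          have : 0 < t := ht
          linarith)
      rw [integral_Ici_eq_integral_Ioi, ← intervalIntegral.integral_interval_add_Ioi
        hψi.integrableOn hψi.integrableOn (b := 0), h1, add_zero, intervalIntegral.integral_symm]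
    -- The cutoff restores compact support on the left. It equals 1 for `t ≥ -1`, and for `t ≤ -1`
    -- both `y` and `h` vanish, so no integral changes.
    set χ : ℝ → ℝ := fun t => Real.smoothTransition (t + 2) with hχ
    have hχs : ContDiff ℝ ∞ χ := Real.smoothTransition.contDiff.comp (contDiff_id.add contDiff_const)
    have hη := H (fun t => χ t * Ψ t) (hχs.mul hΨs) (by
      refine HasCompactSupport.intro (isCompact_Icc (a := -2) (b := -ε)) fun t ht => ?_
      rcases lt_or_ge t (-2) with h2 | h2
      · rw [hχ]; simp [Real.smoothTransition.zero_of_nonpos (show t + 2 ≤ 0 by linarith)]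
      · rw [hΨ0 t ?_, mul_zero]
        by_contra hlt
        exact ht ⟨h2, by linarith⟩) (by
      refine (closure_minimal (t := Set.Iic (-ε)) (fun t ht => ?_) isClosed_Iic).trans
        (fun t (ht : t ≤ -ε) => show t < 0 by linarith)
      by_contra hlt
      refine ht ?_
      simp only
      rw [hΨ0 t (le_of_lt (not_le.mp hlt)), mul_zero])
    have hχ1 (t : ℝ) (ht : -1 ≤ t) : χ t = 1 := by
      rw [hχ]; exact Real.smoothTransition.one_of_one_le (by linarith)
    have e1 : ∫ t, deriv (fun t => χ t * Ψ t) t • y t = ∫ t, ψ t • y t := by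
      refine integral_congr_ae (.of_forall fun t => ?_)
      rcases le_or_gt t (-1) with ht | ht
      · simp [hy0 t ht]
      · simp only
        congr 1
        have : (fun t => χ t * Ψ t) =ᶠ[nhds t] Ψ := by
          filter_upwards [lt_mem_nhds ht] with s hs
          rw [hχ1 s hs.le, one_mul]
        rw [this.deriv_eq, (hΨd t).deriv]
    have e2 : ∫ t, (χ t * Ψ t) • h t = ∫ t, Ψ t • h t := by
      refine integral_congr_ae (.of_forall fun t => ?_)
      rcases le_or_gt t (-1) with ht | ht
      · simp [hh0 t ht]
      · simp [hχ1 t ht.le]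
    rw [e1, e2] at hη
    -- Fubini on the region `s ≤ t`: the inner integral of `ψ` over `t ≥ s` is `-Ψ s`.
    have e3 : ∫ t, ψ t • ∫ s in Set.Iic t, h s = -∫ s, Ψ s • h s := by
      have hprod : Integrable (fun p : ℝ × ℝ => ψ p.1 • h p.2) (volume.prod volume) :=
        hψi.smul_prod hh
      have hset : MeasurableSet {p : ℝ × ℝ | p.2 ≤ p.1} :=
        measurableSet_le measurable_snd measurable_fst
      have hind := hprod.indicator hset
      have hsw := integral_integral_swap (f := fun t s =>
        {p : ℝ × ℝ | p.2 ≤ p.1}.indicator (fun p => ψ p.1 • h p.2) (t, s)) hind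
      have l1 (t : ℝ) : ∫ s, {p : ℝ × ℝ | p.2 ≤ p.1}.indicator (fun p => ψ p.1 • h p.2) (t, s) =
          ψ t • ∫ s in Set.Iic t, h s := by
        rw [← integral_smul, ← integral_indicator measurableSet_Iic]
        rfl
      have l2 (s : ℝ) : ∫ t, {p : ℝ × ℝ | p.2 ≤ p.1}.indicator (fun p => ψ p.1 • h p.2) (t, s) =
          -(Ψ s • h s) := by
        rw [← neg_smul, ← hΨI, ← integral_smul_const, ← integral_indicator measurableSet_Ici]
        rfl
      simp only [l1, l2] at hsw
      rw [hsw, integral_neg]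
    have i1 : Integrable fun t => ψ t • y t :=
      hy.locallyIntegrable.integrable_smul_left_of_hasCompactSupport hψ.continuous hψc
    have i2 : Integrable fun t => ψ t • ∫ s in Set.Iic t, h s :=
      hP.locallyIntegrable.integrable_smul_left_of_hasCompactSupport hψ.continuous hψc
    simp only [smul_sub]
    rw [integral_sub i1 i2, hη, e3, sub_self]
  filter_upwards [key] with t ht ht0
  exact sub_eq_zero.mp (ht ht0)

set_option maxHeartbeats 400000 in
/-- Energy estimates for `y' = F - G` on `(-1, 0)` with `y(-1) = 0`, where `G` is a coercive
function of `y`. -/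
theorem energy_estimate {y h F G : ℝ → Val n} {μ K : ℝ} (hμ : 0 ≤ μ) (hK : 0 ≤ K)
    (hF : MemLp F 2 (volume.restrict (Set.Ioc (-1) 0)))
    (hh : MemLp h 2 (volume.restrict (Set.Ioc (-1) 0)))
    (hy : ∀ᵐ t, t ∈ Set.Ioc (-1 : ℝ) 0 → y t = ∫ s in (-1)..t, h s)
    (hFG : ∀ t, h t = F t - G t) (hG : ∀ t, μ * ‖y t‖ ^ 2 ≤ (⟪y t, G t⟫_ℂ).re)
    (hGK : ∀ t, ‖G t‖ ≤ K * (1 + μ) * ‖y t‖) :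
    (∀ t ∈ Set.Icc (-1 : ℝ) 0, ‖∫ s in (-1)..t, h s‖ ^ 2 ≤ 4 * ∫ s in Set.Ioc (-1) 0, ‖F s‖ ^ 2) ∧
    (1 + μ) ^ 2 * ∫ s in Set.Ioc (-1) 0, ‖y s‖ ^ 2 ≤ 10 * ∫ s in Set.Ioc (-1) 0, ‖F s‖ ^ 2 ∧
    (∀ s ∈ Set.Icc (-1 : ℝ) 0, ∀ t ∈ Set.Icc (-1 : ℝ) 0, s ≤ t →
      ‖(∫ r in (-1)..t, h r) - ∫ r in (-1)..s, h r‖ ^ 2 ≤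
        (t - s) * ((2 + 20 * K ^ 2) * ∫ s in Set.Ioc (-1) 0, ‖F s‖ ^ 2)) := by
  have h10 : (-1 : ℝ) ≤ 0 := by norm_num
  set D := ∫ s in Set.Ioc (-1 : ℝ) 0, ‖F s‖ ^ 2 with hD
  have hD0 : 0 ≤ D := integral_nonneg fun _ => sq_nonneg _
  have hF1 : IntegrableOn F (Set.Ioc (-1) 0) := hF.integrable one_le_two
  have hh1 : IntegrableOn h (Set.Ioc (-1) 0) := hh.integrable one_le_two
  have hF2 : IntegrableOn (fun s => ‖F s‖ ^ 2) (Set.Ioc (-1) 0) := hF.norm.integrable_sq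
  have hh2 : IntegrableOn (fun s => ‖h s‖ ^ 2) (Set.Ioc (-1) 0) := hh.norm.integrable_sq
  have hhI : IntervalIntegrable h volume (-1) 0 :=
    (intervalIntegrable_iff_integrableOn_Ioc_of_le h10).mpr hh1
  set P : ℝ → Val n := fun t => ∫ s in (-1)..t, h s with hP
  have hPc : ContinuousOn P (Set.Icc (-1) 0) := by
    have := intervalIntegral.continuousOn_primitive_interval' hhI Set.left_mem_uIcc
    rwa [Set.uIcc_of_le h10] at this
  have hsub {t : ℝ} (ht : t ∈ Set.Icc (-1 : ℝ) 0) : IntervalIntegrable h volume (-1) t :=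
    hhI.mono_set (by rw [Set.uIcc_of_le ht.1, Set.uIcc_of_le h10]; exact Set.Icc_subset_Icc_right ht.2)
  -- pointwise consequences of the equation
  have hpt : ∀ᵐ t, t ∈ Set.Ioc (-1 : ℝ) 0 →
      (⟪P t, h t⟫_ℂ).re ≤ ‖P t‖ * ‖F t‖ - μ * ‖P t‖ ^ 2 := by
    filter_upwards [hy] with t ht ht0
    have e : P t = y t := (ht ht0).symm
    have h1 := hG t
    have h2 : (⟪y t, F t⟫_ℂ).re ≤ ‖y t‖ * ‖F t‖ :=
      (Complex.re_le_norm _).trans (norm_inner_le_norm _ _)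
    rw [e, hFG t, inner_sub_right, Complex.sub_re]
    linarith
  have hPm : AEStronglyMeasurable P (volume.restrict (Set.Ioc (-1) 0)) :=
    (hPc.mono Set.Ioc_subset_Icc_self).aestronglyMeasurable measurableSet_Ioc
  have hcs : ∫ s in Set.Ioc (-1 : ℝ) 0, ‖F s‖ ≤ √D := by
    refine Real.le_sqrt_of_sq_le ?_
    refine (sq_integral_le hF.norm).trans (le_of_eq ?_)
    simp [hD]
  -- At a maximum `t₀` of `‖P‖` the energy identity reads `‖P t₀‖² ≤ 2‖P t₀‖ ∫‖F‖`, and one factor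
  -- cancels. This sup bound does not involve `μ`.
  obtain ⟨t₀, ht₀, hmax⟩ := isCompact_Icc.exists_isMaxOn (Set.nonempty_Icc.mpr h10) hPc.norm
  have hPmax (t : ℝ) (ht : t ∈ Set.Icc (-1 : ℝ) 0) : ‖P t‖ ≤ ‖P t₀‖ := hmax ht
  have hinn {t : ℝ} (ht : t ∈ Set.Icc (-1 : ℝ) 0) :
      IntegrableOn (fun s => 2 * (⟪P s, h s⟫_ℂ).re) (Set.Ioc (-1) t) := by
    refine IntegrableOn.mono_set ?_ (Set.Ioc_subset_Ioc_right ht.2)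
    refine (hh1.norm.const_mul (2 * ‖P t₀‖)).mono'
      ((Complex.continuous_re.comp_aestronglyMeasurable (hPm.inner hh1.1)).const_mul 2) ?_
    refine (ae_restrict_iff' measurableSet_Ioc).mpr (.of_forall fun s hs => ?_)
    rw [Real.norm_eq_abs, abs_mul, abs_two, mul_assoc]
    gcongr
    refine (Complex.abs_re_le_norm _).trans ((norm_inner_le_norm _ _).trans ?_)
    gcongr
    exact hPmax s ⟨hs.1.le, hs.2⟩
  have hM : ‖P t₀‖ ≤ 2 * √D := by
    have h1 : ‖P t₀‖ ^ 2 = ∫ s in Set.Ioc (-1) t₀, 2 * (⟪P s, h s⟫_ℂ).re :=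
      (norm_sq_primitive ht₀.1 (hsub ht₀)).trans (intervalIntegral.integral_of_le ht₀.1)
    have h2 : ∫ s in Set.Ioc (-1) t₀, 2 * (⟪P s, h s⟫_ℂ).re ≤
        ∫ s in Set.Ioc (-1) t₀, 2 * ‖P t₀‖ * ‖F s‖ := by
      refine integral_mono_ae (hinn ht₀)
        ((hF1.mono_set (Set.Ioc_subset_Ioc_right ht₀.2)).norm.const_mul _) ?_
      refine (ae_restrict_iff' measurableSet_Ioc).mpr ?_
      filter_upwards [hpt] with s hs hs0
      have h3 := hs ⟨hs0.1, hs0.2.trans ht₀.2⟩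
      have h4 : ‖P s‖ * ‖F s‖ ≤ ‖P t₀‖ * ‖F s‖ := by
        gcongr
        exact hPmax s ⟨hs0.1.le, hs0.2.trans ht₀.2⟩
      have h5 : 0 ≤ μ * ‖P s‖ ^ 2 := by positivity
      linarith
    have h3 : ∫ s in Set.Ioc (-1) t₀, 2 * ‖P t₀‖ * ‖F s‖ ≤ 2 * ‖P t₀‖ * √D := by
      rw [integral_const_mul]
      gcongr
      exact (setIntegral_mono_set hF1.norm (.of_forall fun _ => norm_nonneg _)
        (Set.Ioc_subset_Ioc_right ht₀.2).eventuallyLE).trans hcs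
    have h4 : ‖P t₀‖ ^ 2 ≤ 2 * ‖P t₀‖ * √D := (h1.le.trans h2).trans h3
    rcases (norm_nonneg (P t₀)).eq_or_lt with h0 | h0
    · rw [← h0]; exact mul_nonneg zero_le_two (Real.sqrt_nonneg _)
    · nlinarith
  have hPb (t : ℝ) (ht : t ∈ Set.Icc (-1 : ℝ) 0) : ‖P t‖ ^ 2 ≤ 4 * D := by
    calc ‖P t‖ ^ 2 ≤ (2 * √D) ^ 2 := by
          gcongr
          exact (hPmax t ht).trans hM
      _ = 4 * D := by rw [mul_pow, Real.sq_sqrt hD0]; norm_num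
  have hP2 : IntegrableOn (fun s => ‖P s‖ ^ 2) (Set.Ioc (-1) 0) :=
    ((hPc.norm.pow 2).integrableOn_compact isCompact_Icc).mono_set Set.Ioc_subset_Icc_self
  have hyP : ∫ s in Set.Ioc (-1 : ℝ) 0, ‖y s‖ ^ 2 = ∫ s in Set.Ioc (-1 : ℝ) 0, ‖P s‖ ^ 2 := by
    refine setIntegral_congr_ae measurableSet_Ioc ?_
    filter_upwards [hy] with t ht ht0
    rw [ht ht0]
  have hE1 : ∫ s in Set.Ioc (-1 : ℝ) 0, ‖P s‖ ^ 2 ≤ 4 * D := by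
    calc _ ≤ ∫ s in Set.Ioc (-1 : ℝ) 0, 4 * D :=
          setIntegral_mono_on hP2 (integrable_const _) measurableSet_Ioc
            fun s hs => hPb s ⟨hs.1.le, hs.2⟩
      _ = 4 * D := by simp
  -- The energy identity up to time 0 is multiplied by `μ`, and `2μ‖P‖‖F‖ - 2μ²‖P‖² ≤ ‖F‖² - μ²‖P‖²`
  -- is integrated.
  have hE2 : μ ^ 2 * ∫ s in Set.Ioc (-1 : ℝ) 0, ‖P s‖ ^ 2 ≤ D := by
    have h1 : ‖P 0‖ ^ 2 = ∫ s in Set.Ioc (-1) 0, 2 * (⟪P s, h s⟫_ℂ).re :=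
      (norm_sq_primitive h10 hhI).trans (intervalIntegral.integral_of_le h10)
    have h2 : μ * ∫ s in Set.Ioc (-1) 0, 2 * (⟪P s, h s⟫_ℂ).re ≤
        ∫ s in Set.Ioc (-1) 0, (‖F s‖ ^ 2 - μ ^ 2 * ‖P s‖ ^ 2) := by
      rw [← integral_const_mul]
      refine integral_mono_ae ((hinn ⟨h10, le_rfl⟩).const_mul _) (hF2.sub (hP2.const_mul _)) ?_
      refine (ae_restrict_iff' measurableSet_Ioc).mpr ?_
      filter_upwards [hpt] with s hs hs0
      have h3 := mul_le_mul_of_nonneg_left (hs hs0) hμ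
      have h4 := sq_nonneg (μ * ‖P s‖ - ‖F s‖)
      nlinarith
    rw [← h1, integral_sub hF2 (hP2.const_mul _), integral_const_mul] at h2
    have : 0 ≤ μ * ‖P 0‖ ^ 2 := by positivity
    linarith
  -- From `(1 + μ)² ≤ 2 + 2μ²` and the two bounds `4D` and `D`: `2 · 4 + 2 · 1 = 10`.
  have hE : (1 + μ) ^ 2 * ∫ s in Set.Ioc (-1 : ℝ) 0, ‖y s‖ ^ 2 ≤ 10 * D := by
    rw [hyP]
    have h0 : 0 ≤ ∫ s in Set.Ioc (-1 : ℝ) 0, ‖P s‖ ^ 2 := integral_nonneg fun _ => sq_nonneg _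
    nlinarith [mul_nonneg (sq_nonneg (1 - μ)) h0]
  refine ⟨hPb, hE, fun s hs t ht hst => ?_⟩
  have hy2 : IntegrableOn (fun s => ‖y s‖ ^ 2) (Set.Ioc (-1) 0) := by
    refine hP2.congr ((ae_restrict_iff' measurableSet_Ioc).mpr ?_)
    filter_upwards [hy] with t ht ht0
    rw [ht ht0]
  -- The growth `1 + μ` of `G` is exactly what the previous bound pays for, so `y'` is in `L₂` with
  -- a bound free of `μ`. Cauchy-Schwarz on `(s, t)` then gives Hölder continuity of exponent 1/2.
  have hhD : ∫ s in Set.Ioc (-1 : ℝ) 0, ‖h s‖ ^ 2 ≤ (2 + 20 * K ^ 2) * D := by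
    calc ∫ s in Set.Ioc (-1 : ℝ) 0, ‖h s‖ ^ 2
        ≤ ∫ s in Set.Ioc (-1 : ℝ) 0, (2 * ‖F s‖ ^ 2 + (2 * K ^ 2 * (1 + μ) ^ 2) * ‖y s‖ ^ 2) := by
          refine integral_mono hh2 ((hF2.const_mul _).add (hy2.const_mul _)) fun s => ?_
          have h1 : ‖h s‖ ≤ ‖F s‖ + K * (1 + μ) * ‖y s‖ := by
            rw [hFG s]
            exact (norm_sub_le _ _).trans (by linarith [hGK s])
          have h2 : 0 ≤ K * (1 + μ) * ‖y s‖ := by positivity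
          simp only
          calc ‖h s‖ ^ 2 ≤ (‖F s‖ + K * (1 + μ) * ‖y s‖) ^ 2 := by gcongr
            _ ≤ _ := by nlinarith [sq_nonneg (‖F s‖ - K * (1 + μ) * ‖y s‖)]
      _ = 2 * D + 2 * K ^ 2 * ((1 + μ) ^ 2 * ∫ s in Set.Ioc (-1 : ℝ) 0, ‖y s‖ ^ 2) := by
          rw [integral_add (hF2.const_mul _) (hy2.const_mul _), integral_const_mul,
            integral_const_mul]
          ring
      _ ≤ 2 * D + 2 * K ^ 2 * (10 * D) := by gcongr
      _ = _ := by ring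
  rw [intervalIntegral.integral_interval_sub_left (hsub ht) (hsub hs)]
  have hss : Set.Ioc s t ⊆ Set.Ioc (-1) 0 := Set.Ioc_subset_Ioc hs.1 ht.2
  have hhst : MemLp (fun r => ‖h r‖) 2 (volume.restrict (Set.Ioc s t)) :=
    hh.norm.mono_measure (Measure.restrict_mono hss le_rfl)
  have h1 : ‖∫ r in s..t, h r‖ ≤ ∫ r in Set.Ioc s t, ‖h r‖ := by
    rw [intervalIntegral.integral_of_le hst]
    exact norm_integral_le_integral_norm _
  calc ‖∫ r in s..t, h r‖ ^ 2 ≤ (∫ r in Set.Ioc s t, ‖h r‖) ^ 2 := by gcongr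
    _ ≤ (t - s) * ∫ r in Set.Ioc s t, ‖h r‖ ^ 2 := by
        refine (sq_integral_le hhst).trans (le_of_eq ?_)
        simp [hst]
    _ ≤ (t - s) * ((2 + 20 * K ^ 2) * D) := by
        refine mul_le_mul_of_nonneg_left ?_ (by linarith)
        exact (setIntegral_mono_set hh2 (.of_forall fun _ => sq_nonneg _) hss.eventuallyLE).trans hhD

end

end ParabolicSystem

/-! ### Commutators with cutoffs, and test functions built from plane waves. -/

namespace ParabolicSystem

noncomputable section

open scoped InnerProductSpace

variable {d n m : ℕ}

/-! ### Commutators of cutoffs, plane waves and derivatives -/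

/-- The plane wave `e^{-2πi x·ξ}`. -/
def wave (ξ x : Space d) : ℂ := Complex.exp ((-2 * Real.pi * inner ℝ x ξ : ℝ) * Complex.I)

theorem norm_wave (ξ x : Space d) : ‖wave ξ x‖ = 1 := Complex.norm_exp_ofReal_mul_I _

theorem contDiff_wave (ξ : Space d) : ContDiff ℝ ∞ (wave ξ) := by
  have h1 : ContDiff ℝ ∞ fun x : Space d => (-2 * Real.pi * inner ℝ x ξ : ℝ) :=
    contDiff_const.mul (contDiff_id.inner ℝ contDiff_const)
  exact ((Complex.ofRealCLM.contDiff.comp h1).mul contDiff_const).cexp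

theorem contDiff_wave_snd (ξ : Space d) : ContDiff ℝ ∞ fun X : SpaceTime d => wave ξ X.2 :=
  (contDiff_wave ξ).comp contDiff_snd

theorem hasFDerivAt_wave (ξ x : Space d) :
    HasFDerivAt (wave ξ) (((innerSL ℝ).flip ξ).smulRight ((-2 * Real.pi * Complex.I) * wave ξ x)) x := by
  have h1 : HasFDerivAt (fun x : Space d => inner ℝ x ξ) ((innerSL ℝ).flip ξ) x :=
    ((innerSL ℝ).flip ξ).hasFDerivAt
  have h2 := ((Complex.ofRealCLM.hasFDerivAt.comp x (h1.const_mul (-2 * Real.pi))).mul_const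
    Complex.I).cexp
  refine h2.congr_fderiv ?_
  ext v
  simp only [ContinuousLinearMap.smulRight_apply, smul_apply, smul_eq_mul,
    ContinuousLinearMap.comp_apply, Complex.ofRealCLM_apply, Function.comp_apply, wave,
    ContinuousLinearMap.flip_apply, innerSL_apply_apply, Complex.real_smul]
  push_cast
  simp
  ring

theorem dirDeriv_wave_spaceVec (ξ : Space d) (i : Fin d) :
    dirDeriv (spaceVec i) (fun X : SpaceTime d => wave ξ X.2) =
      fun X => (-2 * Real.pi * Complex.I * ξ i) * wave ξ X.2 := by
  funext X
  have := (hasFDerivAt_wave ξ X.2).comp X hasFDerivAt_snd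
  rw [dirDeriv, show (fun X : SpaceTime d => wave ξ X.2) = wave ξ ∘ Prod.snd from rfl, this.fderiv]
  have e : inner ℝ (EuclideanSpace.single i 1) ξ = ξ i := by
    simp [EuclideanSpace.inner_single_left]
  simp only [ContinuousLinearMap.comp_apply, ContinuousLinearMap.smulRight_apply,
    ContinuousLinearMap.flip_apply, innerSL_apply_apply, ContinuousLinearMap.coe_snd', spaceVec, e,
    Complex.real_smul]
  ring

theorem dirDeriv_wave_timeVec (ξ : Space d) :
    dirDeriv timeVec (fun X : SpaceTime d => wave ξ X.2) = fun _ => 0 := by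
  funext X
  have := (hasFDerivAt_wave ξ X.2).comp X hasFDerivAt_snd
  rw [dirDeriv, show (fun X : SpaceTime d => wave ξ X.2) = wave ξ ∘ Prod.snd from rfl, this.fderiv]
  simp [timeVec]

theorem dirDeriv_mul {f g : SpaceTime d → ℂ} (hf : ContDiff ℝ ∞ f) (hg : ContDiff ℝ ∞ g)
    (v : SpaceTime d) :
    dirDeriv v (fun X => f X * g X) = fun X => f X * dirDeriv v g X + dirDeriv v f X * g X := by
  funext X
  have := ((hf.differentiable (by simp)) X).hasFDerivAt.fun_mul
    ((hg.differentiable (by simp)) X).hasFDerivAt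
  rw [dirDeriv, this.fderiv]
  simp [dirDeriv]
  ring

theorem dirDeriv_ofReal {f : SpaceTime d → ℝ} (hf : ContDiff ℝ ∞ f) (v : SpaceTime d) :
    dirDeriv v (fun X => (f X : ℂ)) = fun X => ((dirDeriv v f X : ℝ) : ℂ) :=
  dirDeriv_clm_comp hf Complex.ofRealCLM v

/-- The terms of lower order in `D^l (ζ e^{-2πi x·ξ})` have symbols of degree less than the length
of `l`, and are again cut off by test functions. -/
theorem exists_listDeriv_mul_wave {U : Set (SpaceTime d)} {ζ : SpaceTime d → ℝ}
    (hζ : IsTestFunction U ζ) (l : List (Fin d)) :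
    ∃ (N : ℕ) (p : Fin N → Space d → ℂ) (ψ : Fin N → SpaceTime d → ℝ) (C : ℝ), 0 ≤ C ∧
      (∀ j, IsTestFunction U (ψ j)) ∧
      (∀ j ξ, ‖p j ξ‖ * (1 + ‖ξ‖) ≤ C * (1 + ‖ξ‖) ^ l.length) ∧
      ∀ ξ, listDeriv (l.map spaceVec) (fun X => (ζ X : ℂ) * wave ξ X.2) =
        fun X => ((l.map fun i => (-2 * Real.pi * Complex.I * ξ i)).prod * ζ X +
          ∑ j, p j ξ * ψ j X) * wave ξ X.2 := by
  -- Arbitrary finite index types allow the induction to take disjoint unions.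
  suffices H : ∃ (ι : Type) (_ : Fintype ι) (p : ι → Space d → ℂ) (ψ : ι → SpaceTime d → ℝ)
      (C : ℝ), 0 ≤ C ∧ (∀ j, IsTestFunction U (ψ j)) ∧
      (∀ j ξ, ‖p j ξ‖ * (1 + ‖ξ‖) ≤ C * (1 + ‖ξ‖) ^ l.length) ∧
      ∀ ξ, listDeriv (l.map spaceVec) (fun X => (ζ X : ℂ) * wave ξ X.2) =
        fun X => ((l.map fun i => (-2 * Real.pi * Complex.I * ξ i)).prod * ζ X +
          ∑ j, p j ξ * ψ j X) * wave ξ X.2 by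
    obtain ⟨ι, _, p, ψ, C, hC, hψ, hp, hl⟩ := H
    let e := (Fintype.equivFin ι).symm
    refine ⟨Fintype.card ι, p ∘ e, ψ ∘ e, C, hC, fun j => hψ _, fun j => hp _, fun ξ => ?_⟩
    rw [hl ξ]
    funext X
    rw [← e.sum_comp]
    rfl
  induction l with
  | nil =>
    refine ⟨PEmpty, inferInstance, fun j => j.elim, fun j => j.elim, 0, le_rfl, fun j => j.elim,
      fun j => j.elim, fun ξ => ?_⟩
    simp
  | cons i l ih =>
    obtain ⟨ι, _, p, ψ, C, hC, hψ, hp, hl⟩ := ih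
    have hprod (ξ : Space d) : ‖(l.map fun i => (-2 * Real.pi * Complex.I * (ξ i : ℂ))).prod‖ ≤
        ((2 * Real.pi) * (1 + ‖ξ‖)) ^ l.length := by
      clear hl hp
      induction l with
      | nil => simp
      | cons k l ih =>
        rw [List.map_cons, List.prod_cons, norm_mul, List.length_cons, pow_succ, mul_comm]
        gcongr
        have : ‖(ξ k : ℂ)‖ ≤ ‖ξ‖ := by simpa using PiLp.norm_apply_le ξ k
        simp only [norm_mul, norm_neg, Complex.norm_real, Complex.norm_I, Complex.norm_ofNat,
          Real.norm_eq_abs, abs_of_pos Real.pi_pos, mul_one] at this ⊢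
        gcongr
        linarith
    -- The product rule produces three kinds of remainder: the new derivative hits `ζ` in the
    -- leading term, hits an old cutoff `ψ j`, or hits the wave in an old remainder. In the first
    -- two the symbol keeps its degree while the list grows by one; in the third both grow by one.
    -- So the degree stays below the length.
    refine ⟨Unit ⊕ (ι ⊕ ι), inferInstance,
      Sum.elim (fun _ ξ => (l.map fun i => (-2 * Real.pi * Complex.I * (ξ i : ℂ))).prod)
        (Sum.elim p fun j ξ => (-2 * Real.pi * Complex.I * ξ i) * p j ξ),
      Sum.elim (fun _ => dirDeriv (spaceVec i) ζ)
        (Sum.elim (fun j => dirDeriv (spaceVec i) (ψ j)) ψ),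
      (2 * Real.pi) ^ l.length + (C + 2 * Real.pi * C), by positivity, ?_, ?_, ?_⟩
    · rintro (_ | j | j)
      · exact hζ.dirDeriv _
      · exact (hψ j).dirDeriv _
      · exact hψ j
    · intro j ξ
      have h1 : (1 : ℝ) ≤ 1 + ‖ξ‖ := by linarith [norm_nonneg ξ]
      have hpi := Real.pi_pos
      have hx : 0 ≤ (1 + ‖ξ‖) ^ (l.length + 1) := by positivity
      have hp1 : 0 ≤ (2 * Real.pi) ^ l.length := by positivity
      rcases j with _ | j | j
      · simp only [Sum.elim_inl, List.length_cons]
        calc _ ≤ ((2 * Real.pi) * (1 + ‖ξ‖)) ^ l.length * (1 + ‖ξ‖) := by gcongr; exact hprod ξ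
          _ = (2 * Real.pi) ^ l.length * (1 + ‖ξ‖) ^ (l.length + 1) := by rw [mul_pow]; ring
          _ ≤ _ := by
            gcongr
            have : 0 ≤ C + 2 * Real.pi * C := by positivity
            linarith
      · simp only [Sum.elim_inr, Sum.elim_inl, List.length_cons]
        calc ‖p j ξ‖ * (1 + ‖ξ‖) ≤ C * (1 + ‖ξ‖) ^ l.length := hp j ξ
          _ ≤ C * (1 + ‖ξ‖) ^ (l.length + 1) :=
            mul_le_mul_of_nonneg_left (pow_le_pow_right₀ h1 (Nat.le_succ _)) hC
          _ ≤ _ := by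
            gcongr
            have : 0 ≤ 2 * Real.pi * C := by positivity
            linarith
      · simp only [Sum.elim_inr, List.length_cons]
        have : ‖(ξ i : ℂ)‖ ≤ 1 + ‖ξ‖ := by
          have : ‖(ξ i : ℂ)‖ ≤ ‖ξ‖ := by simpa using PiLp.norm_apply_le ξ i
          linarith
        have e : ‖(-2 * Real.pi * Complex.I * ξ i) * p j ξ‖ = 2 * Real.pi * ‖(ξ i : ℂ)‖ * ‖p j ξ‖ := by
          simp [abs_of_pos hpi]
        rw [e]
        calc 2 * Real.pi * ‖(ξ i : ℂ)‖ * ‖p j ξ‖ * (1 + ‖ξ‖)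
            = 2 * Real.pi * ‖(ξ i : ℂ)‖ * (‖p j ξ‖ * (1 + ‖ξ‖)) := by ring
          _ ≤ 2 * Real.pi * (1 + ‖ξ‖) * (C * (1 + ‖ξ‖) ^ l.length) :=
            mul_le_mul (by gcongr) (hp j ξ) (by positivity) (by positivity)
          _ = 2 * Real.pi * C * (1 + ‖ξ‖) ^ (l.length + 1) := by rw [pow_succ]; ring
          _ ≤ _ := by
            gcongr
            linarith
    · intro ξ
      set c := (l.map fun i => (-2 * Real.pi * Complex.I * (ξ i : ℂ))).prod with hc
      have hr {f : SpaceTime d → ℝ} (hf : ContDiff ℝ ∞ f) : ContDiff ℝ ∞ fun X => (f X : ℂ) :=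
        Complex.ofRealCLM.contDiff.comp hf
      have s1 : ContDiff ℝ ∞ fun X => c * (ζ X : ℂ) := contDiff_const.mul (hr hζ.smooth)
      have s2 : ContDiff ℝ ∞ fun X => ∑ j, p j ξ * (ψ j X : ℂ) :=
        ContDiff.sum fun j _ => contDiff_const.mul (hr (hψ j).smooth)
      have d1 : dirDeriv (spaceVec i) (fun X => c * (ζ X : ℂ) + ∑ j, p j ξ * (ψ j X : ℂ)) =
          fun X => c * ((dirDeriv (spaceVec i) ζ X : ℝ) : ℂ) +
            ∑ j, p j ξ * ((dirDeriv (spaceVec i) (ψ j) X : ℝ) : ℂ) := by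
        funext X
        have hD {f : SpaceTime d → ℝ} (hf : ContDiff ℝ ∞ f) :
            HasFDerivAt (fun X => (f X : ℂ)) (fderiv ℝ (fun X => (f X : ℂ)) X) X :=
          ((hr hf).differentiable (by simp) X).hasFDerivAt
        have := ((hD hζ.smooth).const_mul c).fun_add
          (HasFDerivAt.fun_sum (u := Finset.univ) fun j _ => (hD (hψ j).smooth).const_mul (p j ξ))
        have hd {f : SpaceTime d → ℝ} (hf : ContDiff ℝ ∞ f) :
            fderiv ℝ (fun X => (f X : ℂ)) X (spaceVec i) = ((dirDeriv (spaceVec i) f X : ℝ) : ℂ) :=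
          congrFun (dirDeriv_ofReal hf (spaceVec i)) X
        rw [dirDeriv, this.fderiv]
        simp only [add_apply, smul_apply, smul_eq_mul, sum_apply, hd hζ.smooth]
        congr 1
        exact Finset.sum_congr rfl fun j _ => by rw [hd (hψ j).smooth]
      rw [List.map_cons, listDeriv_cons, hl ξ, dirDeriv_mul (s1.add s2) (contDiff_wave_snd ξ), d1,
        dirDeriv_wave_spaceVec]
      funext X
      simp only [List.map_cons, List.prod_cons, ← hc, Fintype.sum_sum_type, Sum.elim_inl,
        Sum.elim_inr, Finset.univ_unique, Finset.sum_singleton]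
      have e : ∑ j, (-2 * Real.pi * Complex.I * ξ i) * p j ξ * (ψ j X : ℂ) =
          (-2 * Real.pi * Complex.I * ξ i) * ∑ j, p j ξ * (ψ j X : ℂ) := by
        rw [Finset.mul_sum]
        exact Finset.sum_congr rfl fun j _ => by ring
      rw [e]
      ring

/-! ### Very weak solutions -/

/-- The integrand in the very weak formulation of the homogeneous system, where all derivatives fall
on the test function. -/
def veryWeakIntegrand {𝕜 : Type*} [RCLike 𝕜] [Module 𝕜 (Val n)] (m : ℕ)
    (A : MultiIndex d → MultiIndex d → ℝ → Matrix (Fin n) (Fin n) ℂ) (lam : ℝ)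
    (W : SpaceTime d → Val n) (φ : SpaceTime d → 𝕜) (X : SpaceTime d) : Val n :=
  -(dirDeriv timeVec φ X • W X) +
    (∑ α ∈ ofOrder d m, ∑ β ∈ ofOrder d m,
      (-1 : ℝ) ^ m • (spaceDerivs α (spaceDerivs β φ) X • matVec (A α β X.1) (W X))) +
    lam • (φ X • W X)

/-- `W` solves `W_t + (-1)^m ∑ D^α (A^{αβ} D^β W) + λ W = 0` in `U` in the sense of
distributions. -/
def IsVeryWeakSolution (m : ℕ) (A : MultiIndex d → MultiIndex d → ℝ → Matrix (Fin n) (Fin n) ℂ)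
    (lam : ℝ) (U : Set (SpaceTime d)) (W : SpaceTime d → Val n) : Prop :=
  ∀ φ : SpaceTime d → ℝ, IsTestFunction U φ → ∫ X, veryWeakIntegrand m A lam W φ X = 0

theorem locallyIntegrable_matVec {B : ℝ → Matrix (Fin n) (Fin n) ℂ}
    (hB : ∀ i j, Measurable fun t => B t i j) {K : ℝ} (hK : ∀ i j t, ‖B t i j‖ ≤ K)
    {W : SpaceTime d → Val n}
    (hW : LocallyIntegrable W) : LocallyIntegrable fun X => matVec (B X.1) (W X) := by
  intro X
  obtain ⟨s, hs, hWs⟩ := hW X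
  refine ⟨s, hs, ?_⟩
  have := memLp_matVec (B := fun X : SpaceTime d => B X.1)
    (fun i j => (hB i j).comp measurable_fst) (fun i j X => hK i j X.1)
    (memLp_one_iff_integrable.mpr hWs)
  exact memLp_one_iff_integrable.mp this

theorem IsLegendreHadamard.locallyIntegrable_matVec {δ : ℝ}
    {A : MultiIndex d → MultiIndex d → ℝ → Matrix (Fin n) (Fin n) ℂ}
    (hA : IsLegendreHadamard m δ A) {α β : MultiIndex d} (hα : α ∈ ofOrder d m)
    (hβ : β ∈ ofOrder d m) {W : SpaceTime d → Val n} (hW : LocallyIntegrable W) :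
    LocallyIntegrable fun X => matVec (A α β X.1) (W X) :=
  ParabolicSystem.locallyIntegrable_matVec (hA.measurable α hα β hβ) (hA.bound α hα β hβ) hW

theorem integrable_veryWeakIntegrand {δ : ℝ}
    {A : MultiIndex d → MultiIndex d → ℝ → Matrix (Fin n) (Fin n) ℂ}
    (hA : IsLegendreHadamard m δ A) (lam : ℝ) {W : SpaceTime d → Val n} (hW : LocallyIntegrable W)
    {𝕜 : Type*} [RCLike 𝕜] [Module 𝕜 (Val n)] [IsBoundedSMul 𝕜 (Val n)] {φ : SpaceTime d → 𝕜}
    (h : ContDiff ℝ ∞ φ) (hc : HasCompactSupport φ) :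
    Integrable (veryWeakIntegrand m A lam W φ) := by
  refine (((hW.integrable_smul_left_of_hasCompactSupport (contDiff_dirDeriv h timeVec).continuous
    (hasCompactSupport_dirDeriv hc timeVec)).neg).add
    (integrable_finsetSum _ fun α hα => integrable_finsetSum _ fun β hβ => ?_)).add ?_
  · exact ((hA.locallyIntegrable_matVec hα hβ hW).integrable_smul_left_of_hasCompactSupport
      (contDiff_spaceDerivs (contDiff_spaceDerivs h β) α).continuous
      (hasCompactSupport_spaceDerivs (hasCompactSupport_spaceDerivs hc β) α)).smul ((-1 : ℝ) ^ m)
  · exact (hW.integrable_smul_left_of_hasCompactSupport h.continuous hc).smul lam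

/-- Complex-valued test functions are admissible for very weak solutions. -/
theorem IsVeryWeakSolution.integral_complex {δ lam : ℝ}
    {A : MultiIndex d → MultiIndex d → ℝ → Matrix (Fin n) (Fin n) ℂ}
    (hA : IsLegendreHadamard m δ A) {U : Set (SpaceTime d)} {W : SpaceTime d → Val n}
    (hW : LocallyIntegrable W) (hWU : IsVeryWeakSolution m A lam U W) {Φ : SpaceTime d → ℂ}
    (h : ContDiff ℝ ∞ Φ) (hc : HasCompactSupport Φ) (hU : tsupport Φ ⊆ U) :
    ∫ X, veryWeakIntegrand m A lam W Φ X = 0 := by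
  have hre : IsTestFunction U fun X => Complex.reCLM (Φ X) :=
    ⟨Complex.reCLM.contDiff.comp h, hc.comp_left (g := Complex.reCLM) (map_zero _),
      (closure_mono (Function.support_comp_subset (map_zero Complex.reCLM) Φ)).trans hU⟩
  have him : IsTestFunction U fun X => Complex.imCLM (Φ X) :=
    ⟨Complex.imCLM.contDiff.comp h, hc.comp_left (g := Complex.imCLM) (map_zero _),
      (closure_mono (Function.support_comp_subset (map_zero Complex.imCLM) Φ)).trans hU⟩
  have key (X : SpaceTime d) : veryWeakIntegrand m A lam W Φ X =
      veryWeakIntegrand m A lam W (fun X => Complex.reCLM (Φ X)) X +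
      Complex.I • veryWeakIntegrand m A lam W (fun X => Complex.imCLM (Φ X)) X := by
    have hz (z : ℂ) (w : Val n) : z • w = z.re • w + Complex.I • (z.im • w) := by
      conv_lhs => rw [← Complex.re_add_im z]
      rw [add_smul, mul_comm, mul_smul, Complex.coe_smul, Complex.coe_smul]
    simp only [veryWeakIntegrand, dirDeriv_clm_comp h, spaceDerivs_clm_comp h,
      spaceDerivs_clm_comp (contDiff_spaceDerivs h _)]
    simp only [Complex.reCLM_apply, Complex.imCLM_apply]
    rw [hz (dirDeriv timeVec Φ X), hz (Φ X)]
    have hs (α β : MultiIndex d) := hz (spaceDerivs α (spaceDerivs β Φ) X)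
      (matVec (A α β X.1) (W X))
    simp only [hs, smul_add, Finset.sum_add_distrib, Finset.smul_sum, smul_neg,
      smul_comm Complex.I lam, smul_comm Complex.I ((-1 : ℝ) ^ m)]
    abel
  have i1 := integrable_veryWeakIntegrand hA lam hW hre.smooth hre.compact
  have i2 : Integrable fun X =>
      Complex.I • veryWeakIntegrand m A lam W (fun X => Complex.imCLM (Φ X)) X :=
    (integrable_veryWeakIntegrand hA lam hW him.smooth him.compact).smul Complex.I
  simp only [key]
  rw [integral_add i1 i2, integral_smul, hWU _ hre, hWU _ him, smul_zero, add_zero]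

end

end ParabolicSystem

namespace ParabolicSystem

noncomputable section

open scoped InnerProductSpace

variable {d n m : ℕ}

/-! ### The Fourier transform of a localized solution -/

/-- The spatial Fourier transform of `ψ W` at time `t`. -/
def cutoffFourier (W : SpaceTime d → Val n) (ξ : Space d) (ψ : SpaceTime d → ℝ) (t : ℝ) : Val n :=
  ∫ x, ((ψ (t, x) : ℂ) * wave ξ x) • W (t, x)

/-- The region `(-1, ∞) × B_1` in which the cutoffs are supported. -/
def cutoffRegion (d : ℕ) : Set (SpaceTime d) := Set.Ioi (-1) ×ˢ Metric.ball 0 1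

/-- Very weak solutions of the homogeneous system in `Q_1`, with a normalization of the slices. -/
structure IsLocalSolution (m : ℕ) (A : MultiIndex d → MultiIndex d → ℝ → Matrix (Fin n) (Fin n) ℂ)
    (lam M : ℝ) (W : SpaceTime d → Val n) : Prop where
  stronglyMeasurable : StronglyMeasurable W
  integrable : Integrable W
  -- Demanded for every time, so that the spatial Fourier transform of each slice is a continuous
  -- function of `ξ`.
  slice : ∀ t, Integrable fun x => W (t, x)
  veryWeak : IsVeryWeakSolution m A lam (Q m 1 0) W
  memLp : MemLp (fun t => ∫ x, ‖W (t, x)‖) 2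
  bound : ∫ t, (∫ x, ‖W (t, x)‖) ^ 2 ≤ M

theorem IsTestFunction.exists_bound {U : Set (SpaceTime d)} {ψ : SpaceTime d → ℝ}
    (h : IsTestFunction U ψ) : ∃ B, 0 ≤ B ∧ ∀ X, |ψ X| ≤ B := by
  obtain ⟨B, hB⟩ := h.compact.exists_bound_of_continuous h.smooth.continuous
  exact ⟨B, (norm_nonneg _).trans (hB 0), hB⟩

theorem continuous_wave (ξ : Space d) : Continuous (wave ξ) := (contDiff_wave ξ).continuous

theorem integrable_mul_wave_smul {v : Space d → Val n} (hv : Integrable v) (ξ : Space d)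
    {g : Space d → ℝ} (hg : Continuous g) {B : ℝ} (hB : ∀ x, |g x| ≤ B) :
    Integrable fun x => ((g x : ℂ) * wave ξ x) • v x := by
  refine (hv.norm.const_mul B).mono' ?_ (.of_forall fun x => ?_)
  · exact ((Complex.continuous_ofReal.comp hg).mul
      (continuous_wave ξ)).aestronglyMeasurable.smul hv.1
  · rw [norm_smul, norm_mul, norm_wave, mul_one, Complex.norm_real]
    exact mul_le_mul_of_nonneg_right (hB x) (norm_nonneg _)

variable {A : MultiIndex d → MultiIndex d → ℝ → Matrix (Fin n) (Fin n) ℂ} {lam M δ : ℝ}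
  {W : SpaceTime d → Val n} {U : Set (SpaceTime d)}

namespace IsLocalSolution

theorem integrable_slice (hW : IsLocalSolution m A lam M W) (ξ : Space d)
    {ψ : SpaceTime d → ℝ} (h : IsTestFunction U ψ) (t : ℝ) :
    Integrable fun x => ((ψ (t, x) : ℂ) * wave ξ x) • W (t, x) := by
  obtain ⟨B, -, hB⟩ := h.exists_bound
  exact integrable_mul_wave_smul (hW.slice t) ξ
    (h.smooth.continuous.comp (Continuous.prodMk_right t)) (B := B) fun x => hB _

theorem norm_cutoffFourier_le (hW : IsLocalSolution m A lam M W) (ξ : Space d)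
    {ψ : SpaceTime d → ℝ} {B : ℝ} (hB : ∀ X, |ψ X| ≤ B) (t : ℝ) :
    ‖cutoffFourier W ξ ψ t‖ ≤ B * ∫ x, ‖W (t, x)‖ := by
  rw [cutoffFourier, ← integral_const_mul]
  refine norm_integral_le_of_norm_le ((hW.slice t).norm.const_mul B) (.of_forall fun x => ?_)
  rw [norm_smul, norm_mul, norm_wave, mul_one, Complex.norm_real]
  exact mul_le_mul_of_nonneg_right (hB _) (norm_nonneg _)

theorem stronglyMeasurable_cutoffFourier (hW : IsLocalSolution m A lam M W) (ξ : Space d)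
    {ψ : SpaceTime d → ℝ} (h : IsTestFunction U ψ) :
    StronglyMeasurable (cutoffFourier W ξ ψ) := by
  have : StronglyMeasurable fun X : SpaceTime d => ((ψ X : ℂ) * wave ξ X.2) • W X :=
    ((Complex.continuous_ofReal.comp h.smooth.continuous).mul
      (contDiff_wave_snd ξ).continuous).stronglyMeasurable.smul hW.stronglyMeasurable
  exact this.integral_prod_right

theorem memLp_cutoffFourier (hW : IsLocalSolution m A lam M W) (ξ : Space d)
    {ψ : SpaceTime d → ℝ} (h : IsTestFunction U ψ) : MemLp (cutoffFourier W ξ ψ) 2 := by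
  obtain ⟨B, -, hB⟩ := h.exists_bound
  refine (hW.memLp.const_mul B).mono' (hW.stronglyMeasurable_cutoffFourier ξ h).aestronglyMeasurable
    (.of_forall fun t => hW.norm_cutoffFourier_le ξ hB t)

theorem integrable_cutoffFourier (hW : IsLocalSolution m A lam M W) (ξ : Space d)
    {ψ : SpaceTime d → ℝ} (h : IsTestFunction U ψ) : Integrable (cutoffFourier W ξ ψ) := by
  obtain ⟨B, -, hB⟩ := h.exists_bound
  have hi : Integrable fun t => ∫ x, ‖W (t, x)‖ := hW.integrable.norm.integral_prod_left
  refine (hi.const_mul B).mono' (hW.stronglyMeasurable_cutoffFourier ξ h).aestronglyMeasurable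
    (.of_forall fun t => hW.norm_cutoffFourier_le ξ hB t)

end IsLocalSolution

/-- The zero initial condition at `t = -1` for the equation in time. The cutoffs vanish there, but
need not vanish near the final time 0. -/
theorem cutoffFourier_eq_zero (W : SpaceTime d → Val n) (ξ : Space d) {ψ : SpaceTime d → ℝ}
    (h : IsTestFunction (cutoffRegion d) ψ) {t : ℝ} (ht : t ≤ -1) : cutoffFourier W ξ ψ t = 0 := by
  have (x : Space d) : ψ (t, x) = 0 := by
    by_contra h0
    exact absurd (h.supp (subset_tsupport _ h0)).1 (by simpa using ht)
  simp [cutoffFourier, this]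

/-- `D^α D^β (ζ e^{-2πi x·ξ})` up to terms with symbols of lower order. -/
theorem exists_spaceDerivs_mul_wave {ζ : SpaceTime d → ℝ}
    (hζ : IsTestFunction U ζ) (α β : MultiIndex d) :
    ∃ (N : ℕ) (p : Fin N → Space d → ℂ) (ψ : Fin N → SpaceTime d → ℝ) (C : ℝ), 0 ≤ C ∧
      (∀ j, IsTestFunction U (ψ j)) ∧
      (∀ j ξ, ‖p j ξ‖ * (1 + ‖ξ‖) ≤ C * (1 + ‖ξ‖) ^ (order α + order β)) ∧
      ∀ ξ, spaceDerivs α (spaceDerivs β fun X => (ζ X : ℂ) * wave ξ X.2) =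
        fun X => ((-Complex.I) ^ (order α + order β) *
          ((monomial ((2 * Real.pi) • ξ) α * monomial ((2 * Real.pi) • ξ) β : ℝ) : ℂ) * ζ X +
          ∑ j, p j ξ * ψ j X) * wave ξ X.2 := by
  obtain ⟨N, p, ψ, C, hC, hψ, hp, h⟩ := exists_listDeriv_mul_wave hζ (α.toList ++ β.toList)
  refine ⟨N, p, ψ, C, hC, hψ, ?_, fun ξ => ?_⟩
  · simpa only [List.length_append, MultiIndex.length_toList] using hp
  · have := h ξ
    rw [List.map_append, listDeriv_append] at this
    rw [spaceDerivs, spaceDerivs, this]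
    funext X
    congr 3
    rw [List.map_append, List.prod_append, MultiIndex.prod_toList, MultiIndex.prod_toList,
      monomial_smul, monomial_smul]
    push_cast [monomial]
    simp_rw [mul_pow, Finset.prod_mul_distrib, Finset.prod_pow_eq_pow_sum]
    rw [← order, ← order, pow_add]
    simp only [neg_pow (2 : ℂ), neg_pow Complex.I]
    ring

/-- The symbol of the leading part and of `λ`, applied to the Fourier transform. -/
def symbolTerm (m : ℕ) (A : MultiIndex d → MultiIndex d → ℝ → Matrix (Fin n) (Fin n) ℂ) (lam : ℝ)
    (ξ : Space d) (t : ℝ) (y : Val n) : Val n :=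
  (∑ α ∈ ofOrder d m, ∑ β ∈ ofOrder d m,
    (monomial ((2 * Real.pi) • ξ) α * monomial ((2 * Real.pi) • ξ) β) • matVec (A α β t) y) +
    lam • y

/-- The terms produced by the cutoff. -/
def commutatorTerm (m : ℕ) (A : MultiIndex d → MultiIndex d → ℝ → Matrix (Fin n) (Fin n) ℂ)
    {N : MultiIndex d → MultiIndex d → ℕ} (p : ∀ α β, Fin (N α β) → Space d → ℂ)
    (ψ : ∀ α β, Fin (N α β) → SpaceTime d → ℝ) (ζ : SpaceTime d → ℝ) (W : SpaceTime d → Val n)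
    (ξ : Space d) (t : ℝ) : Val n :=
  cutoffFourier W ξ (dirDeriv timeVec ζ) t -
    ∑ α ∈ ofOrder d m, ∑ β ∈ ofOrder d m,
      (-1 : ℝ) ^ m • ∑ j, p α β j ξ • matVec (A α β t) (cutoffFourier W ξ (ψ α β j) t)

theorem matVec_smul (B : Matrix (Fin n) (Fin n) ℂ) (c : ℂ) (v : Val n) :
    matVec B (c • v) = c • matVec B v := by
  simp only [matVec_eq, map_smul]

theorem integral_smul_matVec (B : Matrix (Fin n) (Fin n) ℂ) {g : Space d → ℂ} {v : Space d → Val n}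
    (h : Integrable fun x => g x • v x) :
    ∫ x, g x • matVec B (v x) = matVec B (∫ x, g x • v x) := by
  simp only [← matVec_smul]
  simp only [matVec_eq]
  exact ContinuousLinearMap.integral_comp_comm _ h

theorem integrable_smul_matVec (B : Matrix (Fin n) (Fin n) ℂ) {g : Space d → ℂ} {v : Space d → Val n}
    (h : Integrable fun x => g x • v x) :
    Integrable fun x => g x • matVec B (v x) := by
  simp only [← matVec_smul]
  simp only [matVec_eq]
  exact ContinuousLinearMap.integrable_comp _ h

theorem dirDeriv_time_smul_wave {ζ : SpaceTime d → ℝ} (hζ : ContDiff ℝ ∞ ζ) {η : ℝ → ℝ}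
    (hη : ContDiff ℝ ∞ η) (ξ : Space d) (X : SpaceTime d) :
    dirDeriv timeVec (fun X : SpaceTime d => η X.1 • ((ζ X : ℂ) * wave ξ X.2)) X =
      deriv η X.1 • ((ζ X : ℂ) * wave ξ X.2) +
        η X.1 • (((dirDeriv timeVec ζ X : ℝ) : ℂ) * wave ξ X.2) := by
  have hζ' : ContDiff ℝ ∞ fun X => (ζ X : ℂ) := Complex.ofRealCLM.contDiff.comp hζ
  have h1 : HasFDerivAt (fun X : SpaceTime d => η X.1)
      ((ContinuousLinearMap.toSpanSingleton ℝ (deriv η X.1)).comp (ContinuousLinearMap.fst ℝ ℝ (Space d))) X :=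
    ((hη.differentiable (by simp)) X.1).hasDerivAt.hasFDerivAt.comp X hasFDerivAt_fst
  have h2 : HasFDerivAt (fun X : SpaceTime d => (ζ X : ℂ) * wave ξ X.2) _ X :=
    ((hζ'.mul (contDiff_wave_snd ξ)).differentiable (by simp) X).hasFDerivAt
  have e2 : dirDeriv timeVec (fun X : SpaceTime d => (ζ X : ℂ) * wave ξ X.2) X =
      ((dirDeriv timeVec ζ X : ℝ) : ℂ) * wave ξ X.2 := by
    rw [dirDeriv_mul hζ' (contDiff_wave_snd ξ), dirDeriv_wave_timeVec, dirDeriv_ofReal hζ]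
    simp
  rw [dirDeriv, (h1.fun_smul h2).fderiv]
  rw [dirDeriv] at e2
  simp only [add_apply, smul_apply, ContinuousLinearMap.smulRight_apply,
    ContinuousLinearMap.comp_apply, ContinuousLinearMap.coe_fst',
    ContinuousLinearMap.toSpanSingleton_apply, timeVec]
  rw [one_smul, add_comm]
  exact congrArg (fun z => deriv η X.1 • ((ζ X : ℂ) * wave ξ X.2) + η X.1 • z) e2

end

end ParabolicSystem

/-! ### The equation tested with plane waves, slice by slice. -/

namespace ParabolicSystem

noncomputable section

open scoped InnerProductSpace

variable {d n m : ℕ}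

variable {A : MultiIndex d → MultiIndex d → ℝ → Matrix (Fin n) (Fin n) ℂ} {lam M δ : ℝ}
  {W : SpaceTime d → Val n} {U : Set (SpaceTime d)}

/-- The very weak formulation, tested with `η(t) ζ(X) e^{-2πi x·ξ}` and integrated in `x`. -/
theorem IsLocalSolution.integral_veryWeakIntegrand_slice (hW : IsLocalSolution m A lam M W)
    {ζ : SpaceTime d → ℝ} (hζ : IsTestFunction U ζ)
    {N : MultiIndex d → MultiIndex d → ℕ} {p : ∀ α β, Fin (N α β) → Space d → ℂ}
    {ψ : ∀ α β, Fin (N α β) → SpaceTime d → ℝ} (hψ : ∀ α β j, IsTestFunction U (ψ α β j))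
    (hp : ∀ α β ξ, spaceDerivs α (spaceDerivs β fun X => (ζ X : ℂ) * wave ξ X.2) =
        fun X => ((-Complex.I) ^ (order α + order β) *
          ((monomial ((2 * Real.pi) • ξ) α * monomial ((2 * Real.pi) • ξ) β : ℝ) : ℂ) * ζ X +
          ∑ j, p α β j ξ * ψ α β j X) * wave ξ X.2)
    {η : ℝ → ℝ} (hη : ContDiff ℝ ∞ η) (ξ : Space d) (t : ℝ) :
    ∫ x, veryWeakIntegrand m A lam W
        (fun X : SpaceTime d => η X.1 • ((ζ X : ℂ) * wave ξ X.2)) (t, x) =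
      -(deriv η t • cutoffFourier W ξ ζ t) -
        η t • (commutatorTerm m A p ψ ζ W ξ t - symbolTerm m A lam ξ t (cutoffFourier W ξ ζ t)) := by
  have hζ' : ContDiff ℝ ∞ fun X : SpaceTime d => (ζ X : ℂ) * wave ξ X.2 :=
    (Complex.ofRealCLM.contDiff.comp hζ.smooth).mul (contDiff_wave_snd ξ)
  -- The `2m` derivatives of the wave contribute `(-i)^(2m) = (-1)^m`, which cancels the sign of the
  -- operator. The leading symbol therefore enters with the sign that makes it coercive.
  have hsign : ((-1 : ℝ) ^ m : ℝ) * ((-Complex.I) ^ (m + m)) = 1 := by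
    rw [← two_mul, pow_mul, neg_sq, Complex.I_sq]
    push_cast
    rw [← mul_pow]
    norm_num
  have iζ := hW.integrable_slice ξ hζ t
  have iτ := hW.integrable_slice ξ (hζ.dirDeriv timeVec) t
  have iψ (α β j) := hW.integrable_slice ξ (hψ α β j) t
  -- At a fixed time the coefficients are constant matrices, so after separating the leading symbol
  -- from the remainders the `x`-integral passes inside them.
  have key (x : Space d) : veryWeakIntegrand m A lam W
        (fun X : SpaceTime d => η X.1 • ((ζ X : ℂ) * wave ξ X.2)) (t, x) =
      ((-deriv η t) • (((ζ (t, x) : ℂ) * wave ξ x) • W (t, x)) +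
        (-η t) • ((((dirDeriv timeVec ζ (t, x) : ℝ) : ℂ) * wave ξ x) • W (t, x))) +
      (∑ α ∈ ofOrder d m, ∑ β ∈ ofOrder d m, η t •
        ((monomial ((2 * Real.pi) • ξ) α * monomial ((2 * Real.pi) • ξ) β) •
          (((ζ (t, x) : ℂ) * wave ξ x) • matVec (A α β t) (W (t, x))) +
        (-1 : ℝ) ^ m • ∑ j, p α β j ξ •
          (((ψ α β j (t, x) : ℂ) * wave ξ x) • matVec (A α β t) (W (t, x))))) +
      lam • η t • (((ζ (t, x) : ℂ) * wave ξ x) • W (t, x)) := by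
    simp only [veryWeakIntegrand, dirDeriv_time_smul_wave hζ.smooth hη,
      spaceDerivs_time_smul hζ' hη, spaceDerivs_time_smul (contDiff_spaceDerivs hζ' _) hη, hp,
      add_smul, smul_assoc, neg_add, neg_smul]
    congr 2
    refine Finset.sum_congr rfl fun α hα => Finset.sum_congr rfl fun β hβ => ?_
    rw [mem_ofOrder.mp hα, mem_ofOrder.mp hβ, smul_comm ((-1 : ℝ) ^ m) (η t)]
    congr 1
    rw [add_mul, add_smul, smul_add]
    congr 1
    · rw [← Complex.coe_smul, ← Complex.coe_smul, smul_smul, smul_smul]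
      congr 1
      linear_combination ((monomial ((2 * Real.pi) • ξ) α * monomial ((2 * Real.pi) • ξ) β : ℝ) : ℂ) *
        (ζ (t, x) : ℂ) * wave ξ x * hsign
    · rw [Finset.sum_mul, Finset.sum_smul]
      refine congrArg _ (Finset.sum_congr rfl fun j _ => ?_)
      rw [smul_smul, mul_assoc]
  simp only [key]
  have jM (α β) := integrable_smul_matVec (A α β t) iζ
  have jψ (α β j) := integrable_smul_matVec (A α β t) (iψ α β j)
  have jp (α β j) : Integrable fun x => p α β j ξ •
      (((ψ α β j (t, x) : ℂ) * wave ξ x) • matVec (A α β t) (W (t, x))) :=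
    (jψ α β j).smul (p α β j ξ)
  have K1 : Integrable fun x => (-deriv η t) • (((ζ (t, x) : ℂ) * wave ξ x) • W (t, x)) :=
    iζ.smul (-deriv η t)
  have K2 : Integrable fun x => (-η t) •
      ((((dirDeriv timeVec ζ (t, x) : ℝ) : ℂ) * wave ξ x) • W (t, x)) := iτ.smul (-η t)
  have I1 : Integrable fun x => ((-deriv η t) • (((ζ (t, x) : ℂ) * wave ξ x) • W (t, x)) +
        (-η t) • ((((dirDeriv timeVec ζ (t, x) : ℝ) : ℂ) * wave ξ x) • W (t, x))) :=
    K1.add K2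
  have I2 (α β) : Integrable fun x => (monomial ((2 * Real.pi) • ξ) α * monomial ((2 * Real.pi) • ξ) β) •
      (((ζ (t, x) : ℂ) * wave ξ x) • matVec (A α β t) (W (t, x))) := (jM α β).smul (_ : ℝ)
  have I3 (α β) : Integrable fun x => (-1 : ℝ) ^ m • ∑ j, p α β j ξ •
      (((ψ α β j (t, x) : ℂ) * wave ξ x) • matVec (A α β t) (W (t, x))) :=
    Integrable.smul ((-1 : ℝ) ^ m) (f := fun x => ∑ j, p α β j ξ •
      (((ψ α β j (t, x) : ℂ) * wave ξ x) • matVec (A α β t) (W (t, x))))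
      (integrable_finsetSum _ fun j _ => jp α β j)
  have I4 (α β) : Integrable fun x => η t •
        ((monomial ((2 * Real.pi) • ξ) α * monomial ((2 * Real.pi) • ξ) β) •
          (((ζ (t, x) : ℂ) * wave ξ x) • matVec (A α β t) (W (t, x))) +
        (-1 : ℝ) ^ m • ∑ j, p α β j ξ •
          (((ψ α β j (t, x) : ℂ) * wave ξ x) • matVec (A α β t) (W (t, x)))) :=
    ((I2 α β).add (I3 α β)).smul (η t)
  have I5 : Integrable fun x => lam • η t • (((ζ (t, x) : ℂ) * wave ξ x) • W (t, x)) :=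
    (iζ.smul (η t)).smul lam
  have I6 : Integrable fun x => ∑ α ∈ ofOrder d m, ∑ β ∈ ofOrder d m, η t •
        ((monomial ((2 * Real.pi) • ξ) α * monomial ((2 * Real.pi) • ξ) β) •
          (((ζ (t, x) : ℂ) * wave ξ x) • matVec (A α β t) (W (t, x))) +
        (-1 : ℝ) ^ m • ∑ j, p α β j ξ •
          (((ψ α β j (t, x) : ℂ) * wave ξ x) • matVec (A α β t) (W (t, x)))) :=
    integrable_finsetSum _ fun α _ => integrable_finsetSum _ fun β _ => I4 α β
  have I7 : Integrable fun x => ((-deriv η t) • (((ζ (t, x) : ℂ) * wave ξ x) • W (t, x)) +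
        (-η t) • ((((dirDeriv timeVec ζ (t, x) : ℝ) : ℂ) * wave ξ x) • W (t, x))) +
      (∑ α ∈ ofOrder d m, ∑ β ∈ ofOrder d m, η t •
        ((monomial ((2 * Real.pi) • ξ) α * monomial ((2 * Real.pi) • ξ) β) •
          (((ζ (t, x) : ℂ) * wave ξ x) • matVec (A α β t) (W (t, x))) +
        (-1 : ℝ) ^ m • ∑ j, p α β j ξ •
          (((ψ α β j (t, x) : ℂ) * wave ξ x) • matVec (A α β t) (W (t, x))))) := I1.add I6
  rw [integral_add I7 I5, integral_add I1 I6,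
    integral_add K1 K2, integral_smul, integral_smul,
    integral_smul, integral_smul, integral_finsetSum _ fun α _ => integrable_finsetSum _ fun β _ => I4 α β]
  have e1 (α) : ∫ x, ∑ β ∈ ofOrder d m, η t •
        ((monomial ((2 * Real.pi) • ξ) α * monomial ((2 * Real.pi) • ξ) β) •
          (((ζ (t, x) : ℂ) * wave ξ x) • matVec (A α β t) (W (t, x))) +
        (-1 : ℝ) ^ m • ∑ j, p α β j ξ •
          (((ψ α β j (t, x) : ℂ) * wave ξ x) • matVec (A α β t) (W (t, x)))) =
      ∑ β ∈ ofOrder d m, η t •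
        ((monomial ((2 * Real.pi) • ξ) α * monomial ((2 * Real.pi) • ξ) β) •
          matVec (A α β t) (cutoffFourier W ξ ζ t) +
        (-1 : ℝ) ^ m • ∑ j, p α β j ξ • matVec (A α β t) (cutoffFourier W ξ (ψ α β j) t)) := by
    rw [integral_finsetSum _ fun β _ => I4 α β]
    refine Finset.sum_congr rfl fun β _ => ?_
    rw [integral_smul, integral_add (I2 α β) (I3 α β), integral_smul, integral_smul,
      integral_finsetSum _ fun j _ => jp α β j, integral_smul_matVec _ iζ]
    congr 4
    funext j
    rw [integral_smul, integral_smul_matVec _ (iψ α β j)]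
    rfl
  simp only [e1]
  simp only [← Finset.smul_sum, Finset.sum_add_distrib]
  rw [show (∫ x, ((ζ (t, x) : ℂ) * wave ξ x) • W (t, x)) = cutoffFourier W ξ ζ t from rfl,
    show (∫ x, (((dirDeriv timeVec ζ (t, x) : ℝ) : ℂ) * wave ξ x) • W (t, x)) =
      cutoffFourier W ξ (dirDeriv timeVec ζ) t from rfl, commutatorTerm, symbolTerm]
  simp only [← Finset.smul_sum]
  generalize (∑ α ∈ ofOrder d m, ∑ β ∈ ofOrder d m,
    (monomial ((2 * Real.pi) • ξ) α * monomial ((2 * Real.pi) • ξ) β) •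
      matVec (A α β t) (cutoffFourier W ξ ζ t)) = S
  generalize (∑ α ∈ ofOrder d m, ∑ β ∈ ofOrder d m,
    ∑ j, p α β j ξ • matVec (A α β t) (cutoffFourier W ξ (ψ α β j) t)) = S'
  generalize cutoffFourier W ξ ζ t = y
  module

end

end ParabolicSystem

namespace ParabolicSystem

noncomputable section

open scoped InnerProductSpace

variable {d n m : ℕ}

variable {A : MultiIndex d → MultiIndex d → ℝ → Matrix (Fin n) (Fin n) ℂ} {lam M δ : ℝ}
  {W : SpaceTime d → Val n} {U : Set (SpaceTime d)}

/-! ### The `L₂` norm in time -/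

theorem norm_toLp_sq {X : Type*} [MeasurableSpace X] {μ : Measure X} {f : X → Val n}
    (hf : MemLp f 2 μ) : ‖hf.toLp f‖ ^ 2 = ∫ x, ‖f x‖ ^ 2 ∂μ := by
  have h : ((‖hf.toLp f‖ ^ 2 : ℝ) : ℂ) = ((∫ x, ‖f x‖ ^ 2 ∂μ : ℝ) : ℂ) := by
    have := inner_self_eq_norm_sq_to_K (𝕜 := ℂ) (hf.toLp f)
    push_cast
    refine (this.symm.trans ?_)
    rw [L2.inner_def, ← integral_complex_ofReal]
    refine integral_congr_ae ?_
    filter_upwards [hf.coeFn_toLp] with x h1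
    rw [h1, inner_self_eq_norm_sq_to_K]
    simp
  exact_mod_cast h

/-- The norm of `L₂((-1, 0))`. -/
def timeNorm (g : ℝ → Val n) : ℝ := √(∫ t in Set.Ioc (-1) 0, ‖g t‖ ^ 2)

theorem timeNorm_nonneg (g : ℝ → Val n) : 0 ≤ timeNorm g := Real.sqrt_nonneg _

theorem timeNorm_sq (g : ℝ → Val n) : timeNorm g ^ 2 = ∫ t in Set.Ioc (-1) 0, ‖g t‖ ^ 2 :=
  Real.sq_sqrt (integral_nonneg fun _ => sq_nonneg _)

theorem timeNorm_eq {g : ℝ → Val n} (hg : MemLp g 2 (volume.restrict (Set.Ioc (-1) 0))) :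
    timeNorm g = ‖hg.toLp g‖ := by
  rw [timeNorm, ← norm_toLp_sq hg, Real.sqrt_sq (norm_nonneg _)]

theorem timeNorm_add_le {f g : ℝ → Val n} (hf : MemLp f 2 (volume.restrict (Set.Ioc (-1) 0)))
    (hg : MemLp g 2 (volume.restrict (Set.Ioc (-1) 0))) :
    timeNorm (fun t => f t + g t) ≤ timeNorm f + timeNorm g := by
  rw [timeNorm_eq hf, timeNorm_eq hg, timeNorm_eq (g := fun t => f t + g t) (hf.add hg)]
  exact (congrArg norm (MemLp.toLp_add hf hg)).trans_le (norm_add_le _ _)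

theorem timeNorm_sum_le {ι : Type*} (s : Finset ι) {f : ι → ℝ → Val n}
    (hf : ∀ i ∈ s, MemLp (f i) 2 (volume.restrict (Set.Ioc (-1) 0))) :
    timeNorm (fun t => ∑ i ∈ s, f i t) ≤ ∑ i ∈ s, timeNorm (f i) := by
  classical
  induction s using Finset.induction_on with
  | empty => simp [timeNorm]
  | insert i s hi ih =>
    simp only [Finset.sum_insert hi]
    refine (timeNorm_add_le (hf i (Finset.mem_insert_self _ _))
      (memLp_finsetSum s fun j hj => hf j (Finset.mem_insert_of_mem hj))).trans ?_
    gcongr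
    exact ih fun j hj => hf j (Finset.mem_insert_of_mem hj)

theorem timeNorm_le_mul {f : ℝ → Val n} {g : ℝ → ℝ} {c : ℝ} (hc : 0 ≤ c)
    (hg : IntegrableOn (fun t => g t ^ 2) (Set.Ioc (-1) 0)) (h : ∀ t, ‖f t‖ ≤ c * g t) :
    timeNorm f ≤ c * √(∫ t in Set.Ioc (-1) 0, g t ^ 2) := by
  rw [timeNorm, ← Real.sqrt_sq hc, ← Real.sqrt_mul (sq_nonneg _)]
  refine Real.sqrt_le_sqrt ?_
  rw [← integral_const_mul]
  refine integral_mono_of_nonneg (.of_forall fun _ => sq_nonneg _) (hg.const_mul _)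
    (.of_forall fun t => ?_)
  simp only
  rw [← mul_pow]
  exact pow_le_pow_left₀ (norm_nonneg _) (h t) 2

/-! ### The ordinary differential equation for the Fourier transform -/

theorem memLp_symbolTerm (hA : IsLegendreHadamard m δ A) (ξ : Space d) {q : ENNReal} {μ : Measure ℝ}
    {y : ℝ → Val n} (hy : MemLp y q μ) : MemLp (fun t => symbolTerm m A lam ξ t (y t)) q μ := by
  refine MemLp.add (memLp_finsetSum _ fun α hα => memLp_finsetSum _ fun β hβ => ?_)
    (hy.const_smul lam)
  exact (memLp_matVec (hA.measurable α hα β hβ) (hA.bound α hα β hβ) hy).const_smul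
    (_ : ℝ)

theorem memLp_commutatorTerm (hA : IsLegendreHadamard m δ A) (ξ : Space d) {q : ENNReal}
    {μ : Measure ℝ} {N : MultiIndex d → MultiIndex d → ℕ}
    (p : ∀ α β, Fin (N α β) → Space d → ℂ) {ψ : ∀ α β, Fin (N α β) → SpaceTime d → ℝ}
    {ζ : SpaceTime d → ℝ} (h1 : MemLp (cutoffFourier W ξ (dirDeriv timeVec ζ)) q μ)
    (h2 : ∀ α β j, MemLp (cutoffFourier W ξ (ψ α β j)) q μ) :
    MemLp (commutatorTerm m A p ψ ζ W ξ) q μ := by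
  refine MemLp.sub h1 (memLp_finsetSum _ fun α hα => memLp_finsetSum _ fun β hβ => ?_)
  have : MemLp (fun t => ∑ j, p α β j ξ • matVec (A α β t) (cutoffFourier W ξ (ψ α β j) t)) q μ :=
    memLp_finsetSum _ fun j _ => (memLp_matVec (hA.measurable α hα β hβ) (hA.bound α hα β hβ)
      (h2 α β j)).const_smul (p α β j ξ)
  exact this.const_smul ((-1 : ℝ) ^ m)

/-- The symbol is bounded by the same quantity `1 + μ` that measures its coercivity, with a factor
free of `ξ` and `λ`. The extra `δ⁻¹` rewrites `|2πξ|^(2m)` in terms of `δ|2πξ|^(2m)`. -/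
theorem norm_symbolTerm_le (hA : IsLegendreHadamard m δ A) (hδ : 0 < δ) (hl : 0 < lam)
    (ξ : Space d) (t : ℝ) (y : Val n) :
    ‖symbolTerm m A lam ξ t y‖ ≤ ((ofOrder d m).card ^ 2 * (n * δ⁻¹) * δ⁻¹ + 1) *
      (1 + (δ * ‖(2 * Real.pi) • ξ‖ ^ (2 * m) + lam)) * ‖y‖ := by
  set X := ‖(2 * Real.pi) • ξ‖ with hX
  have hX0 : 0 ≤ X := norm_nonneg _
  have hterm : ∀ α ∈ ofOrder d m, ∀ β ∈ ofOrder d m,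
      ‖(monomial ((2 * Real.pi) • ξ) α * monomial ((2 * Real.pi) • ξ) β) • matVec (A α β t) y‖ ≤
        X ^ (2 * m) * (n * δ⁻¹ * ‖y‖) := by
    intro α hα β hβ
    rw [norm_smul, Real.norm_eq_abs, abs_mul, two_mul m, pow_add]
    have h1 := abs_monomial_le ((2 * Real.pi) • ξ) α
    have h2 := abs_monomial_le ((2 * Real.pi) • ξ) β
    rw [mem_ofOrder.mp hα] at h1
    rw [mem_ofOrder.mp hβ] at h2
    exact mul_le_mul (mul_le_mul h1 h2 (abs_nonneg _) (by positivity))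
      (norm_matVec_le (fun i j => hA.bound α hα β hβ i j t) y) (norm_nonneg _) (by positivity)
  have h1 : ‖symbolTerm m A lam ξ t y‖ ≤
      (ofOrder d m).card ^ 2 * (X ^ (2 * m) * (n * δ⁻¹ * ‖y‖)) + lam * ‖y‖ := by
    refine (norm_add_le _ _).trans (add_le_add ?_ ?_)
    · refine (norm_sum_le_of_le _ fun α hα => norm_sum_le_of_le _ fun β hβ =>
        hterm α hα β hβ).trans_eq ?_
      simp only [Finset.sum_const, nsmul_eq_mul]
      ring
    · rw [norm_smul, Real.norm_eq_abs, abs_of_pos hl]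
  refine h1.trans ?_
  set c := ((ofOrder d m).card : ℝ) ^ 2 * (n * δ⁻¹) with hc
  have hc0 : 0 ≤ c := by positivity
  have e : (c * δ⁻¹ + 1) * (1 + (δ * X ^ (2 * m) + lam)) * ‖y‖ -
      (((ofOrder d m).card : ℝ) ^ 2 * (X ^ (2 * m) * (n * δ⁻¹ * ‖y‖)) + lam * ‖y‖) =
      (c * δ⁻¹ * (1 + lam) + 1 + δ * X ^ (2 * m)) * ‖y‖ := by
    rw [hc]
    field_simp
    ring
  have : 0 ≤ (c * δ⁻¹ * (1 + lam) + 1 + δ * X ^ (2 * m)) * ‖y‖ := by positivity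
  linarith

theorem le_re_inner_symbolTerm (hA : IsLegendreHadamard m δ A) (ξ : Space d) (t : ℝ) (y : Val n) :
    (δ * ‖(2 * Real.pi) • ξ‖ ^ (2 * m) + lam) * ‖y‖ ^ 2 ≤
      (⟪y, symbolTerm m A lam ξ t y⟫_ℂ).re := by
  have h := hA.le_re_sum_inner t ((2 * Real.pi) • ξ) y
  have e : (⟪y, symbolTerm m A lam ξ t y⟫_ℂ).re =
      (∑ α ∈ ofOrder d m, ∑ β ∈ ofOrder d m,
        ((monomial ((2 * Real.pi) • ξ) α * monomial ((2 * Real.pi) • ξ) β : ℝ) : ℂ) *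
          ⟪y, matVec (A α β t) y⟫_ℂ).re + lam * ‖y‖ ^ 2 := by
    have hr (c : ℝ) (w : Val n) : ⟪y, c • w⟫_ℂ = (c : ℂ) * ⟪y, w⟫_ℂ := by
      rw [← Complex.coe_smul, inner_smul_right]
    rw [symbolTerm, inner_add_right, Complex.add_re]
    congr 1
    · simp only [inner_sum, hr]
    · rw [hr, inner_self_eq_norm_sq_to_K, Complex.re_ofReal_mul]
      congr 1
      simp [← Complex.ofReal_pow]
  rw [e, add_mul]
  linarith

/-- Testing with `η(t) ζ e^{-2πi x·ξ}` and integrating in `x` first leaves the weak form of an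
ordinary differential equation, which `ae_eq_primitive` integrates from the zero initial value. -/
theorem IsLocalSolution.cutoffFourier_ae_eq (hA : IsLegendreHadamard m δ A)
    (hW : IsLocalSolution m A lam M W) {ζ : SpaceTime d → ℝ}
    (hζ : IsTestFunction (cutoffRegion d) ζ)
    {N : MultiIndex d → MultiIndex d → ℕ} {p : ∀ α β, Fin (N α β) → Space d → ℂ}
    {ψ : ∀ α β, Fin (N α β) → SpaceTime d → ℝ}
    (hψ : ∀ α β j, IsTestFunction (cutoffRegion d) (ψ α β j))
    (hp : ∀ α β ξ, spaceDerivs α (spaceDerivs β fun X => (ζ X : ℂ) * wave ξ X.2) =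
        fun X => ((-Complex.I) ^ (order α + order β) *
          ((monomial ((2 * Real.pi) • ξ) α * monomial ((2 * Real.pi) • ξ) β : ℝ) : ℂ) * ζ X +
          ∑ j, p α β j ξ * ψ α β j X) * wave ξ X.2) (ξ : Space d) :
    ∀ᵐ t, t ∈ Set.Ioc (-1 : ℝ) 0 → cutoffFourier W ξ ζ t =
      ∫ s in (-1)..t, (commutatorTerm m A p ψ ζ W ξ s -
        symbolTerm m A lam ξ s (cutoffFourier W ξ ζ s)) := by
  set h := fun s => commutatorTerm m A p ψ ζ W ξ s -
        symbolTerm m A lam ξ s (cutoffFourier W ξ ζ s) with hh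
  have hY := hW.integrable_cutoffFourier ξ hζ
  have hh1 : Integrable h := by
    refine memLp_one_iff_integrable.mp (MemLp.sub (memLp_commutatorTerm hA ξ p ?_ ?_)
      (memLp_symbolTerm hA ξ (memLp_one_iff_integrable.mpr hY)))
    · exact memLp_one_iff_integrable.mpr (hW.integrable_cutoffFourier ξ (hζ.dirDeriv timeVec))
    · exact fun α β j => memLp_one_iff_integrable.mpr (hW.integrable_cutoffFourier ξ (hψ α β j))
  have hh0 : ∀ t ≤ -1, h t = 0 := by
    intro t ht
    simp [hh, commutatorTerm, symbolTerm, cutoffFourier_eq_zero W ξ hζ ht,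
      cutoffFourier_eq_zero W ξ (hζ.dirDeriv timeVec) ht,
      fun α β j => cutoffFourier_eq_zero W ξ (hψ α β j) ht, matVec_eq]
  have key := ae_eq_primitive hY hh1 (fun t ht => cutoffFourier_eq_zero W ξ hζ ht) hh0 ?_
  · filter_upwards [key, measure_eq_zero_iff_ae_notMem.mp (measure_singleton (0 : ℝ))] with t h1 h2 ht
    rw [h1 (lt_of_le_of_ne ht.2 h2), ← intervalIntegral.integral_Iic_sub_Iic hh1.integrableOn
      hh1.integrableOn]
    rw [setIntegral_eq_zero_of_forall_eq_zero (f := h) (t := Set.Iic (-1 : ℝ)) fun s hs => hh0 s hs, sub_zero]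
  · intro η hη hηc hη0
    have hζ' : ContDiff ℝ ∞ fun X : SpaceTime d => (ζ X : ℂ) * wave ξ X.2 :=
      (Complex.ofRealCLM.contDiff.comp hζ.smooth).mul (contDiff_wave_snd ξ)
    set Φ := fun X : SpaceTime d => η X.1 • ((ζ X : ℂ) * wave ξ X.2) with hΦ
    have hΦs : ContDiff ℝ ∞ Φ := (hη.comp contDiff_fst).smul hζ'
    have hsub : Function.support Φ ⊆ Function.support ζ := fun X hX => by
      contrapose! hX
      simp only [Function.mem_support, not_not] at hX ⊢
      simp [hΦ, hX]
    have hts : tsupport Φ ⊆ tsupport ζ := closure_mono hsub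
    have hΦc : HasCompactSupport Φ := hζ.compact.of_isClosed_subset (isClosed_tsupport _) hts
    have htη : tsupport Φ ⊆ Prod.fst ⁻¹' tsupport η := by
      refine closure_minimal (fun X hX => subset_tsupport _ ?_)
        ((isClosed_tsupport η).preimage continuous_fst)
      contrapose! hX
      simp only [Function.mem_support, not_not] at hX ⊢
      simp [hΦ, hX]
    -- The factor `η` keeps the support in `t < 0`, while `ζ` keeps it in `t > -1` and inside the
    -- unit ball.
    have hΦU : tsupport Φ ⊆ Q m 1 0 := fun X hX => by
      have h1 := hζ.supp (hts hX)
      have h2 := hη0 (htη hX)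
      refine ⟨⟨?_, h2⟩, h1.2⟩
      simpa using h1.1
    have hv := hW.veryWeak.integral_complex hA hW.integrable.locallyIntegrable hΦs hΦc hΦU
    have hi := integrable_veryWeakIntegrand hA lam hW.integrable.locallyIntegrable hΦs hΦc
    rw [show (volume : Measure (SpaceTime d)) = volume.prod volume from rfl] at hv hi
    rw [integral_prod _ hi] at hv
    simp only [hΦ, hW.integral_veryWeakIntegrand_slice hζ hψ hp hη] at hv
    obtain ⟨B, hB⟩ := hηc.exists_bound_of_continuous hη.continuous
    have hη' : Continuous (deriv η) := hη.continuous_deriv (by simp)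
    obtain ⟨B', hB'⟩ := hηc.deriv.exists_bound_of_continuous hη'
    have i1 : Integrable fun t => deriv η t • cutoffFourier W ξ ζ t :=
      hY.bdd_smul B' hη'.aestronglyMeasurable (.of_forall hB')
    have i2 : Integrable fun t => η t • h t :=
      hh1.bdd_smul B hη.continuous.aestronglyMeasurable (.of_forall hB)
    have i3 : Integrable fun t => -(deriv η t • cutoffFourier W ξ ζ t) := i1.neg
    rw [integral_sub i3 i2, integral_neg, sub_eq_zero] at hv
    rw [← hv, neg_neg]

end

end ParabolicSystem

/-! ### Bootstrap: decay in the frequency and Hölder continuity in time. -/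

namespace ParabolicSystem

noncomputable section

open scoped InnerProductSpace

variable {d n m : ℕ}

variable {A : MultiIndex d → MultiIndex d → ℝ → Matrix (Fin n) (Fin n) ℂ} {lam M δ : ℝ}
  {W : SpaceTime d → Val n} {U : Set (SpaceTime d)}

/-- Decay of order `s` in `ξ` of the localized Fourier transforms of solutions, uniformly over all
systems with ellipticity constant `δ`. -/
def HasFourierDecay (d n m : ℕ) (δ : ℝ) (s : ℕ) : Prop :=
  ∀ ζ : SpaceTime d → ℝ, IsTestFunction (cutoffRegion d) ζ → ∃ C : ℝ, 0 ≤ C ∧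
    ∀ (A : MultiIndex d → MultiIndex d → ℝ → Matrix (Fin n) (Fin n) ℂ) (lam M : ℝ)
      (W : SpaceTime d → Val n), IsLegendreHadamard m δ A → 0 < lam → IsLocalSolution m A lam M W →
    ∀ ξ, (1 + ‖ξ‖) ^ s * timeNorm (cutoffFourier W ξ ζ) ≤ C * √M

theorem hasFourierDecay_zero (d n m : ℕ) (δ : ℝ) : HasFourierDecay d n m δ 0 := by
  intro ζ hζ
  obtain ⟨B, hB0, hB⟩ := hζ.exists_bound
  refine ⟨B, hB0, fun A lam M W hA hl hW ξ => ?_⟩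
  rw [pow_zero, one_mul]
  have hi : Integrable fun t => (∫ x, ‖W (t, x)‖) ^ 2 := hW.memLp.integrable_sq
  refine (timeNorm_le_mul hB0 hi.integrableOn (hW.norm_cutoffFourier_le ξ hB)).trans ?_
  gcongr
  exact (setIntegral_le_integral hi (.of_forall fun _ => sq_nonneg _)).trans hW.bound

/-- Converts the factor `1 + μ` gained in the energy estimate into `2m` powers of `1 + |ξ|`.
Dropping `λ` is harmless, since it only helps. -/
theorem one_add_pow_le_symbol (hδ : 0 < δ) (hl : 0 < lam) (m : ℕ) (ξ : Space d) :
    (1 + ‖ξ‖) ^ (2 * m) ≤ 2 ^ (2 * m - 1) * (1 + δ⁻¹) *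
      (1 + (δ * ‖(2 * Real.pi) • ξ‖ ^ (2 * m) + lam)) := by
  have h1 := add_pow_le zero_le_one (norm_nonneg ξ) (2 * m)
  rw [one_pow] at h1
  refine h1.trans ?_
  rw [mul_assoc]
  gcongr
  have h2 : ‖ξ‖ ≤ ‖(2 * Real.pi) • ξ‖ := by
    rw [norm_smul, Real.norm_of_nonneg (by positivity)]
    exact le_mul_of_one_le_left (norm_nonneg _) (by linarith [Real.pi_gt_three])
  have h3 : ‖ξ‖ ^ (2 * m) ≤ ‖(2 * Real.pi) • ξ‖ ^ (2 * m) := by gcongr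
  have h4 : δ⁻¹ * (δ * ‖(2 * Real.pi) • ξ‖ ^ (2 * m)) = ‖(2 * Real.pi) • ξ‖ ^ (2 * m) := by
    field_simp
  have h5 : 0 ≤ δ * ‖(2 * Real.pi) • ξ‖ ^ (2 * m) := by positivity
  have h6 : 0 ≤ δ⁻¹ * (1 + lam) := by positivity
  nlinarith

/-- The energy estimate gains one power of `ξ` over the cutoff terms. -/
theorem HasFourierDecay.exists_primitive (hm : 1 ≤ m) (hδ : 0 < δ) {s : ℕ}
    (hs : HasFourierDecay d n m δ s) {ζ : SpaceTime d → ℝ}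
    (hζ : IsTestFunction (cutoffRegion d) ζ) : ∃ C : ℝ, 0 ≤ C ∧
    ∀ (A : MultiIndex d → MultiIndex d → ℝ → Matrix (Fin n) (Fin n) ℂ) (lam M : ℝ)
      (W : SpaceTime d → Val n), IsLegendreHadamard m δ A → 0 < lam → IsLocalSolution m A lam M W →
    ∀ ξ, (1 + ‖ξ‖) ^ (s + 1) * timeNorm (cutoffFourier W ξ ζ) ≤ C * √M ∧ ∃ P : ℝ → Val n,
      (∀ᵐ t, t ∈ Set.Ioc (-1 : ℝ) 0 → cutoffFourier W ξ ζ t = P t) ∧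
      (∀ t ∈ Set.Ioc (-1 : ℝ) 0, (1 + ‖ξ‖) ^ (s + 1) * ‖P t‖ ≤ C * √M * (1 + ‖ξ‖) ^ (2 * m)) ∧
      ∀ r ∈ Set.Ioc (-1 : ℝ) 0, ∀ t ∈ Set.Ioc (-1 : ℝ) 0, r ≤ t →
        (1 + ‖ξ‖) ^ (s + 1) * ‖P t - P r‖ ≤ √(t - r) * (C * √M * (1 + ‖ξ‖) ^ (2 * m)) := by
  choose N p ψ c hc hψ hpc hp using exists_spaceDerivs_mul_wave hζ
  -- The decay hypothesis is used for the cutoffs produced by the commutators, which is why it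
  -- quantifies over all of them.
  choose D hD hdec using fun α β j => hs (ψ α β j) (hψ α β j)
  obtain ⟨D₀, hD₀, hdec₀⟩ := hs _ (hζ.dirDeriv timeVec)
  set K₁ : ℝ := D₀ + ∑ α ∈ ofOrder d m, ∑ β ∈ ofOrder d m, ∑ j, c α β * (n * δ⁻¹) * D α β j with hK₁
  have hK₁0 : 0 ≤ K₁ := add_nonneg hD₀ (Finset.sum_nonneg fun α _ => Finset.sum_nonneg fun β _ =>
    Finset.sum_nonneg fun j _ => mul_nonneg (mul_nonneg (hc α β) (by positivity)) (hD α β j))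
  set K : ℝ := (ofOrder d m).card ^ 2 * (n * δ⁻¹) * δ⁻¹ + 1 with hK
  have hK0 : 0 ≤ K := by positivity
  set c₁ : ℝ := 2 ^ (2 * m - 1) * (1 + δ⁻¹) with hc₁
  have hc₁0 : 0 ≤ c₁ := by positivity
  -- The three summands serve the sup bound, the `L₂` bound and the Hölder bound, in turn; `K₁`
  -- bounds the commutator.
  set C := (2 + √10 * c₁ + √(2 + 20 * K ^ 2)) * K₁ with hC
  have hC0 : 0 ≤ C := by positivity
  refine ⟨C, hC0, fun A lam M W hA hl hW ξ => ?_⟩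
  set z := 1 + ‖ξ‖ with hz
  have hz1 : 1 ≤ z := by linarith [norm_nonneg ξ]
  have hz0 : 0 < z := by linarith
  set F := commutatorTerm m A p ψ ζ W ξ with hF
  set G := fun t => symbolTerm m A lam ξ t (cutoffFourier W ξ ζ t) with hG
  have mY {φ : SpaceTime d → ℝ} (h : IsTestFunction (cutoffRegion d) φ) :
      MemLp (cutoffFourier W ξ φ) 2 (volume.restrict (Set.Ioc (-1) 0)) :=
    (hW.memLp_cutoffFourier ξ h).restrict _
  have mF : MemLp F 2 (volume.restrict (Set.Ioc (-1) 0)) :=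
    memLp_commutatorTerm hA ξ p (mY (hζ.dirDeriv timeVec)) fun α β j => mY (hψ α β j)
  have mG : MemLp G 2 (volume.restrict (Set.Ioc (-1) 0)) := memLp_symbolTerm hA ξ (mY hζ)
  -- The commutator symbols satisfy `|p| z ≤ c z^(2m)`. The spare factor `z` raises the decay order
  -- from `s` to `s + 1`, at the price of `z^(2m)`.
  have hFn : z ^ (s + 1) * timeNorm F ≤ K₁ * √M * z ^ (2 * m) := by
    have hzm : z ≤ z ^ (2 * m) := le_self_pow₀ hz1 (by omega)
    have t1 : timeNorm F ≤ timeNorm (cutoffFourier W ξ (dirDeriv timeVec ζ)) +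
        ∑ α ∈ ofOrder d m, ∑ β ∈ ofOrder d m, ∑ j,
          ‖p α β j ξ‖ * (n * δ⁻¹) * timeNorm (cutoffFourier W ξ (ψ α β j)) := by
      set g := fun (α β : MultiIndex d) (j : Fin (N α β)) (t : ℝ) =>
        p α β j ξ • matVec (A α β t) (cutoffFourier W ξ (ψ α β j) t) with hg
      have mg : ∀ α ∈ ofOrder d m, ∀ β ∈ ofOrder d m, ∀ j,
          MemLp (fun t => (-(-1 : ℝ) ^ m) • g α β j t) 2 (volume.restrict (Set.Ioc (-1) 0)) :=
        fun α hα β hβ j => ((memLp_matVec (hA.measurable α hα β hβ) (hA.bound α hα β hβ)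
          (mY (hψ α β j))).const_smul (p α β j ξ)).const_smul (-(-1 : ℝ) ^ m)
      have e : F = fun t => cutoffFourier W ξ (dirDeriv timeVec ζ) t +
          ∑ α ∈ ofOrder d m, ∑ β ∈ ofOrder d m, ∑ j, (-(-1 : ℝ) ^ m) • g α β j t := by
        funext t
        simp only [hF, commutatorTerm, hg, neg_smul, Finset.sum_neg_distrib, Finset.smul_sum,
          sub_eq_add_neg]
      rw [e]
      have mg2 : ∀ α ∈ ofOrder d m, ∀ β ∈ ofOrder d m,
          MemLp (fun t => ∑ j, (-(-1 : ℝ) ^ m) • g α β j t) 2 (volume.restrict (Set.Ioc (-1) 0)) :=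
        fun α hα β hβ => memLp_finsetSum _ fun j _ => mg α hα β hβ j
      have mg3 : ∀ α ∈ ofOrder d m,
          MemLp (fun t => ∑ β ∈ ofOrder d m, ∑ j, (-(-1 : ℝ) ^ m) • g α β j t) 2
            (volume.restrict (Set.Ioc (-1) 0)) :=
        fun α hα => memLp_finsetSum _ fun β hβ => mg2 α hα β hβ
      refine (timeNorm_add_le (mY (hζ.dirDeriv timeVec)) (memLp_finsetSum _ mg3)).trans ?_
      gcongr
      refine (timeNorm_sum_le _ mg3).trans (Finset.sum_le_sum fun α hα => ?_)
      refine (timeNorm_sum_le _ (mg2 α hα)).trans (Finset.sum_le_sum fun β hβ => ?_)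
      refine (timeNorm_sum_le _ fun j _ => mg α hα β hβ j).trans (Finset.sum_le_sum fun j _ => ?_)
      refine timeNorm_le_mul (g := fun t => ‖cutoffFourier W ξ (ψ α β j) t‖) (by positivity)
        (mY (hψ α β j)).norm.integrable_sq fun t => ?_
      rw [norm_smul, norm_smul, norm_neg, norm_pow, norm_neg, norm_one, one_pow, one_mul, mul_assoc]
      gcongr
      exact norm_matVec_le (fun i k => hA.bound α hα β hβ i k t) _
    have t2 : z ^ (s + 1) * timeNorm (cutoffFourier W ξ (dirDeriv timeVec ζ)) ≤
        D₀ * √M * z ^ (2 * m) := by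
      have := hdec₀ A lam M W hA hl hW ξ
      calc _ = (z ^ s * timeNorm (cutoffFourier W ξ (dirDeriv timeVec ζ))) * z := by ring
        _ ≤ _ := mul_le_mul this hzm hz0.le (by positivity)
    have t3 : ∀ α ∈ ofOrder d m, ∀ β ∈ ofOrder d m, ∀ j,
        z ^ (s + 1) * (‖p α β j ξ‖ * (n * δ⁻¹) * timeNorm (cutoffFourier W ξ (ψ α β j))) ≤
          c α β * (n * δ⁻¹) * D α β j * √M * z ^ (2 * m) := by
      intro α hα β hβ j
      have h1 := hdec α β j A lam M W hA hl hW ξ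
      have h2 := hpc α β j ξ
      rw [mem_ofOrder.mp hα, mem_ofOrder.mp hβ, ← two_mul, ← hz] at h2
      calc _ = (‖p α β j ξ‖ * z) * (n * δ⁻¹) * (z ^ s * timeNorm (cutoffFourier W ξ (ψ α β j))) := by
            ring
        _ ≤ (c α β * z ^ (2 * m)) * (n * δ⁻¹) * (D α β j * √M) := by
            refine mul_le_mul (mul_le_mul_of_nonneg_right h2 (by positivity)) h1
              (mul_nonneg (by positivity) (timeNorm_nonneg _)) ?_
            have := hc α β
            positivity
        _ = _ := by ring
    calc _ ≤ z ^ (s + 1) * _ := mul_le_mul_of_nonneg_left t1 (by positivity)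
      _ = z ^ (s + 1) * timeNorm (cutoffFourier W ξ (dirDeriv timeVec ζ)) +
        ∑ α ∈ ofOrder d m, ∑ β ∈ ofOrder d m, ∑ j, z ^ (s + 1) * (
          ‖p α β j ξ‖ * (n * δ⁻¹) * timeNorm (cutoffFourier W ξ (ψ α β j))) := by
        rw [mul_add]; simp only [Finset.mul_sum]
      _ ≤ D₀ * √M * z ^ (2 * m) + ∑ α ∈ ofOrder d m, ∑ β ∈ ofOrder d m, ∑ j,
          c α β * (n * δ⁻¹) * D α β j * √M * z ^ (2 * m) :=
        add_le_add t2 (Finset.sum_le_sum fun α hα => Finset.sum_le_sum fun β hβ =>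
          Finset.sum_le_sum fun j _ => t3 α hα β hβ j)
      _ = _ := by
        rw [hK₁]
        simp only [← Finset.sum_mul]
        ring
  set μ := δ * ‖(2 * Real.pi) • ξ‖ ^ (2 * m) + lam with hμ
  have hμ0 : 0 ≤ μ := by positivity
  obtain ⟨E1, E2, E3⟩ := energy_estimate (y := cutoffFourier W ξ ζ) (h := fun t => F t - G t)
    hμ0 hK0 mF (mF.sub mG) (hW.cutoffFourier_ae_eq hA hζ hψ hp ξ) (fun _ => rfl)
    (fun t => le_re_inner_symbolTerm hA ξ t _) (fun t => norm_symbolTerm_le hA hδ hl ξ t _)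
  rw [← timeNorm_sq] at E1 E2 E3
  rw [← timeNorm_sq] at E2
  have hF0 := timeNorm_nonneg F
  have hX0 : 0 ≤ K₁ * √M * z ^ (2 * m) := by positivity
  refine ⟨?_, fun t => ∫ r in (-1)..t, (F r - G r), hW.cutoffFourier_ae_eq hA hζ hψ hp ξ, ?_, ?_⟩
  · have h1 : (1 + μ) * timeNorm (cutoffFourier W ξ ζ) ≤ √10 * timeNorm F := by
      refine (abs_le_of_sq_le_sq' ?_ (by positivity)).2
      rw [mul_pow, mul_pow, Real.sq_sqrt (by norm_num)]
      exact E2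
    have h2 := one_add_pow_le_symbol hδ hl m ξ
    -- The gain `1 + μ ≳ z^(2m)` exactly cancels the loss in the bound for `F`. The pointwise bounds
    -- below have no such gain and keep the factor `z^(2m)`.
    have h3 : z ^ (2 * m) * (z ^ (s + 1) * timeNorm (cutoffFourier W ξ ζ)) ≤
        z ^ (2 * m) * (C * √M) := by
      calc _ = z ^ (s + 1) * (z ^ (2 * m) * timeNorm (cutoffFourier W ξ ζ)) := by ring
        _ ≤ z ^ (s + 1) * (c₁ * (1 + μ) * timeNorm (cutoffFourier W ξ ζ)) := by
          refine mul_le_mul_of_nonneg_left (mul_le_mul_of_nonneg_right h2 (timeNorm_nonneg _)) ?_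
          positivity
        _ ≤ z ^ (s + 1) * (c₁ * (√10 * timeNorm F)) := by
          rw [mul_assoc c₁]
          gcongr
        _ = √10 * c₁ * (z ^ (s + 1) * timeNorm F) := by ring
        _ ≤ √10 * c₁ * (K₁ * √M * z ^ (2 * m)) := by gcongr
        _ ≤ (2 + √10 * c₁ + √(2 + 20 * K ^ 2)) * (K₁ * √M * z ^ (2 * m)) := by
          gcongr
          linarith [Real.sqrt_nonneg (2 + 20 * K ^ 2)]
        _ = _ := by rw [hC]; ring
    exact le_of_mul_le_mul_left h3 (by positivity)
  · intro t ht
    have h1 : ‖∫ r in (-1)..t, (F r - G r)‖ ≤ 2 * timeNorm F := by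
      refine (abs_le_of_sq_le_sq' ?_ (by positivity)).2
      rw [mul_pow]
      exact (E1 t (Set.Ioc_subset_Icc_self ht)).trans_eq (by norm_num)
    calc _ ≤ z ^ (s + 1) * (2 * timeNorm F) := by gcongr
      _ = 2 * (z ^ (s + 1) * timeNorm F) := by ring
      _ ≤ 2 * (K₁ * √M * z ^ (2 * m)) := by gcongr
      _ ≤ (2 + √10 * c₁ + √(2 + 20 * K ^ 2)) * (K₁ * √M * z ^ (2 * m)) := by
        gcongr
        have : 0 ≤ √10 * c₁ := by positivity
        linarith [Real.sqrt_nonneg (2 + 20 * K ^ 2)]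
      _ = _ := by rw [hC]; ring
  · intro r hr t ht hrt
    have h1 : ‖(∫ r in (-1)..t, (F r - G r)) - ∫ r in (-1)..r, (F r - G r)‖ ≤
        √(t - r) * (√(2 + 20 * K ^ 2) * timeNorm F) := by
      refine (abs_le_of_sq_le_sq' ?_ (by positivity)).2
      rw [mul_pow, mul_pow, Real.sq_sqrt (sub_nonneg.mpr hrt), Real.sq_sqrt (by positivity)]
      exact E3 r (Set.Ioc_subset_Icc_self hr) t (Set.Ioc_subset_Icc_self ht) hrt
    calc _ ≤ z ^ (s + 1) * (√(t - r) * (√(2 + 20 * K ^ 2) * timeNorm F)) := by gcongr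
      _ = √(t - r) * (√(2 + 20 * K ^ 2) * (z ^ (s + 1) * timeNorm F)) := by ring
      _ ≤ √(t - r) * (√(2 + 20 * K ^ 2) * (K₁ * √M * z ^ (2 * m))) := by gcongr
      _ ≤ √(t - r) * ((2 + √10 * c₁ + √(2 + 20 * K ^ 2)) * (K₁ * √M * z ^ (2 * m))) := by
        gcongr
        have : 0 ≤ √10 * c₁ := by positivity
        linarith
      _ = _ := by rw [hC]; ring

theorem hasFourierDecay (d n : ℕ) (hm : 1 ≤ m) (hδ : 0 < δ) (s : ℕ) : HasFourierDecay d n m δ s := by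
  induction s with
  | zero => exact hasFourierDecay_zero d n m δ
  | succ s ih =>
    intro ζ hζ
    obtain ⟨C, hC, h⟩ := ih.exists_primitive hm hδ hζ
    exact ⟨C, hC, fun A lam M W hA hl hW ξ => (h A lam M W hA hl hW ξ).1⟩

/-- The localized Fourier transforms decay rapidly and are Hölder continuous in time. -/
theorem exists_fourier_bounds (n : ℕ) (hm : 1 ≤ m) (hδ : 0 < δ) (k : ℕ) {ζ : SpaceTime d → ℝ}
    (hζ : IsTestFunction (cutoffRegion d) ζ) : ∃ C : ℝ, 0 ≤ C ∧
    ∀ (A : MultiIndex d → MultiIndex d → ℝ → Matrix (Fin n) (Fin n) ℂ) (lam M : ℝ)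
      (W : SpaceTime d → Val n), IsLegendreHadamard m δ A → 0 < lam → IsLocalSolution m A lam M W →
    ∀ ξ, ∃ P : ℝ → Val n, (∀ᵐ t, t ∈ Set.Ioc (-1 : ℝ) 0 → cutoffFourier W ξ ζ t = P t) ∧
      (∀ t ∈ Set.Ioc (-1 : ℝ) 0, (1 + ‖ξ‖) ^ k * ‖P t‖ ≤ C * √M) ∧
      ∀ r ∈ Set.Ioc (-1 : ℝ) 0, ∀ t ∈ Set.Ioc (-1 : ℝ) 0, r ≤ t →
        (1 + ‖ξ‖) ^ k * ‖P t - P r‖ ≤ √(t - r) * (C * √M) := by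
  -- Starting from `2m` more powers of decay than required absorbs the factor `(1 + |ξ|)^(2m)` in
  -- the pointwise bounds.
  obtain ⟨C, hC, h⟩ := (hasFourierDecay d n hm hδ (k + 2 * m)).exists_primitive hm hδ hζ
  refine ⟨C, hC, fun A lam M W hA hl hW ξ => ?_⟩
  obtain ⟨-, P, h1, h2, h3⟩ := h A lam M W hA hl hW ξ
  have hz1 : 1 ≤ 1 + ‖ξ‖ := by linarith [norm_nonneg ξ]
  have key {a b : ℝ} (ha : 0 ≤ a) (hab : (1 + ‖ξ‖) ^ (k + 2 * m + 1) * a ≤ b * (1 + ‖ξ‖) ^ (2 * m)) :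
      (1 + ‖ξ‖) ^ k * a ≤ b := by
    have e : (1 + ‖ξ‖) ^ (2 * m) * ((1 + ‖ξ‖) ^ k * a) ≤ (1 + ‖ξ‖) ^ (2 * m) * b := by
      calc _ = (1 + ‖ξ‖) ^ (k + 2 * m) * a := by rw [pow_add]; ring
        _ ≤ (1 + ‖ξ‖) ^ (k + 2 * m + 1) * a :=
          mul_le_mul_of_nonneg_right (pow_le_pow_right₀ hz1 (Nat.le_succ _)) ha
        _ ≤ _ := by rwa [mul_comm _ b]
    exact le_of_mul_le_mul_left e (by positivity)
  refine ⟨P, h1, fun t ht => key (norm_nonneg _) (h2 t ht), fun r hr t ht hrt => ?_⟩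
  exact key (norm_nonneg _) ((h3 r hr t ht hrt).trans_eq (by ring))

end

end ParabolicSystem

namespace ParabolicSystem

noncomputable section

open scoped FourierTransform SchwartzMap

variable {d n m : ℕ}

variable {A : MultiIndex d → MultiIndex d → ℝ → Matrix (Fin n) (Fin n) ℂ} {lam M δ : ℝ}
  {W : SpaceTime d → Val n} {U : Set (SpaceTime d)}

/-! ### Fourier inversion -/

theorem continuous_fourier {v : Space d → Val n} (hv : Integrable v) : Continuous (𝓕 v) :=
  VectorFourier.fourierIntegral_continuous Real.continuous_fourierChar
    (L := innerₗ (Space d)) continuous_inner hv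

theorem continuous_fourierInv {v : Space d → Val n} (hv : Integrable v) : Continuous (𝓕⁻ v) :=
  VectorFourier.fourierIntegral_continuous Real.continuous_fourierChar
    (L := -innerₗ (Space d)) continuous_inner.neg hv

/-- Fourier inversion, almost everywhere. -/
theorem ae_eq_fourierInv_fourier {v : Space d → Val n} (hv : Integrable v)
    (hv' : Integrable (𝓕 v)) : ∀ᵐ x, v x = 𝓕⁻ (𝓕 v) x := by
  refine ae_eq_of_integral_contDiff_smul_eq hv.locallyIntegrable
    (continuous_fourierInv hv').locallyIntegrable fun φ hφ hφc => ?_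
  have hc : ContDiff ℝ ∞ fun x => (φ x : ℂ) := Complex.ofRealCLM.contDiff.comp hφ
  have hcc : HasCompactSupport fun x => (φ x : ℂ) := hφc.comp_left (g := ((↑) : ℝ → ℂ)) (by simp)
  let Φ : 𝓢(Space d, ℂ) := hcc.toSchwartzMap hc
  have e0 (x : Space d) : (φ x : ℂ) = Φ x := rfl
  have e1 : 𝓕 ((𝓕⁻ Φ : 𝓢(Space d, ℂ)) : Space d → ℂ) = Φ := by
    rw [← SchwartzMap.fourier_coe, FourierTransform.fourier_fourierInv_eq]
  -- Both transforms are moved onto the test function, where inversion holds in Schwartz space; `v`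
  -- is only integrable, so the identity is obtained by duality.
  have h1 := VectorFourier.integral_fourierIntegral_smul_eq_flip (L := innerₗ (Space d))
    Real.continuous_fourierChar continuous_inner
    ((𝓕⁻ Φ : 𝓢(Space d, ℂ)).integrable (μ := volume)) hv
  have h2 := VectorFourier.integral_fourierIntegral_smul_eq_flip (L := -innerₗ (Space d))
    Real.continuous_fourierChar continuous_inner.neg (Φ.integrable (μ := volume)) hv'
  have f1 : VectorFourier.fourierIntegral Real.fourierChar volume (innerₗ (Space d)).flip v = 𝓕 v := by
    rw [flip_innerₗ]; rfl
  have f2 : VectorFourier.fourierIntegral Real.fourierChar volume (-innerₗ (Space d)).flip (𝓕 v) =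
      𝓕⁻ (𝓕 v) := by
    have : (-innerₗ (Space d)).flip = -innerₗ (Space d) := by
      ext x y; simp [real_inner_comm]
    rw [this]; rfl
  have f3 : VectorFourier.fourierIntegral Real.fourierChar volume (-innerₗ (Space d)) (Φ : Space d → ℂ) =
      (𝓕⁻ Φ : 𝓢(Space d, ℂ)) := by
    rw [SchwartzMap.fourierInv_coe]; rfl
  have f4 : VectorFourier.fourierIntegral Real.fourierChar volume (innerₗ (Space d))
      ((𝓕⁻ Φ : 𝓢(Space d, ℂ)) : Space d → ℂ) = Φ := e1
  rw [f1, f4] at h1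
  rw [f2, f3] at h2
  have : ∫ x, (φ x : ℂ) • v x = ∫ x, (φ x : ℂ) • 𝓕⁻ (𝓕 v) x := h1.trans h2
  simpa only [Complex.coe_smul] using this

theorem cutoffFourier_eq_fourier (W : SpaceTime d → Val n) (ξ : Space d) (ζ : SpaceTime d → ℝ)
    (t : ℝ) : cutoffFourier W ξ ζ t = 𝓕 (fun x => (ζ (t, x) : ℂ) • W (t, x)) ξ := by
  rw [Real.fourier_eq']
  refine integral_congr_ae (.of_forall fun x => ?_)
  simp only
  rw [mul_comm, mul_smul]
  rfl

theorem integrable_one_add_norm_inv (d : ℕ) :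
    Integrable fun ξ : Space d => ((1 + ‖ξ‖) ^ (d + 1))⁻¹ := by
  have := integrable_one_add_norm (E := Space d) (μ := volume) (r := (d + 1 : ℕ)) (by simp)
  refine this.congr (.of_forall fun ξ => ?_)
  simp only
  rw [Real.rpow_neg (by positivity), Real.rpow_natCast]

theorem norm_exp_sub_one_le (a : ℝ) : ‖Complex.exp ((a : ℂ) * Complex.I) - 1‖ ≤ |a| := by
  rw [mul_comm]
  exact Real.norm_exp_I_mul_ofReal_sub_one_le

/-- A function is almost everywhere close to a constant, if its Fourier transform decays and is
close to the one whose integral is the constant. -/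
theorem norm_sub_integral_le {v : Space d → Val n} (hv : Integrable v) {g : Space d → Val n}
    (hg : AEStronglyMeasurable g volume) {K ε : ℝ}
    (h1 : ∀ ξ, (1 + ‖ξ‖) ^ (d + 2) * ‖𝓕 v ξ‖ ≤ K) (h2 : ∀ ξ, (1 + ‖ξ‖) ^ (d + 2) * ‖𝓕 v ξ - g ξ‖ ≤ ε) :
    ∀ᵐ x, ‖v x - ∫ ξ, g ξ‖ ≤
      (2 * Real.pi * ‖x‖ * K + ε) * ∫ ξ : Space d, ((1 + ‖ξ‖) ^ (d + 1))⁻¹ := by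
  have hz (ξ : Space d) : 1 ≤ 1 + ‖ξ‖ := by linarith [norm_nonneg ξ]
  have hdiv {ξ : Space d} {a b : ℝ} (h : (1 + ‖ξ‖) ^ (d + 2) * a ≤ b) :
      (1 + ‖ξ‖) * a ≤ b * ((1 + ‖ξ‖) ^ (d + 1))⁻¹ := by
    have : 0 < (1 + ‖ξ‖) ^ (d + 1) := by have := hz ξ; positivity
    rw [← div_eq_mul_inv, le_div_iff₀ this]
    calc _ = (1 + ‖ξ‖) ^ (d + 2) * a := by ring
      _ ≤ b := h
  have hdiv' {ξ : Space d} {a b : ℝ} (ha : 0 ≤ a) (h : (1 + ‖ξ‖) ^ (d + 2) * a ≤ b) :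
      a ≤ b * ((1 + ‖ξ‖) ^ (d + 1))⁻¹ :=
    (le_mul_of_one_le_left ha (hz ξ)).trans (hdiv h)
  have hI := integrable_one_add_norm_inv d
  have i1 : Integrable (𝓕 v) := (hI.const_mul K).mono' (continuous_fourier hv).aestronglyMeasurable
    (.of_forall fun ξ => hdiv' (norm_nonneg _) (h1 ξ))
  have i2 : Integrable fun ξ => 𝓕 v ξ - g ξ := (hI.const_mul ε).mono'
    ((continuous_fourier hv).aestronglyMeasurable.sub hg)
    (.of_forall fun ξ => hdiv' (norm_nonneg _) (h2 ξ))
  have i3 : Integrable g := by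
    have := i1.sub i2
    refine this.congr (.of_forall fun ξ => ?_)
    simp
  filter_upwards [ae_eq_fourierInv_fourier hv i1] with x hx
  -- The first summand measures displacement in `x` and costs a factor `2π|x||ξ|`, the second the
  -- change of transform. Of the `d + 2` powers of decay one pays for `|ξ|`, and the other `d + 1`
  -- give integrability.
  have e (ξ : Space d) : Complex.exp ((2 * Real.pi * inner ℝ ξ x : ℝ) * Complex.I) • 𝓕 v ξ - g ξ =
      (Complex.exp ((2 * Real.pi * inner ℝ ξ x : ℝ) * Complex.I) - 1) • 𝓕 v ξ + (𝓕 v ξ - g ξ) := by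
    rw [sub_smul, one_smul]; abel
  have i4 : Integrable fun ξ =>
      Complex.exp ((2 * Real.pi * inner ℝ ξ x : ℝ) * Complex.I) • 𝓕 v ξ := by
    refine i1.norm.mono' ?_ (.of_forall fun ξ => ?_)
    · have c1 : Continuous fun ξ : Space d =>
          Complex.exp ((2 * Real.pi * inner ℝ ξ x : ℝ) * Complex.I) := by fun_prop
      exact c1.aestronglyMeasurable.smul (continuous_fourier hv).aestronglyMeasurable
    · rw [norm_smul, Complex.norm_exp_ofReal_mul_I, one_mul]
  rw [hx, Real.fourierInv_eq', ← integral_sub i4 i3, ← integral_const_mul]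
  refine norm_integral_le_of_norm_le (hI.const_mul _) (.of_forall fun ξ => ?_)
  rw [e]
  refine (norm_add_le _ _).trans ?_
  rw [add_mul]
  refine add_le_add ?_ (hdiv' (norm_nonneg _) (h2 ξ))
  rw [norm_smul]
  have h3 : ‖Complex.exp ((2 * Real.pi * inner ℝ ξ x : ℝ) * Complex.I) - 1‖ ≤
      2 * Real.pi * ‖x‖ * (1 + ‖ξ‖) := by
    refine (norm_exp_sub_one_le _).trans ?_
    rw [abs_mul, abs_of_pos (by positivity)]
    have h4 := abs_real_inner_le_norm ξ x
    calc 2 * Real.pi * |inner ℝ ξ x| ≤ 2 * Real.pi * (‖ξ‖ * ‖x‖) := by gcongr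
      _ ≤ 2 * Real.pi * ((1 + ‖ξ‖) * ‖x‖) := by gcongr; linarith
      _ = _ := by ring
  calc _ ≤ 2 * Real.pi * ‖x‖ * (1 + ‖ξ‖) * ‖𝓕 v ξ‖ := by gcongr
    _ = 2 * Real.pi * ‖x‖ * ((1 + ‖ξ‖) * ‖𝓕 v ξ‖) := by ring
    _ ≤ 2 * Real.pi * ‖x‖ * (K * ((1 + ‖ξ‖) ^ (d + 1))⁻¹) :=
      mul_le_mul_of_nonneg_left (hdiv (h1 ξ)) (by positivity)
    _ = _ := by ring

/-! ### Mean oscillation -/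

/-- The mean itself lies within `B` of `c`, whence the factor 2. -/
theorem meanOsc_le_of_ae_norm_sub_le {D : Set (SpaceTime d)} (hD0 : volume D ≠ 0)
    (hD : volume D ≠ ⊤) {g : SpaceTime d → Val n}
    (hg : AEStronglyMeasurable g (volume.restrict D)) {c : Val n} {B : ℝ}
    (h : ∀ᵐ X ∂volume.restrict D, ‖g X - c‖ ≤ B) : meanOsc D g ≤ 2 * B := by
  have : IsFiniteMeasure (volume.restrict D) := ⟨by simpa using hD.lt_top⟩
  have : NeZero (volume.restrict D) := ⟨by simpa [Measure.restrict_eq_zero] using hD0⟩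
  have avg {F : Type} [NormedAddCommGroup F] [NormedSpace ℝ F] [CompleteSpace F]
      {f : SpaceTime d → F} {b : ℝ} (hf : ∀ᵐ X ∂volume.restrict D, ‖f X‖ ≤ b) :
      ‖⨍ X in D, f X‖ ≤ b := by
    have h1 := norm_integral_le_of_norm_le_const hf
    have h2 : 0 < (volume.restrict D).real Set.univ := by
      rw [measureReal_def, ENNReal.toReal_pos_iff]
      exact ⟨pos_iff_ne_zero.mpr (by simpa using hD0), measure_lt_top _ _⟩
    rw [average_eq, norm_smul, norm_inv, Real.norm_of_nonneg h2.le, inv_mul_le_iff₀ h2, mul_comm]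
    exact h1
  have hi : Integrable g (volume.restrict D) := by
    refine (integrable_const (‖c‖ + B)).mono' hg ?_
    filter_upwards [h] with X hX
    calc ‖g X‖ = ‖c + (g X - c)‖ := by congr 1; abel
      _ ≤ _ := (norm_add_le _ _).trans (by gcongr)
  have h1 : ‖(⨍ X in D, g X) - c‖ ≤ B := by
    have e : (⨍ X in D, g X) - c = ⨍ X in D, (g X - c) := by
      rw [average_eq, average_eq, integral_sub hi (integrable_const c), smul_sub]
      congr 1
      rw [← average_eq, average_const]
    rw [e]
    exact avg h
  refine (le_abs_self _).trans (avg (f := fun X => ‖g X - ⨍ Y in D, g Y‖) ?_)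
  filter_upwards [h] with X hX
  rw [norm_norm]
  calc ‖g X - ⨍ Y in D, g Y‖ = ‖(g X - c) - ((⨍ Y in D, g Y) - c)‖ := by congr 1; abel
    _ ≤ ‖g X - c‖ + ‖(⨍ Y in D, g Y) - c‖ := norm_sub_le _ _
    _ ≤ 2 * B := by linarith

end

end ParabolicSystem

namespace ParabolicSystem

noncomputable section

open scoped FourierTransform

variable {d n m : ℕ}

variable {A : MultiIndex d → MultiIndex d → ℝ → Matrix (Fin n) (Fin n) ℂ} {lam M δ : ℝ}
  {W : SpaceTime d → Val n} {U : Set (SpaceTime d)}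

/-! ### Solutions in the unit cylinder -/

/-- The time bump is centred at the final time 0, so the cutoff equals 1 up to the top of the
cylinder. -/
theorem exists_cutoff (d : ℕ) : ∃ ζ : SpaceTime d → ℝ, IsTestFunction (cutoffRegion d) ζ ∧
    ∀ t ∈ Set.Icc (-(1 / 2) : ℝ) 0, ∀ x ∈ Metric.ball (0 : Space d) (1 / 2), ζ (t, x) = 1 := by
  let f : ContDiffBump (0 : ℝ) := ⟨1 / 2, 3 / 4, by norm_num, by norm_num⟩
  let g : ContDiffBump (0 : Space d) := ⟨1 / 2, 3 / 4, by norm_num, by norm_num⟩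
  have hsub : tsupport (fun X : SpaceTime d => f X.1 * g X.2) ⊆
      Metric.closedBall 0 (3 / 4) ×ˢ Metric.closedBall 0 (3 / 4) := by
    refine closure_minimal (fun X hX => ?_)
      (Metric.isClosed_closedBall.prod Metric.isClosed_closedBall)
    have h1 : X.1 ∈ Function.support f := fun h => hX (by simp [h])
    have h2 : X.2 ∈ Function.support g := fun h => hX (by simp [h])
    rw [ContDiffBump.support_eq] at h1 h2
    exact ⟨Metric.ball_subset_closedBall h1, Metric.ball_subset_closedBall h2⟩
  refine ⟨fun X => f X.1 * g X.2, ⟨?_, ?_, ?_⟩, fun t ht x hx => ?_⟩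
  · exact (f.contDiff.comp contDiff_fst).mul (g.contDiff.comp contDiff_snd)
  · exact ((isCompact_closedBall (0 : ℝ) (3 / 4)).prod
      (isCompact_closedBall (0 : Space d) (3 / 4))).of_isClosed_subset (isClosed_tsupport _) hsub
  · intro X hX
    obtain ⟨h1, h2⟩ := hsub hX
    refine ⟨?_, Metric.closedBall_subset_ball (by norm_num) h2⟩
    rw [Metric.mem_closedBall, Real.dist_eq, sub_zero, abs_le] at h1
    simp only [Set.mem_Ioi]
    linarith [h1.1]
  · have h1 : f t = 1 := f.one_of_mem_closedBall (by
      rw [Metric.mem_closedBall, Real.dist_eq, sub_zero, abs_le]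
      exact ⟨ht.1, ht.2.trans (by norm_num [f])⟩)
    have h2 : g x = 1 := g.one_of_mem_closedBall (Metric.ball_subset_closedBall hx)
    simp only [h1, h2, mul_one]

theorem measurableSet_Q (m : ℕ) (r : ℝ) (X : SpaceTime d) : MeasurableSet (Q m r X) :=
  measurableSet_Ioo.prod measurableSet_ball

theorem isOpen_Q (m : ℕ) (r : ℝ) (X : SpaceTime d) : IsOpen (Q m r X) :=
  isOpen_Ioo.prod Metric.isOpen_ball

theorem volume_Q_ne_zero (m : ℕ) {r : ℝ} (hr : 0 < r) (X : SpaceTime d) : volume (Q m r X) ≠ 0 := by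
  refine ((isOpen_Q m r X).measure_pos volume ?_).ne'
  refine Set.Nonempty.prod (Set.nonempty_Ioo.mpr ?_) ⟨X.2, Metric.mem_ball_self hr⟩
  have : 0 < r ^ (2 * m) := by positivity
  linarith

theorem volume_Q_ne_top (m : ℕ) (r : ℝ) (X : SpaceTime d) : volume (Q m r X) ≠ ⊤ := by
  refine ne_top_of_le_ne_top ?_ (measure_mono (Set.prod_mono Set.Ioo_subset_Icc_self
    Metric.ball_subset_closedBall))
  exact (isCompact_Icc.prod (isCompact_closedBall _ _)).measure_lt_top.ne

theorem restrict_Q (m : ℕ) (r : ℝ) (X : SpaceTime d) :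
    (volume : Measure (SpaceTime d)).restrict (Q m r X) =
      (volume.restrict (Set.Ioo (X.1 - r ^ (2 * m)) X.1)).prod
        (volume.restrict (Metric.ball X.2 r)) :=
  (Measure.prod_restrict _ _).symm

/-- Near the origin `W = ζ W`, and the decay of the Fourier transform makes `W` Lipschitz in `x` and
Hölder in `t`. Both variations are `O(ρ)` on `Q_ρ`. -/
theorem exists_meanOsc_le_of_isLocalSolution (d n : ℕ) (hm : 1 ≤ m) (hδ : 0 < δ) :
    ∃ C : ℝ, 0 ≤ C ∧
    ∀ (A : MultiIndex d → MultiIndex d → ℝ → Matrix (Fin n) (Fin n) ℂ) (lam M : ℝ)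
      (W : SpaceTime d → Val n), IsLegendreHadamard m δ A → 0 < lam → IsLocalSolution m A lam M W →
    ∀ ρ : ℝ, 0 < ρ → ρ ≤ 1 / 8 → meanOsc (Q m ρ 0) W ≤ C * ρ * √M := by
  obtain ⟨ζ, hζ, hζ1⟩ := exists_cutoff d
  obtain ⟨C, hC, H⟩ := exists_fourier_bounds n hm hδ (d + 2) hζ
  set J := ∫ ξ : Space d, ((1 + ‖ξ‖) ^ (d + 1))⁻¹ with hJ
  have hJ0 : 0 ≤ J := integral_nonneg fun ξ => by positivity
  refine ⟨2 * ((2 * Real.pi + 1) * C * J), by positivity, fun A lam M W hA hl hW ρ hρ hρ8 => ?_⟩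
  choose P hP1 hP2 hP3 using H A lam M W hA hl hW
  have hρm : ρ ^ m ≤ ρ := pow_le_of_le_one hρ.le (by linarith) (by omega)
  have hρm0 : 0 < ρ ^ m := by positivity
  have hρ2 : ρ ^ (2 * m) ≤ ρ ^ 2 := by
    rw [mul_comm, pow_mul]; gcongr
  -- The null set of times on which the transform differs from its continuous version depends on
  -- `ξ`. Only countably many frequencies are used, and continuity in `ξ` extends the bounds to all
  -- of them.
  let e := TopologicalSpace.denseSeq (Space d)
  have he : DenseRange e := TopologicalSpace.denseRange_denseSeq _
  let v : ℝ → Space d → Val n := fun t x => (ζ (t, x) : ℂ) • W (t, x)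
  have hv (t : ℝ) : Integrable (v t) := by
    have := hW.integrable_slice 0 hζ t
    refine this.congr (.of_forall fun x => ?_)
    simp [v, wave]
  have hY (t : ℝ) (ξ : Space d) : cutoffFourier W ξ ζ t = 𝓕 (v t) ξ :=
    cutoffFourier_eq_fourier W ξ ζ t
  let good : ℝ → Prop := fun t => t ∈ Set.Ioc (-1 : ℝ) 0 ∧ ∀ i, 𝓕 (v t) (e i) = P (e i) t
  have hgood : ∀ᵐ t ∂volume.restrict (Set.Ioo (-ρ ^ (2 * m)) 0), good t := by
    rw [ae_restrict_iff' measurableSet_Ioo]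
    filter_upwards [ae_all_iff.mpr fun i => hP1 (e i)] with t ht htI
    have : t ∈ Set.Ioc (-1 : ℝ) 0 := ⟨by nlinarith [htI.1], htI.2.le⟩
    exact ⟨this, fun i => (hY t (e i)).symm.trans (ht i this)⟩
  have hb1 {t : ℝ} (ht : good t) (ξ : Space d) : (1 + ‖ξ‖) ^ (d + 2) * ‖𝓕 (v t) ξ‖ ≤ C * √M := by
    have hc := continuous_fourier (hv t)
    refine he.induction_on (p := fun ξ => (1 + ‖ξ‖) ^ (d + 2) * ‖𝓕 (v t) ξ‖ ≤ C * √M) ξ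
      (isClosed_le (by fun_prop) continuous_const) fun i => ?_
    rw [ht.2 i]
    exact hP2 (e i) t ht.1
  have hb2 {r t : ℝ} (hr : good r) (ht : good t) (hrt : |t - r| ≤ ρ ^ (2 * m)) (ξ : Space d) :
      (1 + ‖ξ‖) ^ (d + 2) * ‖𝓕 (v t) ξ - 𝓕 (v r) ξ‖ ≤ ρ * (C * √M) := by
    have hc := continuous_fourier (hv t)
    have hc' := continuous_fourier (hv r)
    -- Since `√(ρ^(2m)) = ρ^m ≤ ρ`, exponent 1/2 in time suffices for one power of `ρ`.
    have hs : √|t - r| ≤ ρ := by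
      refine (Real.sqrt_le_sqrt hrt).trans ?_
      rw [mul_comm, pow_mul, Real.sqrt_sq hρm0.le]
      exact hρm
    refine he.induction_on
      (p := fun ξ => (1 + ‖ξ‖) ^ (d + 2) * ‖𝓕 (v t) ξ - 𝓕 (v r) ξ‖ ≤ ρ * (C * √M)) ξ
      (isClosed_le (by fun_prop) continuous_const) fun i => ?_
    rw [ht.2 i, hr.2 i]
    refine le_trans ?_ (mul_le_mul_of_nonneg_right hs (by positivity))
    rcases le_total r t with h | h
    · rw [abs_of_nonneg (sub_nonneg.mpr h)]
      exact hP3 (e i) r hr.1 t ht.1 h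
    · rw [abs_sub_comm, abs_of_nonneg (sub_nonneg.mpr h), norm_sub_rev]
      exact hP3 (e i) t ht.1 r hr.1 h
  have hne : (ae (volume.restrict (Set.Ioo (-ρ ^ (2 * m)) (0 : ℝ)))).NeBot := by
    rw [ae_restrict_neBot, Real.volume_Ioo]
    simp
    positivity
  obtain ⟨t₀, ht₀, ht₀I⟩ := (hgood.and (ae_restrict_mem measurableSet_Ioo)).exists
  -- By inversion this stands for the value of `W` at `(t₀, 0)`, the reference constant for the
  -- oscillation.
  set c := ∫ ξ, 𝓕 (v t₀) ξ with hc
  have hae : ∀ᵐ X ∂volume.restrict (Q m ρ (0 : SpaceTime d)),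
      ‖W X - c‖ ≤ (2 * Real.pi + 1) * C * J * ρ * √M := by
    rw [restrict_Q, Measure.ae_prod_iff_ae_ae]
    · rw [Prod.fst_zero, Prod.snd_zero, zero_sub]
      filter_upwards [hgood, ae_restrict_mem measurableSet_Ioo] with t ht htI
      have hlt : |t - t₀| ≤ ρ ^ (2 * m) := by
        rw [abs_le]
        constructor <;> linarith [htI.1, htI.2, ht₀I.1, ht₀I.2]
      have h1 := norm_sub_integral_le (hv t) (continuous_fourier (hv t₀)).aestronglyMeasurable
        (hb1 ht) (hb2 ht₀ ht hlt)
      rw [ae_restrict_iff' measurableSet_ball]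
      filter_upwards [h1] with x hx hxb
      have hxρ : ‖x‖ ≤ ρ := by simpa using (Metric.mem_ball.mp hxb).le
      have e1 : v t x = W (t, x) := by
        have := hζ1 t ⟨by nlinarith [htI.1], htI.2.le⟩ x (Metric.ball_subset_ball (by linarith) hxb)
        simp [v, this]
      rw [e1] at hx
      refine hx.trans ?_
      calc _ ≤ (2 * Real.pi * ρ * (C * √M) + ρ * (C * √M)) * J := by gcongr
        _ = _ := by ring
    · exact measurableSet_le ((hW.stronglyMeasurable.sub stronglyMeasurable_const).norm.measurable)
        measurable_const
  refine (meanOsc_le_of_ae_norm_sub_le (volume_Q_ne_zero m hρ 0) (volume_Q_ne_top m ρ 0)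
    hW.stronglyMeasurable.aestronglyMeasurable hae).trans_eq (by ring)

end

end ParabolicSystem

/-! ### Choosing good representatives of very weak solutions. -/

namespace ParabolicSystem

noncomputable section

variable {d n m : ℕ}

variable {A : MultiIndex d → MultiIndex d → ℝ → Matrix (Fin n) (Fin n) ℂ} {lam M δ : ℝ}
  {W : SpaceTime d → Val n} {U : Set (SpaceTime d)}

theorem listDeriv_eq_zero_of_notMem {E F : Type*} [NormedAddCommGroup E] [NormedSpace ℝ E]
    [NormedAddCommGroup F] [NormedSpace ℝ F] {φ : E → F} (l : List E) {X : E} (hX : X ∉ tsupport φ) :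
    listDeriv l φ X = 0 :=
  image_eq_zero_of_notMem_tsupport fun h => hX (tsupport_listDeriv_subset l φ h)

theorem spaceDerivs_eq_zero_of_notMem {F : Type*} [NormedAddCommGroup F] [NormedSpace ℝ F]
    {φ : SpaceTime d → F} (α : MultiIndex d) {X : SpaceTime d} (hX : X ∉ tsupport φ) :
    spaceDerivs α φ X = 0 := listDeriv_eq_zero_of_notMem _ hX

theorem dirDeriv_eq_zero_of_notMem {E F : Type*} [NormedAddCommGroup E] [NormedSpace ℝ E]
    [NormedAddCommGroup F] [NormedSpace ℝ F] {φ : E → F} (v : E) {X : E} (hX : X ∉ tsupport φ) :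
    dirDeriv v φ X = 0 :=
  listDeriv_eq_zero_of_notMem [v] hX

theorem IsVeryWeakSolution.congr_ae (h : IsVeryWeakSolution m A lam U W) (hU : MeasurableSet U)
    {W' : SpaceTime d → Val n} (hWW' : ∀ᵐ X ∂volume.restrict U, W X = W' X) :
    IsVeryWeakSolution m A lam U W' := by
  intro φ hφ
  rw [← h φ hφ]
  refine integral_congr_ae ?_
  rw [ae_restrict_iff' hU] at hWW'
  filter_upwards [hWW'] with X hX
  by_cases hXU : X ∈ U
  · simp only [veryWeakIntegrand, hX hXU]
  · have hXs : X ∉ tsupport φ := fun h => hXU (hφ.supp h)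
    have hXs' (β : MultiIndex d) : X ∉ tsupport (spaceDerivs β φ) :=
      fun h => hXs (tsupport_listDeriv_subset _ _ h)
    simp only [veryWeakIntegrand, spaceDerivs_eq_zero_of_notMem _ (hXs' _),
      dirDeriv_eq_zero_of_notMem _ hXs, image_eq_zero_of_notMem_tsupport hXs, zero_smul]

theorem meanOsc_congr_ae {D : Set (SpaceTime d)} {g g' : SpaceTime d → Val n}
    (h : ∀ᵐ X ∂volume.restrict D, g X = g' X) : meanOsc D g = meanOsc D g' := by
  rw [meanOsc, meanOsc, average_congr h]
  refine average_congr ?_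
  filter_upwards [h] with X hX
  rw [hX]

theorem Q_subset (m : ℕ) {r R : ℝ} (hr : 0 ≤ r) (hR : r ≤ R) (X : SpaceTime d) :
    Q m r X ⊆ Q m R X := by
  refine Set.prod_mono (Set.Ioo_subset_Ioo_left ?_) (Metric.ball_subset_ball hR)
  have : r ^ (2 * m) ≤ R ^ (2 * m) := by gcongr
  linarith

/-- A square integrable very weak solution in `Q_1` is almost everywhere equal to a normalized one. -/
theorem exists_isLocalSolution (hW : MemLp W 2 (volume.restrict (Q m 1 (0 : SpaceTime d))))
    (hWs : IsVeryWeakSolution m A lam (Q m 1 0) W) :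
    ∃ W', IsLocalSolution m A lam
      (volume.real (Metric.ball (0 : Space d) 1) * ∫ X in Q m 1 0, ‖W X‖ ^ 2) W' ∧
      ∀ᵐ X ∂volume.restrict (Q m 1 (0 : SpaceTime d)), W X = W' X := by
  classical
  set Q₁ := Q m 1 (0 : SpaceTime d) with hQ₁
  have hQm : MeasurableSet Q₁ := measurableSet_Q m 1 0
  obtain ⟨V, hVm, hWV⟩ := hW.1
  set V₁ := Q₁.indicator V with hV₁
  have hV₁m : StronglyMeasurable V₁ := hVm.indicator hQm
  have hfin : IsFiniteMeasure (volume.restrict Q₁) := ⟨by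
    simpa using (volume_Q_ne_top m 1 (0 : SpaceTime d)).lt_top⟩
  have hV2 : MemLp V₁ 2 := by
    rw [hV₁, memLp_indicator_iff_restrict hQm]
    exact (memLp_congr_ae hWV).mp hW
  have hV1 : Integrable V₁ := by
    rw [hV₁, integrable_indicator_iff hQm]
    exact ((memLp_congr_ae hWV).mp hW).integrable one_le_two
  -- Almost every slice is integrable; setting the function to zero on the remaining times makes all
  -- of them so.
  set T := {t : ℝ | Integrable fun x => V₁ (t, x)} with hT
  have hTm : MeasurableSet T := measurableSet_integrable (f := fun t x => V₁ (t, x)) hV₁m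
  have hTae : ∀ᵐ t : ℝ, t ∈ T := hV1.prod_right_ae
  set W' := (Prod.fst ⁻¹' T).indicator V₁ with hW'
  have hW'V : W' =ᵐ[volume] V₁ := by
    have : ∀ᵐ X : SpaceTime d, X.1 ∈ T :=
      Measure.quasiMeasurePreserving_fst.ae hTae
    filter_upwards [this] with X hX
    exact Set.indicator_of_mem (s := Prod.fst ⁻¹' T) hX V₁
  have hW'm : StronglyMeasurable W' := hV₁m.indicator (measurable_fst hTm)
  have hWW' : ∀ᵐ X ∂volume.restrict Q₁, W X = W' X := by
    filter_upwards [hWV, ae_restrict_of_ae hW'V, ae_restrict_mem hQm] with X h1 h2 h3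
    rw [h1, h2]
    exact (Set.indicator_of_mem h3 V).symm
  have hslice (t : ℝ) : Integrable fun x => W' (t, x) := by
    by_cases ht : t ∈ T
    · have e : (fun x => W' (t, x)) = fun x => V₁ (t, x) := by
        funext x
        exact Set.indicator_of_mem (s := Prod.fst ⁻¹' T) (a := ((t, x) : SpaceTime d)) ht V₁
      rw [e]
      exact ht
    · have e : (fun x => W' (t, x)) = fun x => 0 := by
        funext x
        exact Set.indicator_of_notMem (s := Prod.fst ⁻¹' T) (a := ((t, x) : SpaceTime d)) ht V₁
      rw [e]
      exact integrable_zero _ _ _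
  have hW'1 : Integrable W' := hV1.congr hW'V.symm
  have hW'2 : MemLp W' 2 := (memLp_congr_ae hW'V).mpr hV2
  have hsq : Integrable fun X => ‖W' X‖ ^ 2 := hW'2.norm.integrable_sq
  have hzero (t : ℝ) (x : Space d) (hx : x ∉ Metric.ball (0 : Space d) 1) : W' (t, x) = 0 := by
    rw [hW', Set.indicator_apply]
    split_ifs
    · exact Set.indicator_of_notMem (fun h => hx h.2) V
    · rfl
  set B := volume.real (Metric.ball (0 : Space d) 1) with hB
  -- Cauchy-Schwarz on the unit ball, outside which the slices vanish, produces the ball volume in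
  -- the normalization.
  have hcs : ∀ᵐ t : ℝ, (∫ x, ‖W' (t, x)‖) ^ 2 ≤ B * ∫ x, ‖W' (t, x)‖ ^ 2 := by
    filter_upwards [hsq.prod_right_ae] with t ht
    have : IsFiniteMeasure (volume.restrict (Metric.ball (0 : Space d) 1)) := ⟨by
      simpa using measure_ball_lt_top⟩
    have hm2 : MemLp (fun x => ‖W' (t, x)‖) 2 (volume.restrict (Metric.ball (0 : Space d) 1)) := by
      have : MemLp (fun x => ‖W' (t, x)‖) 2 volume := by
        refine (memLp_two_iff_integrable_sq_norm (hslice t).norm.1).mpr ?_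
        simpa only [norm_norm] using ht
      exact this.restrict _
    have h := sq_integral_le hm2
    have s1 : ∫ x in Metric.ball (0 : Space d) 1, ‖W' (t, x)‖ = ∫ x, ‖W' (t, x)‖ :=
      setIntegral_eq_integral_of_forall_compl_eq_zero fun x hx => by rw [hzero t x hx, norm_zero]
    have s2 : ∫ x in Metric.ball (0 : Space d) 1, ‖W' (t, x)‖ ^ 2 = ∫ x, ‖W' (t, x)‖ ^ 2 :=
      setIntegral_eq_integral_of_forall_compl_eq_zero fun x hx => by
        rw [hzero t x hx, norm_zero, zero_pow two_ne_zero]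
    rw [s1, s2] at h
    simpa [hB, measureReal_def] using h
  have hsm : StronglyMeasurable fun t => ∫ x, ‖W' (t, x)‖ := hW'm.norm.integral_prod_right
  have hi2 : Integrable fun t => B * ∫ x, ‖W' (t, x)‖ ^ 2 := hsq.integral_prod_left.const_mul B
  have hi1 : Integrable fun t => (∫ x, ‖W' (t, x)‖) ^ 2 := by
    refine hi2.mono' (hsm.pow 2).aestronglyMeasurable ?_
    filter_upwards [hcs] with t ht
    rwa [Real.norm_of_nonneg (sq_nonneg _)]
  refine ⟨W', ⟨hW'm, hW'1, hslice, hWs.congr_ae hQm hWW', ?_, ?_⟩, hWW'⟩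
  · exact (memLp_two_iff_integrable_sq hsm.aestronglyMeasurable).mpr hi1
  · have h3 : ∫ t, ∫ x, ‖W' (t, x)‖ ^ 2 = ∫ X in Q₁, ‖W X‖ ^ 2 := by
      rw [← integral_prod _ hsq]
      have : ∫ X in Q₁, ‖W X‖ ^ 2 = ∫ X in Q₁, ‖W' X‖ ^ 2 := by
        refine integral_congr_ae ?_
        filter_upwards [hWW'] with X hX
        simp only [hX]
      rw [this]
      refine (setIntegral_eq_integral_of_forall_compl_eq_zero fun X hX => ?_).symm
      rw [hW', Set.indicator_apply]
      split_ifs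
      · rw [hV₁, Set.indicator_of_notMem hX, norm_zero, zero_pow two_ne_zero]
      · rw [norm_zero, zero_pow two_ne_zero]
    rw [← h3, ← integral_const_mul]
    exact integral_mono_ae hi1 hi2 hcs

theorem exists_meanOsc_le_unit (d n : ℕ) (hm : 1 ≤ m) (hδ : 0 < δ) :
    ∃ C : ℝ, 0 ≤ C ∧
    ∀ (A : MultiIndex d → MultiIndex d → ℝ → Matrix (Fin n) (Fin n) ℂ) (lam : ℝ)
      (W : SpaceTime d → Val n), IsLegendreHadamard m δ A → 0 < lam →
      MemLp W 2 (volume.restrict (Q m 1 (0 : SpaceTime d))) → IsVeryWeakSolution m A lam (Q m 1 0) W →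
    ∀ ρ : ℝ, 0 < ρ → ρ ≤ 1 / 8 →
      meanOsc (Q m ρ 0) W ≤ C * ρ * √(⨍ X in Q m 1 0, ‖W X‖ ^ 2) := by
  obtain ⟨C, hC, H⟩ := exists_meanOsc_le_of_isLocalSolution d n hm hδ
  set B := volume.real (Metric.ball (0 : Space d) 1) * volume.real (Q m 1 (0 : SpaceTime d)) with hB
  refine ⟨C * √B, by positivity, fun A lam W hA hl hW hWs ρ hρ hρ8 => ?_⟩
  obtain ⟨W', hW', hWW'⟩ := exists_isLocalSolution hW hWs
  have h1 := H A lam _ W' hA hl hW' ρ hρ hρ8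
  have hsub : Q m ρ (0 : SpaceTime d) ⊆ Q m 1 0 := Q_subset m hρ.le (by linarith) 0
  rw [meanOsc_congr_ae (ae_restrict_of_ae_restrict_of_subset hsub hWW')]
  refine h1.trans_eq ?_
  have hv : volume.real (Q m 1 (0 : SpaceTime d)) ≠ 0 := by
    rw [measureReal_def, ENNReal.toReal_ne_zero]
    exact ⟨volume_Q_ne_zero m one_pos 0, volume_Q_ne_top m 1 0⟩
  have e : volume.real (Metric.ball (0 : Space d) 1) * ∫ X in Q m 1 0, ‖W X‖ ^ 2 =
      B * ⨍ X in Q m 1 0, ‖W X‖ ^ 2 := by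
    rw [setAverage_eq, hB, smul_eq_mul]
    field_simp
  rw [e, Real.sqrt_mul (by positivity)]
  ring

end

end ParabolicSystem

namespace ParabolicSystem

noncomputable section

variable {d n m : ℕ}

variable {A : MultiIndex d → MultiIndex d → ℝ → Matrix (Fin n) (Fin n) ℂ} {lam M δ : ℝ}
  {W : SpaceTime d → Val n} {U : Set (SpaceTime d)}

/-! ### Parabolic scaling -/

/-- The affine map `(t, x) ↦ (t₀ + a t, x₀ + b x)`. -/
def scaling {a b : ℝ} (ha : a ≠ 0) (hb : b ≠ 0) (X₀ : SpaceTime d) : SpaceTime d ≃ₜ SpaceTime d :=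
  ((Homeomorph.smulOfNeZero a ha).trans (Homeomorph.addLeft X₀.1)).prodCongr
    ((Homeomorph.smulOfNeZero b hb).trans (Homeomorph.addLeft X₀.2))

theorem scaling_apply {a b : ℝ} (ha : a ≠ 0) (hb : b ≠ 0) (X₀ X : SpaceTime d) :
    scaling ha hb X₀ X = (X₀.1 + a • X.1, X₀.2 + b • X.2) := rfl

theorem hasFDerivAt_scaling {a b : ℝ} (ha : a ≠ 0) (hb : b ≠ 0) (X₀ X : SpaceTime d) :
    HasFDerivAt (scaling ha hb X₀)
      ((a • ContinuousLinearMap.id ℝ ℝ).prodMap (b • ContinuousLinearMap.id ℝ (Space d))) X := by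
  have h1 : HasFDerivAt (fun t : ℝ => X₀.1 + a • t) (a • ContinuousLinearMap.id ℝ ℝ) X.1 :=
    ((hasFDerivAt_id X.1).const_smul a).const_add _
  have h2 : HasFDerivAt (fun x : Space d => X₀.2 + b • x) (b • ContinuousLinearMap.id ℝ (Space d)) X.2 :=
    ((hasFDerivAt_id X.2).const_smul b).const_add _
  exact h1.prodMap X h2

theorem contDiff_scaling_symm {a b : ℝ} (ha : a ≠ 0) (hb : b ≠ 0) (X₀ : SpaceTime d) :
    ContDiff ℝ ∞ (scaling ha hb X₀).symm := by
  have : ((scaling ha hb X₀).symm : SpaceTime d → SpaceTime d) =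
      fun X => (a⁻¹ • (-X₀.1 + X.1), b⁻¹ • (-X₀.2 + X.2)) := rfl
  rw [this]
  fun_prop

/-- The Jacobian cancels in averages and in equations with right side zero, so only its being finite
and nonzero matters. -/
theorem exists_map_scaling {a b : ℝ} (ha : a ≠ 0) (hb : b ≠ 0) (X₀ : SpaceTime d) :
    ∃ c : ENNReal, c ≠ 0 ∧ c ≠ ⊤ ∧
      Measure.map (scaling ha hb X₀) volume = c • (volume : Measure (SpaceTime d)) := by
  have key {E : Type} [NormedAddCommGroup E] [InnerProductSpace ℝ E] [FiniteDimensional ℝ E]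
      [MeasurableSpace E] [BorelSpace E] {r : ℝ} (hr : r ≠ 0) (x₀ : E) :
      Measure.map ((Homeomorph.smulOfNeZero r hr).trans (Homeomorph.addLeft x₀)) volume =
        ENNReal.ofReal |(r ^ Module.finrank ℝ E)⁻¹| • (volume : Measure E) := by
    have e : (((Homeomorph.smulOfNeZero r hr).trans (Homeomorph.addLeft x₀) : E ≃ₜ E) : E → E) =
        (fun x => x₀ + x) ∘ (fun x => r • x) := rfl
    rw [e, ← Measure.map_map (by fun_prop) (by fun_prop)]
    rw [Measure.map_addHaar_smul volume hr, Measure.map_smul, map_add_left_eq_self]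
  refine ⟨ENNReal.ofReal |(b ^ Module.finrank ℝ (Space d))⁻¹| *
    ENNReal.ofReal |(a ^ Module.finrank ℝ ℝ)⁻¹|, ?_, by finiteness, ?_⟩
  · simp only [ne_eq, mul_eq_zero, ENNReal.ofReal_eq_zero, not_or, not_le, abs_pos, inv_eq_zero]
    exact ⟨pow_ne_zero _ hb, pow_ne_zero _ ha⟩
  · have e : ((scaling ha hb X₀ : SpaceTime d ≃ₜ SpaceTime d) : SpaceTime d → SpaceTime d) =
        Prod.map ((Homeomorph.smulOfNeZero a ha).trans (Homeomorph.addLeft X₀.1))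
          ((Homeomorph.smulOfNeZero b hb).trans (Homeomorph.addLeft X₀.2)) := rfl
    rw [e, show (volume : Measure (SpaceTime d)) = volume.prod volume from rfl,
      ← Measure.map_prod_map _ _ (Homeomorph.measurable _) (Homeomorph.measurable _), key, key,
      Measure.prod_smul_left, Measure.prod_smul_right, smul_smul, mul_comm]

theorem scaling_preimage_Q {R : ℝ} (hR : 0 < R) (X₀ : SpaceTime d) (ρ : ℝ) :
    scaling (pow_pos hR (2 * m)).ne' hR.ne' X₀ ⁻¹' Q m (R * ρ) X₀ = Q m ρ 0 := by
  ext X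
  have hR2 : 0 < R ^ (2 * m) := by positivity
  simp only [Set.mem_preimage, scaling_apply, Q, Set.mem_prod, Set.mem_Ioo, Metric.mem_ball,
    dist_eq_norm, add_sub_cancel_left, smul_eq_mul, norm_smul, Real.norm_of_nonneg hR.le, mul_pow,
    Prod.fst_zero, Prod.snd_zero, sub_zero, zero_sub]
  refine and_congr (and_congr ?_ ?_) ?_
  · rw [sub_eq_add_neg, add_lt_add_iff_left, ← mul_neg, mul_lt_mul_iff_right₀ hR2]
  · rw [add_lt_iff_neg_left, ← not_le, mul_nonneg_iff_of_pos_left hR2, not_le]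
  · rw [mul_lt_mul_iff_right₀ hR]

theorem average_scaling {F : Type*} [NormedAddCommGroup F] [NormedSpace ℝ F] {R : ℝ} (hR : 0 < R)
    (X₀ : SpaceTime d) (ρ : ℝ) (g : SpaceTime d → F) :
    ⨍ X in Q m ρ 0, g (scaling (pow_pos hR (2 * m)).ne' hR.ne' X₀ X) =
      ⨍ X in Q m (R * ρ) X₀, g X := by
  set T := scaling (pow_pos hR (2 * m)).ne' hR.ne' X₀ with hT
  obtain ⟨c, hc0, hc, h⟩ := exists_map_scaling (pow_pos hR (2 * m)).ne' hR.ne' X₀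
  have hemb : MeasurableEmbedding T := T.measurableEmbedding
  have h1 : Measure.map T (volume.restrict (Q m ρ 0)) = c • volume.restrict (Q m (R * ρ) X₀) := by
    rw [← scaling_preimage_Q hR X₀ ρ, ← hT, ← hemb.restrict_map, h, Measure.restrict_smul]
  have h2 : ∫ X in Q m ρ 0, g (T X) = c.toReal • ∫ X in Q m (R * ρ) X₀, g X := by
    rw [← hemb.integral_map, h1, integral_smul_measure]
  have h3 : volume.real (Q m ρ (0 : SpaceTime d)) = c.toReal * volume.real (Q m (R * ρ) X₀) := by
    have := congrArg (fun μ : Measure (SpaceTime d) => (μ Set.univ).toReal) h1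
    simpa [Measure.map_apply hemb.measurable, measureReal_def] using this
  rw [setAverage_eq, setAverage_eq, h2, h3, smul_smul]
  congr 1
  have : c.toReal ≠ 0 := ENNReal.toReal_ne_zero.mpr ⟨hc0, hc⟩
  rw [mul_inv]
  field_simp

theorem meanOsc_scaling {R : ℝ} (hR : 0 < R) (X₀ : SpaceTime d) (ρ : ℝ) (W : SpaceTime d → Val n) :
    meanOsc (Q m ρ 0) (fun X => W (scaling (pow_pos hR (2 * m)).ne' hR.ne' X₀ X)) =
      meanOsc (Q m (R * ρ) X₀) W := by
  rw [meanOsc, average_scaling hR X₀ ρ W]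
  exact average_scaling hR X₀ ρ fun X => ‖W X - ⨍ Y in Q m (R * ρ) X₀, W Y‖

theorem memLp_scaling {R : ℝ} (hR : 0 < R) (X₀ : SpaceTime d)
    (hW : MemLp W 2 (volume.restrict (Q m R X₀))) :
    MemLp (fun X => W (scaling (pow_pos hR (2 * m)).ne' hR.ne' X₀ X)) 2
      (volume.restrict (Q m 1 (0 : SpaceTime d))) := by
  set T := scaling (pow_pos hR (2 * m)).ne' hR.ne' X₀ with hT
  obtain ⟨c, hc0, hc, h⟩ := exists_map_scaling (pow_pos hR (2 * m)).ne' hR.ne' X₀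
  have hemb : MeasurableEmbedding T := T.measurableEmbedding
  have h1 : Measure.map T (volume.restrict (Q m 1 0)) = c • volume.restrict (Q m R X₀) := by
    have := scaling_preimage_Q (m := m) hR X₀ 1
    rw [mul_one] at this
    rw [← this, ← hT, ← hemb.restrict_map, h, Measure.restrict_smul]
  have h2 : MemLp W 2 (Measure.map T (volume.restrict (Q m 1 0))) := by
    rw [h1]
    exact hW.smul_measure hc
  exact (hemb.memLp_map_measure_iff).mp h2

theorem IsLegendreHadamard.comp_affine (hA : IsLegendreHadamard m δ A) (s a : ℝ) :
    IsLegendreHadamard m δ fun α β t => A α β (s + a • t) where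
  measurable α hα β hβ i j := (hA.measurable α hα β hβ i j).comp (by fun_prop)
  bound α hα β hβ i j t := hA.bound α hα β hβ i j _
  elliptic t ξ θ := hA.elliptic _ ξ θ

/-- One time derivative and `2m` space derivatives both scale like `R^(2m)`. With `λ` replaced by
`R^(2m) λ` the whole integrand acquires this factor. -/
theorem IsVeryWeakSolution.comp_scaling {R : ℝ} (hR : 0 < R) (X₀ : SpaceTime d)
    (h : IsVeryWeakSolution m A lam (Q m R X₀) W) :
    IsVeryWeakSolution m (fun α β t => A α β (X₀.1 + R ^ (2 * m) • t)) (R ^ (2 * m) * lam) (Q m 1 0)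
      (fun X => W (scaling (pow_pos hR (2 * m)).ne' hR.ne' X₀ X)) := by
  intro φ hφ
  set T := scaling (pow_pos hR (2 * m)).ne' hR.ne' X₀ with hT
  set L := (R ^ (2 * m) • ContinuousLinearMap.id ℝ ℝ).prodMap
    (R • ContinuousLinearMap.id ℝ (Space d)) with hL
  have hTL : ∀ X, HasFDerivAt T L X := hasFDerivAt_scaling _ _ X₀
  have hs : ContDiff ℝ ∞ (φ ∘ T.symm) := hφ.smooth.comp (contDiff_scaling_symm _ _ X₀)
  have hφ' : IsTestFunction (Q m R X₀) (φ ∘ T.symm) := by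
    refine ⟨hs, hφ.compact.comp_homeomorph T.symm, ?_⟩
    rw [tsupport_comp_eq_preimage φ T.symm]
    intro X hX
    have h1 := hφ.supp hX
    have h2 := scaling_preimage_Q (m := m) hR X₀ 1
    rw [mul_one] at h2
    rw [← h2] at h1
    simpa [hT] using h1
  have e0 : φ = fun X => (φ ∘ T.symm) (T X) := by funext X; simp
  have eL (l : List (Fin d)) {g : SpaceTime d → ℝ} (hg : ContDiff ℝ ∞ g) :
      listDeriv (l.map spaceVec) (fun X => g (T X)) =
        fun X => R ^ l.length • listDeriv (l.map spaceVec) g (T X) := by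
    rw [listDeriv_comp_affine hg hTL]
    have : (l.map spaceVec).map L = (l.map (spaceVec (d := d))).map (R • ·) := by
      simp only [List.map_map]
      refine List.map_congr_left fun i _ => ?_
      simp [hL, spaceVec]
    rw [this, listDeriv_smul_dir R hg]
    simp
  have eα (α : MultiIndex d) (hα : α ∈ ofOrder d m) {g : SpaceTime d → ℝ} (hg : ContDiff ℝ ∞ g) :
      spaceDerivs α (fun X => g (T X)) = fun X => R ^ m • spaceDerivs α g (T X) := by
    have := eL α.toList hg
    rwa [MultiIndex.length_toList, mem_ofOrder.mp hα] at this
  have et : dirDeriv timeVec φ = fun X => R ^ (2 * m) * dirDeriv timeVec (φ ∘ T.symm) (T X) := by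
    conv_lhs => rw [e0]
    rw [dirDeriv_comp_affine hs hTL]
    funext X
    have : L timeVec = R ^ (2 * m) • timeVec := by simp [hL, timeVec]
    rw [this, dirDeriv, map_smul]
    rfl
  have e2 (α β : MultiIndex d) (hα : α ∈ ofOrder d m) (hβ : β ∈ ofOrder d m) :
      spaceDerivs α (spaceDerivs β φ) =
        fun X => R ^ (2 * m) * spaceDerivs α (spaceDerivs β (φ ∘ T.symm)) (T X) := by
    conv_lhs => rw [e0]
    rw [eα β hβ hs]
    have hg : ContDiff ℝ ∞ (R ^ m • spaceDerivs β (φ ∘ T.symm)) :=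
      (contDiff_spaceDerivs hs β).const_smul (R ^ m)
    have := eα α hα hg
    refine this.trans ?_
    have e3 : spaceDerivs α (R ^ m • spaceDerivs β (φ ∘ T.symm)) =
        fun X => R ^ m • spaceDerivs α (spaceDerivs β (φ ∘ T.symm)) X :=
      spaceDerivs_clm_comp (contDiff_spaceDerivs hs β) (R ^ m • ContinuousLinearMap.id ℝ ℝ) α
    funext X
    rw [e3]
    simp only [smul_eq_mul]
    rw [two_mul, pow_add, mul_assoc]
  have key (X : SpaceTime d) : veryWeakIntegrand m (fun α β t => A α β (X₀.1 + R ^ (2 * m) • t))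
      (R ^ (2 * m) * lam) (fun X => W (T X)) φ X =
      R ^ (2 * m) • veryWeakIntegrand m A lam W (φ ∘ T.symm) (T X) := by
    have hT1 : X₀.1 + R ^ (2 * m) • X.1 = (T X).1 := rfl
    have hφT : φ X = (φ ∘ T.symm) (T X) := congrFun e0 X
    simp only [veryWeakIntegrand, et, hT1]
    rw [Finset.sum_congr rfl fun α hα => Finset.sum_congr rfl fun β hβ => by rw [e2 α β hα hβ]]
    rw [hφT]
    simp only [smul_add, Finset.smul_sum, smul_neg, mul_smul]
    congr 2
    refine Finset.sum_congr rfl fun α _ => Finset.sum_congr rfl fun β _ => ?_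
    rw [smul_comm]
  simp only [key]
  obtain ⟨c, hc0, hc, hmap⟩ := exists_map_scaling (pow_pos hR (2 * m)).ne' hR.ne' X₀
  have hemb : MeasurableEmbedding T := T.measurableEmbedding
  rw [integral_smul, ← hemb.integral_map (g := veryWeakIntegrand m A lam W (φ ∘ T.symm)), hmap,
    integral_smul_measure, h _ hφ', smul_zero, smul_zero]

/-- Homogeneous systems with coefficients depending only on time have solutions of small mean
oscillation on small cylinders. -/
theorem exists_meanOsc_le (d n : ℕ) (hm : 1 ≤ m) (hδ : 0 < δ) :
    ∃ C : ℝ, 0 ≤ C ∧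
    ∀ (A : MultiIndex d → MultiIndex d → ℝ → Matrix (Fin n) (Fin n) ℂ) (lam R : ℝ)
      (X₀ : SpaceTime d) (W : SpaceTime d → Val n), IsLegendreHadamard m δ A → 0 < lam → 0 < R →
      MemLp W 2 (volume.restrict (Q m R X₀)) → IsVeryWeakSolution m A lam (Q m R X₀) W →
    ∀ r : ℝ, 0 < r → 8 * r ≤ R →
      meanOsc (Q m r X₀) W ≤ C * (r / R) * √(⨍ X in Q m R X₀, ‖W X‖ ^ 2) := by
  obtain ⟨C, hC, H⟩ := exists_meanOsc_le_unit d n hm hδ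
  refine ⟨C, hC, fun A lam R X₀ W hA hl hR hW hWs r hr hrR => ?_⟩
  -- The rescaled zeroth-order coefficient is arbitrary, which is why the estimate in the unit
  -- cylinder has to be uniform in it.
  have h1 := H _ (R ^ (2 * m) * lam) _ (hA.comp_affine X₀.1 (R ^ (2 * m))) (by positivity)
    (memLp_scaling hR X₀ hW) (hWs.comp_scaling hR X₀) (r / R) (by positivity)
    (by rw [div_le_iff₀ hR]; linarith)
  rw [meanOsc_scaling hR, average_scaling hR X₀ 1 fun X => ‖W X‖ ^ 2, mul_one,
    mul_div_cancel₀ r hR.ne'] at h1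
  exact h1

end

end ParabolicSystem

namespace ParabolicSystem

noncomputable section

variable {d n m : ℕ}

variable {A : MultiIndex d → MultiIndex d → ℝ → Matrix (Fin n) (Fin n) ℂ} {lam M δ : ℝ}
  {W : SpaceTime d → Val n} {U : Set (SpaceTime d)}

/-! ### From weak to very weak solutions -/

theorem integrable_smul_locallyIntegrable {ψ : SpaceTime d → ℝ} (hψ : IsTestFunction U ψ)
    {g : SpaceTime d → Val n} (hg : LocallyIntegrable g) : Integrable fun X => ψ X • g X :=
  hg.integrable_smul_left_of_hasCompactSupport hψ.smooth.continuous hψ.compact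

theorem matVec_real_smul (B : Matrix (Fin n) (Fin n) ℂ) (c : ℝ) (v : Val n) :
    matVec B (c • v) = c • matVec B v := by
  rw [← Complex.coe_smul, matVec_smul, Complex.coe_smul]

theorem integral_smul_matVec_prod {B : ℝ → Matrix (Fin n) (Fin n) ℂ}
    (hB : ∀ i j, Measurable fun t => B t i j) {K : ℝ} (hK : ∀ i j t, ‖B t i j‖ ≤ K)
    (hW : LocallyIntegrable W) {ψ : SpaceTime d → ℝ} (hψ : IsTestFunction U ψ) :
    ∫ X, ψ X • matVec (B X.1) (W X) = ∫ t, matVec (B t) (∫ x, ψ (t, x) • W (t, x)) := by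
  have hi := integrable_smul_locallyIntegrable hψ (locallyIntegrable_matVec hB hK hW)
  have hi' := integrable_smul_locallyIntegrable hψ hW
  rw [show (volume : Measure (SpaceTime d)) = volume.prod volume from rfl] at hi hi' ⊢
  rw [integral_prod _ hi]
  refine integral_congr_ae ?_
  filter_upwards [hi'.prod_right_ae] with t ht
  have h := (Matrix.toEuclideanCLM (𝕜 := ℂ) (B t)).integral_comp_comm ht
  rw [matVec_eq, ← h]
  refine integral_congr_ae (.of_forall fun x => ?_)
  exact (matVec_real_smul _ _ _).symm

/-- Weak spatial derivatives commute with coefficients depending only on time. -/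
theorem integral_smul_matVec_of_weakDeriv {β : MultiIndex d} {w V : SpaceTime d → Val n} {c : ℝ}
    (hw : LocallyIntegrable w) (hV : LocallyIntegrable V)
    (H : ∀ φ : SpaceTime d → ℝ, IsTestFunction U φ →
      ∫ X, spaceDerivs β φ X • w X = c • ∫ X, φ X • V X)
    {B : ℝ → Matrix (Fin n) (Fin n) ℂ}
    (hB : ∀ i j, Measurable fun t => B t i j) {K : ℝ} (hK : ∀ i j t, ‖B t i j‖ ≤ K)
    {ψ : SpaceTime d → ℝ} (hψ : IsTestFunction U ψ) :
    ∫ X, spaceDerivs β ψ X • matVec (B X.1) (w X) = c • ∫ X, ψ X • matVec (B X.1) (V X) := by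
  have hβψ := hψ.spaceDerivs β
  rw [integral_smul_matVec_prod hB hK hw hβψ, integral_smul_matVec_prod hB hK hV hψ,
    ← integral_smul]
  have i1 := integrable_smul_locallyIntegrable hβψ hw
  have i2 := integrable_smul_locallyIntegrable hψ hV
  rw [show (volume : Measure (SpaceTime d)) = volume.prod volume from rfl] at i1 i2
  have j1 : Integrable fun t => ∫ x, spaceDerivs β ψ (t, x) • w (t, x) := i1.integral_prod_left
  have j2 : Integrable fun t => ∫ x, ψ (t, x) • V (t, x) := i2.integral_prod_left
  have j3 : Integrable fun t => c • ∫ x, ψ (t, x) • V (t, x) := j2.smul c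
  -- `B` is only measurable, so it cannot be absorbed into a test function. Testing with `η(t) ψ`
  -- for all `η` gives the derivative identity on almost every time slice, where `B t` is a constant
  -- matrix.
  have key := ae_eq_of_integral_contDiff_smul_eq j1.locallyIntegrable j3.locallyIntegrable
    fun η hη hηc => by
      have hsub : tsupport (fun X : SpaceTime d => η X.1 • ψ X) ⊆ tsupport ψ :=
        closure_mono fun X hX h => hX (by simp [h])
      have hηψ : IsTestFunction U fun X : SpaceTime d => η X.1 • ψ X :=
        ⟨(hη.comp contDiff_fst).smul hψ.smooth,
          hψ.compact.of_isClosed_subset (isClosed_tsupport _) hsub, hsub.trans hψ.supp⟩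
      have h := H _ hηψ
      have k1 := integrable_smul_locallyIntegrable (hηψ.spaceDerivs β) hw
      have k2 := integrable_smul_locallyIntegrable hηψ hV
      rw [show (volume : Measure (SpaceTime d)) = volume.prod volume from rfl] at h k1 k2
      rw [integral_prod _ k1, integral_prod _ k2] at h
      simp only [spaceDerivs_time_smul hψ.smooth hη, smul_assoc, integral_smul] at h
      rw [h, ← integral_smul]
      refine integral_congr_ae (.of_forall fun t => ?_)
      simp only
      rw [smul_comm]
  refine integral_congr_ae ?_
  filter_upwards [key] with t ht
  rw [ht, matVec_real_smul]

theorem integral_veryWeakIntegrand (hA : IsLegendreHadamard m δ A) (lam : ℝ)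
    (hW : LocallyIntegrable W) {φ : SpaceTime d → ℝ} (hφ : IsTestFunction U φ) :
    ∫ X, veryWeakIntegrand m A lam W φ X =
      -(∫ X, dirDeriv timeVec φ X • W X) +
      (∑ α ∈ ofOrder d m, ∑ β ∈ ofOrder d m,
        (-1 : ℝ) ^ m • ∫ X, spaceDerivs α (spaceDerivs β φ) X • matVec (A α β X.1) (W X)) +
      lam • ∫ X, φ X • W X := by
  have i1 := integrable_smul_locallyIntegrable (hφ.dirDeriv timeVec) hW
  have i1' : Integrable fun X => -(dirDeriv timeVec φ X • W X) := i1.neg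
  have i2 : ∀ α ∈ ofOrder d m, ∀ β ∈ ofOrder d m, Integrable fun X => (-1 : ℝ) ^ m •
      (spaceDerivs α (spaceDerivs β φ) X • matVec (A α β X.1) (W X)) := fun α hα β hβ =>
    (integrable_smul_locallyIntegrable ((hφ.spaceDerivs β).spaceDerivs α)
      (hA.locallyIntegrable_matVec hα hβ hW)).smul ((-1 : ℝ) ^ m)
  have i3 : Integrable fun X => lam • (φ X • W X) :=
    (integrable_smul_locallyIntegrable hφ hW).smul lam
  have i4 : ∀ α ∈ ofOrder d m, Integrable fun X => ∑ β ∈ ofOrder d m, (-1 : ℝ) ^ m •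
      (spaceDerivs α (spaceDerivs β φ) X • matVec (A α β X.1) (W X)) := fun α hα =>
    integrable_finsetSum _ fun β hβ => i2 α hα β hβ
  have i5 : Integrable fun X => ∑ α ∈ ofOrder d m, ∑ β ∈ ofOrder d m, (-1 : ℝ) ^ m •
      (spaceDerivs α (spaceDerivs β φ) X • matVec (A α β X.1) (W X)) :=
    integrable_finsetSum _ i4
  have i6 : Integrable fun X => -(dirDeriv timeVec φ X • W X) +
      ∑ α ∈ ofOrder d m, ∑ β ∈ ofOrder d m, (-1 : ℝ) ^ m •
      (spaceDerivs α (spaceDerivs β φ) X • matVec (A α β X.1) (W X)) := i1'.add i5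
  simp only [veryWeakIntegrand]
  rw [integral_add i6 i3, integral_add i1' i5, integral_neg, integral_smul,
    integral_finsetSum _ i4]
  congr 2
  refine Finset.sum_congr rfl fun α hα => ?_
  rw [integral_finsetSum _ (i2 α hα)]
  exact Finset.sum_congr rfl fun β _ => integral_smul _ _

/-- Weak solutions with weak derivatives `V β` are very weak solutions. -/
theorem isVeryWeakSolution_of_weak (hA : IsLegendreHadamard m δ A) {w : SpaceTime d → Val n}
    {V : MultiIndex d → SpaceTime d → Val n} (hw : LocallyIntegrable w)
    (hV : ∀ β ∈ ofOrder d m, LocallyIntegrable (V β))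
    (H : ∀ β ∈ ofOrder d m, ∀ φ : SpaceTime d → ℝ, IsTestFunction U φ →
      ∫ X, spaceDerivs β φ X • w X = (-1 : ℝ) ^ m • ∫ X, φ X • V β X)
    (hweak : ∀ φ : SpaceTime d → ℝ, IsTestFunction U φ →
      -(∫ X, dirDeriv timeVec φ X • w X) +
        (∑ α ∈ ofOrder d m, ∑ β ∈ ofOrder d m,
          ∫ X, spaceDerivs α φ X • matVec (A α β X.1) (V β X)) +
        lam • ∫ X, φ X • w X = 0) :
    IsVeryWeakSolution m A lam U w := by
  intro φ hφ
  rw [integral_veryWeakIntegrand hA lam hw hφ, ← hweak φ hφ]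
  congr 2
  refine Finset.sum_congr rfl fun α hα => Finset.sum_congr rfl fun β hβ => ?_
  rw [spaceDerivs_comm hφ.smooth, integral_smul_matVec_of_weakDeriv hw (hV β hβ) (H β hβ)
    (hA.measurable α hα β hβ) (hA.bound α hα β hβ) (hφ.spaceDerivs α), smul_smul, ← mul_pow]
  simp

/-- Derivatives of very weak solutions are very weak solutions. -/
theorem IsVeryWeakSolution.weakDeriv (hA : IsLegendreHadamard m δ A) {w V : SpaceTime d → Val n}
    (hw : LocallyIntegrable w) (hV : LocallyIntegrable V) {γ : MultiIndex d} {c : ℝ} (hc : c ≠ 0)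
    (H : ∀ φ : SpaceTime d → ℝ, IsTestFunction U φ →
      ∫ X, spaceDerivs γ φ X • w X = c • ∫ X, φ X • V X)
    (hws : IsVeryWeakSolution m A lam U w) : IsVeryWeakSolution m A lam U V := by
  intro φ hφ
  have h := hws _ (hφ.spaceDerivs γ)
  rw [integral_veryWeakIntegrand hA lam hw (hφ.spaceDerivs γ), H φ hφ,
    dirDeriv_spaceDerivs_comm hφ.smooth, H _ (hφ.dirDeriv timeVec)] at h
  have e : ∀ α ∈ ofOrder d m, ∀ β ∈ ofOrder d m,
      (-1 : ℝ) ^ m • ∫ X, spaceDerivs α (spaceDerivs β (spaceDerivs γ φ)) X •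
        matVec (A α β X.1) (w X) =
      c • ((-1 : ℝ) ^ m • ∫ X, spaceDerivs α (spaceDerivs β φ) X • matVec (A α β X.1) (V X)) := by
    intro α hα β hβ
    -- `D^γ` is brought outermost on the test function and then transferred to `w` past the
    -- coefficient.
    rw [spaceDerivs_comm hφ.smooth β γ, spaceDerivs_comm (hφ.spaceDerivs β).smooth α γ,
      integral_smul_matVec_of_weakDeriv hw hV H (hA.measurable α hα β hβ) (hA.bound α hα β hβ)
        ((hφ.spaceDerivs β).spaceDerivs α), smul_comm]
  rw [Finset.sum_congr rfl fun α hα => Finset.sum_congr rfl fun β hβ => e α hα β hβ,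
    smul_comm lam c] at h
  simp only [← Finset.smul_sum] at h
  rw [← smul_neg, ← smul_add, ← smul_add, smul_eq_zero_iff_right hc] at h
  rw [integral_veryWeakIntegrand hA lam hV hφ, ← h]
  simp only [Finset.smul_sum]

/-! ### Uniqueness of weak derivatives -/

theorem HasWeakDeriv.ae_eq {α : MultiIndex d} {u g g' : SpaceTime d → Val n}
    (h : HasWeakDeriv α u g) (h' : HasWeakDeriv α u g') : ∀ᵐ X, g X = g' X := by
  refine ae_eq_of_integral_contDiff_smul_eq h.locallyIntegrable_right h'.locallyIntegrable_right
    fun φ hφ hφc => ?_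
  have hφt : IsTestFunction Set.univ φ := ⟨hφ, hφc, Set.subset_univ _⟩
  have := (h.integral_eq φ hφt).symm.trans (h'.integral_eq φ hφt)
  exact smul_right_injective _ (pow_ne_zero _ (by norm_num)) this

/-- `weakDeriv 0 u` is a chosen representative, so it agrees with `u` only almost everywhere. -/
theorem HasWeakDeriv.ae_eq_of_zero {u g : SpaceTime d → Val n} (h : HasWeakDeriv 0 u g) :
    ∀ᵐ X, u X = g X := by
  refine ae_eq_of_integral_contDiff_smul_eq h.locallyIntegrable_left h.locallyIntegrable_right
    fun φ hφ hφc => ?_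
  have := h.integral_eq φ ⟨hφ, hφc, Set.subset_univ _⟩
  simpa [multiDeriv_eq_spaceDerivs, spaceDerivs_zero, order] using this

theorem MemL2Loc.congr_ae {g g' : SpaceTime d → Val n} (h : MemL2Loc g) (hg : ∀ᵐ X, g X = g' X) :
    MemL2Loc g' := fun K hK => (memLp_congr_ae (ae_restrict_of_ae hg)).mp (h K hK)

theorem MemL2Loc.memLp_Q {g : SpaceTime d → Val n} (h : MemL2Loc g) (m : ℕ) (r : ℝ)
    (X : SpaceTime d) : MemLp g 2 (volume.restrict (Q m r X)) :=
  (h _ (isCompact_Icc.prod (isCompact_closedBall X.2 r))).mono_measure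
    (Measure.restrict_mono (Set.prod_mono Set.Ioo_subset_Icc_self Metric.ball_subset_closedBall)
      le_rfl)

theorem MemHLoc.hasWeakDeriv {u : SpaceTime d → Val n} (hu : MemHLoc m u) {α : MultiIndex d}
    (hα : order α ≤ m) : HasWeakDeriv α u (weakDeriv α u) :=
  hasWeakDeriv_weakDeriv ((hu.space α (mem_ofOrderLE.mpr hα)).imp fun _ h => h.1)

theorem MemHLoc.memL2Loc_weakDeriv {u : SpaceTime d → Val n} (hu : MemHLoc m u) {α : MultiIndex d}
    (hα : order α ≤ m) : MemL2Loc (ParabolicSystem.weakDeriv α u) := by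
  obtain ⟨g, hg, hg2⟩ := hu.space α (mem_ofOrderLE.mpr hα)
  exact hg2.congr_ae (hg.ae_eq (hu.hasWeakDeriv hα))

theorem MemHLoc.ae_eq_weakDeriv_zero {u : SpaceTime d → Val n} (hu : MemHLoc m u) :
    ∀ᵐ X, u X = ParabolicSystem.weakDeriv 0 u X :=
  (hu.hasWeakDeriv (by simp [order])).ae_eq_of_zero

theorem MemHLoc.memL2Loc {u : SpaceTime d → Val n} (hu : MemHLoc m u) : MemL2Loc u :=
  (hu.memL2Loc_weakDeriv (α := 0) (by simp [order])).congr_ae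
    (hu.ae_eq_weakDeriv_zero.mono fun _ h => h.symm)

end

end ParabolicSystem

namespace ParabolicSystem

noncomputable section

variable {d n m : ℕ}

variable {A : MultiIndex d → MultiIndex d → ℝ → Matrix (Fin n) (Fin n) ℂ} {lam M δ : ℝ}
  {W : SpaceTime d → Val n} {U : Set (SpaceTime d)}

/-! ### Averages over cylinders -/

theorem volume_real_Q_pos (m : ℕ) {r : ℝ} (hr : 0 < r) (X : SpaceTime d) :
    0 < volume.real (Q m r X) :=
  ENNReal.toReal_pos (volume_Q_ne_zero m hr X) (volume_Q_ne_top m r X)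

theorem volume_real_Q (m : ℕ) {r : ℝ} (hr : 0 < r) (X : SpaceTime d) :
    volume.real (Q m r X) = r ^ (2 * m + d) * volume.real (Metric.ball (0 : Space d) 1) := by
  have h : volume (Q m r X) = volume (Set.Ioo (X.1 - r ^ (2 * m)) X.1) * volume (Metric.ball X.2 r) :=
    Measure.prod_prod _ _
  rw [measureReal_def, h, Real.volume_Ioo, Measure.addHaar_ball_of_pos _ _ hr, sub_sub_cancel,
    ENNReal.toReal_mul, ENNReal.toReal_mul, ENNReal.toReal_ofReal (by positivity),
    ENNReal.toReal_ofReal (by positivity), finrank_euclideanSpace_fin, pow_add, mul_assoc]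
  rfl

/-- The parabolic dimension is `2m + d`; its half is the exponent of `κ` in front of the data. -/
theorem volume_real_Q_mul (m : ℕ) {r κ : ℝ} (hr : 0 < r) (hκ : 0 < κ) (X : SpaceTime d) :
    √(volume.real (Q m (κ * r) X)) =
      κ ^ ((m : ℝ) + (d : ℝ) / 2) * √(volume.real (Q m r X)) := by
  rw [volume_real_Q m (by positivity), volume_real_Q m hr, mul_pow, mul_assoc,
    Real.sqrt_mul (by positivity), Real.sqrt_eq_rpow (κ ^ _), ← Real.rpow_natCast κ,
    ← Real.rpow_mul hκ.le]
  congr 2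
  push_cast
  ring

theorem average_mono {D : Set (SpaceTime d)} {f g : SpaceTime d → ℝ} (hf : ∀ X, 0 ≤ f X)
    (hg : IntegrableOn g D) (h : ∀ᵐ X ∂volume.restrict D, f X ≤ g X) :
    ⨍ X in D, f X ≤ ⨍ X in D, g X := by
  rw [setAverage_eq, setAverage_eq, smul_eq_mul, smul_eq_mul]
  exact mul_le_mul_of_nonneg_left (integral_mono_of_nonneg (.of_forall hf) hg h) (by positivity)

theorem average_nonneg {D : Set (SpaceTime d)} {f : SpaceTime d → ℝ} (hf : ∀ X, 0 ≤ f X) :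
    0 ≤ ⨍ X in D, f X := by
  rw [setAverage_eq, smul_eq_mul]
  exact mul_nonneg (by positivity) (integral_nonneg hf)

theorem average_norm_le_sqrt {D : Set (SpaceTime d)} (hD0 : 0 < volume.real D)
    {f : SpaceTime d → Val n} (hf : MemLp f 2 (volume.restrict D)) :
    ⨍ X in D, ‖f X‖ ≤ √(⨍ X in D, ‖f X‖ ^ 2) := by
  have : IsFiniteMeasure (volume.restrict D) := ⟨by
    simpa using (ENNReal.toReal_pos_iff.mp hD0).2⟩
  refine Real.le_sqrt_of_sq_le ?_
  have h := sq_integral_le hf.norm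
  rw [measureReal_restrict_apply_univ] at h
  rw [setAverage_eq, setAverage_eq, smul_eq_mul, smul_eq_mul, mul_pow, inv_pow, ← div_eq_inv_mul,
    div_le_iff₀ (by positivity)]
  calc _ ≤ _ := h
    _ = _ := by field_simp

theorem sqrt_average_Lp_le {D : Set (SpaceTime d)}
    (V : Lp (Val n) 2 (volume : Measure (SpaceTime d))) :
    √(⨍ X in D, ‖V X‖ ^ 2) ≤ (√(volume.real D))⁻¹ * ‖V‖ := by
  have h1 : ‖V‖ ^ 2 = ∫ X, ‖V X‖ ^ 2 := by
    conv_lhs => rw [← Lp.toLp_coeFn V (Lp.memLp V)]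
    exact norm_toLp_sq (Lp.memLp V)
  have h2 : ∫ X in D, ‖V X‖ ^ 2 ≤ ‖V‖ ^ 2 := by
    rw [h1]
    exact setIntegral_le_integral (Lp.memLp V).norm.integrable_sq (.of_forall fun _ => sq_nonneg _)
  rw [setAverage_eq, smul_eq_mul, Real.sqrt_mul (by positivity), Real.sqrt_inv]
  gcongr
  exact Real.sqrt_le_left (norm_nonneg _) |>.mpr h2

theorem sqrt_average_sub_le {D : Set (SpaceTime d)} {f g : SpaceTime d → Val n}
    (hf : MemLp f 2 (volume.restrict D)) (hg : MemLp g 2 (volume.restrict D)) :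
    √(⨍ X in D, ‖f X - g X‖ ^ 2) ≤
      2 * √(⨍ X in D, ‖f X‖ ^ 2) + 2 * √(⨍ X in D, ‖g X‖ ^ 2) := by
  have i1 : IntegrableOn (fun X => ‖f X‖ ^ 2) D := hf.norm.integrable_sq
  have i2 : IntegrableOn (fun X => ‖g X‖ ^ 2) D := hg.norm.integrable_sq
  have j1 : IntegrableOn (fun X => 2 * ‖f X‖ ^ 2) D := i1.const_mul 2
  have j2 : IntegrableOn (fun X => 2 * ‖g X‖ ^ 2) D := i2.const_mul 2
  have h1 : ⨍ X in D, ‖f X - g X‖ ^ 2 ≤ ⨍ X in D, (2 * ‖f X‖ ^ 2 + 2 * ‖g X‖ ^ 2) := by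
    refine average_mono (fun _ => sq_nonneg _) (j1.add j2) (.of_forall fun X => ?_)
    have := norm_sub_le (f X) (g X)
    nlinarith [sq_nonneg (‖f X‖ - ‖g X‖), norm_nonneg (f X - g X)]
  have h2 : ⨍ X in D, (2 * ‖f X‖ ^ 2 + 2 * ‖g X‖ ^ 2) =
      2 * (⨍ X in D, ‖f X‖ ^ 2) + 2 * ⨍ X in D, ‖g X‖ ^ 2 := by
    simp only [setAverage_eq, smul_eq_mul]
    rw [integral_add j1 j2, integral_const_mul, integral_const_mul]
    ring
  rw [h2] at h1
  have a0 : 0 ≤ ⨍ X in D, ‖f X‖ ^ 2 := average_nonneg fun _ => sq_nonneg _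
  have b0 : 0 ≤ ⨍ X in D, ‖g X‖ ^ 2 := average_nonneg fun _ => sq_nonneg _
  refine Real.sqrt_le_iff.mpr ⟨by positivity, h1.trans ?_⟩
  have h3 := Real.sq_sqrt a0
  have h4 := Real.sq_sqrt b0
  have h5 : 0 ≤ √(⨍ X in D, ‖f X‖ ^ 2) * √(⨍ X in D, ‖g X‖ ^ 2) := by positivity
  nlinarith

theorem meanOsc_le_add {D : Set (SpaceTime d)} (hD : 0 < volume.real D) {g V : SpaceTime d → Val n}
    (hg : IntegrableOn g D) (hV : IntegrableOn V D) :
    meanOsc D g ≤ meanOsc D (fun X => g X - V X) + 2 * ⨍ X in D, ‖V X‖ := by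
  have : IsFiniteMeasure (volume.restrict D) := ⟨by
    simpa using (ENNReal.toReal_pos_iff.mp hD).2⟩
  have e : ⨍ X in D, (g X - V X) = (⨍ X in D, g X) - ⨍ X in D, V X := by
    simp only [setAverage_eq]
    rw [integral_sub hg hV, smul_sub]
  have hVn : ‖⨍ X in D, V X‖ ≤ ⨍ X in D, ‖V X‖ := by
    simp only [setAverage_eq]
    rw [norm_smul, norm_inv, Real.norm_of_nonneg hD.le, smul_eq_mul]
    gcongr
    exact norm_integral_le_integral_norm _
  have i1 : IntegrableOn (fun X => ‖(g X - V X) - ⨍ Y in D, (g Y - V Y)‖) D :=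
    ((hg.sub hV).sub (integrable_const _)).norm
  have i2 : IntegrableOn (fun X => ‖V X‖) D := hV.norm
  have i3 : IntegrableOn (fun X => ‖(g X - V X) - ⨍ Y in D, (g Y - V Y)‖ + ‖V X‖) D := i1.add i2
  have i4 : IntegrableOn (fun _ => ‖⨍ Y in D, V Y‖) D := integrable_const _
  have h1 : meanOsc D g ≤ ⨍ X in D,
      (‖(g X - V X) - ⨍ Y in D, (g Y - V Y)‖ + ‖V X‖ + ‖⨍ Y in D, V Y‖) := by
    refine average_mono (fun _ => norm_nonneg _) (i3.add i4) (.of_forall fun X => ?_)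
    have e2 : g X - ⨍ Y in D, g Y =
        ((g X - V X) - ⨍ Y in D, (g Y - V Y)) + V X - ⨍ Y in D, V Y := by rw [e]; abel
    rw [e2]
    exact (norm_sub_le _ _).trans (add_le_add_left (norm_add_le _ _) _)
  have h2 : ⨍ X in D, (‖(g X - V X) - ⨍ Y in D, (g Y - V Y)‖ + ‖V X‖ + ‖⨍ Y in D, V Y‖) =
      meanOsc D (fun X => g X - V X) + (⨍ X in D, ‖V X‖) + ‖⨍ Y in D, V Y‖ := by
    rw [meanOsc]
    simp only [setAverage_eq] at i3 i4 i1 ⊢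
    rw [integral_add i3 i4, integral_add i1 i2, setIntegral_const]
    simp only [smul_eq_mul]
    field_simp
  rw [h2] at h1
  linarith

/-- The mean oscillation of the sum of a solution to the homogeneous system and an `L₂` function. -/
theorem exists_meanOsc_le_of_sub (d n : ℕ) (hm : 1 ≤ m) (hδ : 0 < δ) :
    ∃ C : ℝ, 0 ≤ C ∧
    ∀ (A : MultiIndex d → MultiIndex d → ℝ → Matrix (Fin n) (Fin n) ℂ) (lam r κ : ℝ)
      (X₀ : SpaceTime d) (g : SpaceTime d → Val n)
      (V : Lp (Val n) 2 (volume : Measure (SpaceTime d))), IsLegendreHadamard m δ A → 0 < lam →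
      0 < r → 8 ≤ κ → MemLp g 2 (volume.restrict (Q m (κ * r) X₀)) →
      IsVeryWeakSolution m A lam (Q m (κ * r) X₀) (fun X => g X - V X) →
      meanOsc (Q m r X₀) g ≤ C * κ⁻¹ * √(⨍ X in Q m (κ * r) X₀, ‖g X‖ ^ 2) +
        (C + 2) * κ ^ ((m : ℝ) + (d : ℝ) / 2) *
          ((√(volume.real (Q m (κ * r) X₀)))⁻¹ * ‖V‖) := by
  obtain ⟨C, hC, H⟩ := exists_meanOsc_le d n hm hδ
  refine ⟨C * 2, by positivity, fun A lam r κ X₀ g V hA hl hr hκ hg hs => ?_⟩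
  have hκ0 : 0 < κ := by linarith
  have hR : 0 < κ * r := by positivity
  have hVU : MemLp V 2 (volume.restrict (Q m (κ * r) X₀)) := (Lp.memLp V).restrict _
  have hVr : MemLp V 2 (volume.restrict (Q m r X₀)) := (Lp.memLp V).restrict _
  have h1 := H A lam (κ * r) X₀ _ hA hl hR (hg.sub hVU) hs r hr (by nlinarith)
  have hpos := volume_real_Q_pos (d := d) m hr X₀
  have hposU := volume_real_Q_pos (d := d) m hR X₀
  have hsub : Q m r X₀ ⊆ Q m (κ * r) X₀ := Q_subset m hr.le (by nlinarith) X₀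
  have hgr : MemLp g 2 (volume.restrict (Q m r X₀)) :=
    hg.mono_measure (Measure.restrict_mono hsub le_rfl)
  have : IsFiniteMeasure (volume.restrict (Q m r X₀)) := ⟨by
    simpa using (volume_Q_ne_top m r X₀).lt_top⟩
  have h2 := meanOsc_le_add hpos (hgr.integrable one_le_two) (hVr.integrable one_le_two)
  have h3 := (average_norm_le_sqrt hpos hVr).trans (sqrt_average_Lp_le V)
  have h4 := sqrt_average_sub_le hg hVU
  have h5 := sqrt_average_Lp_le (D := Q m (κ * r) X₀) V
  set v := (√(volume.real (Q m (κ * r) X₀)))⁻¹ * ‖V‖ with hv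
  set a := √(⨍ X in Q m (κ * r) X₀, ‖g X‖ ^ 2) with ha
  have hv0 : 0 ≤ v := by positivity
  have hκp : 1 ≤ κ ^ ((m : ℝ) + (d : ℝ) / 2) := Real.one_le_rpow (by linarith) (by positivity)
  have h6 : (√(volume.real (Q m r X₀)))⁻¹ * ‖V‖ = κ ^ ((m : ℝ) + (d : ℝ) / 2) * v := by
    rw [hv, volume_real_Q_mul m hr hκ0]
    have : √(volume.real (Q m r X₀)) ≠ 0 := (Real.sqrt_pos.mpr hpos).ne'
    have : κ ^ ((m : ℝ) + (d : ℝ) / 2) ≠ 0 := by positivity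
    field_simp
  have h7 : r / (κ * r) = κ⁻¹ := by field_simp
  rw [h6] at h3
  rw [h7] at h1
  have hκ1 : κ⁻¹ ≤ 1 := inv_le_one_of_one_le₀ (by linarith)
  have h8 : C * κ⁻¹ * √(⨍ X in Q m (κ * r) X₀, ‖g X - V X‖ ^ 2) ≤
      C * κ⁻¹ * (2 * a) + C * (2 * (κ ^ ((m : ℝ) + (d : ℝ) / 2) * v)) := by
    calc _ ≤ C * κ⁻¹ * (2 * a + 2 * v) := by
          refine mul_le_mul_of_nonneg_left (h4.trans ?_) (by positivity)
          linarith
      _ = C * κ⁻¹ * (2 * a) + C * (2 * (κ⁻¹ * v)) := by ring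
      -- In the homogeneous part the contribution of `V` carries only `κ⁻¹`, which is at most 1 and
      -- hence at most the volume factor.
      _ ≤ _ := by
        gcongr
        exact hκ1.trans hκp
  calc _ ≤ _ := h2
    _ ≤ (C * κ⁻¹ * (2 * a) + C * (2 * (κ ^ ((m : ℝ) + (d : ℝ) / 2) * v))) +
        2 * (κ ^ ((m : ℝ) + (d : ℝ) / 2) * v) := by
      gcongr
      exact h1.trans h8
    _ = _ := by ring

end

end ParabolicSystem

/-! ### Splitting off the contribution of the data. -/

namespace ParabolicSystem

noncomputable section

variable {d n m : ℕ}

variable {A : MultiIndex d → MultiIndex d → ℝ → Matrix (Fin n) (Fin n) ℂ} {lam M δ : ℝ}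
  {W : SpaceTime d → Val n} {U : Set (SpaceTime d)}

theorem MemL2Loc.locallyIntegrable {g : SpaceTime d → Val n} (h : MemL2Loc g) :
    LocallyIntegrable g :=
  locallyIntegrable_iff.mpr fun K hK => by
    have : IsFiniteMeasure (volume.restrict K) := ⟨by simpa using hK.measure_lt_top⟩
    exact (h K hK).integrable one_le_two

theorem locallyIntegrable_Lp (V : Lp (Val n) 2 (volume : Measure (SpaceTime d))) :
    LocallyIntegrable V := (Lp.memLp V).locallyIntegrable one_le_two

/-- The weak formulation, with all integrals over the whole space. -/
theorem IsWeakSolution.integral_eq (hA : IsLegendreHadamard m δ A) {u : SpaceTime d → Val n}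
    {f : MultiIndex d → SpaceTime d → Val n} (hf : ∀ α ∈ ofOrderLE d m, MemL2Loc (f α))
    (hu : MemHLoc m u) (h : IsWeakSolution m A lam f U u)
    {φ : SpaceTime d → ℝ} (hφ : IsTestFunction U φ) :
    -(∫ X, dirDeriv timeVec φ X • u X) +
      (∑ α ∈ ofOrder d m, ∑ β ∈ ofOrder d m,
        ∫ X, spaceDerivs α φ X • matVec (A α β X.1) (weakDeriv β u X)) +
      lam • ∫ X, φ X • u X =
    ∑ β ∈ ofOrderLE d m, (-1 : ℝ) ^ order β • ∫ X, spaceDerivs β φ X • f β X := by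
  have h0 := h φ hφ
  have hout {X : SpaceTime d} (hX : X ∉ U) : X ∉ tsupport φ := fun hX' => hX (hφ.supp hX')
  rw [setIntegral_eq_integral_of_forall_compl_eq_zero, setIntegral_eq_integral_of_forall_compl_eq_zero]
    at h0
  · simp only [timeDeriv_eq_dirDeriv, multiDeriv_eq_spaceDerivs, neg_smul, mul_smul] at h0
    have hu1 := hu.memL2Loc.locallyIntegrable
    have i1 : Integrable fun X => -(dirDeriv timeVec φ X • u X) :=
      (integrable_smul_locallyIntegrable (hφ.dirDeriv timeVec) hu1).neg
    have i2 : ∀ α ∈ ofOrder d m, ∀ β ∈ ofOrder d m, Integrable fun X => (-1 : ℝ) ^ (m + order α) •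
        (spaceDerivs α φ X • matVec (A α β X.1) (weakDeriv β u X)) := fun α hα β hβ =>
      (integrable_smul_locallyIntegrable (hφ.spaceDerivs α)
        (hA.locallyIntegrable_matVec hα hβ (hu.memL2Loc_weakDeriv
          (mem_ofOrder.mp hβ).le).locallyIntegrable)).smul ((-1 : ℝ) ^ (m + order α))
    have i3 : ∀ α ∈ ofOrder d m, Integrable fun X => ∑ β ∈ ofOrder d m, (-1 : ℝ) ^ (m + order α) •
        (spaceDerivs α φ X • matVec (A α β X.1) (weakDeriv β u X)) := fun α hα =>
      integrable_finsetSum _ (i2 α hα)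
    have i4 : Integrable fun X => ∑ α ∈ ofOrder d m, ∑ β ∈ ofOrder d m, (-1 : ℝ) ^ (m + order α) •
        (spaceDerivs α φ X • matVec (A α β X.1) (weakDeriv β u X)) := integrable_finsetSum _ i3
    have i5 : Integrable fun X => lam • φ X • u X :=
      (integrable_smul_locallyIntegrable hφ hu1).smul lam
    have i6 : Integrable fun X => -(dirDeriv timeVec φ X • u X) + ∑ α ∈ ofOrder d m,
        ∑ β ∈ ofOrder d m, (-1 : ℝ) ^ (m + order α) •
        (spaceDerivs α φ X • matVec (A α β X.1) (weakDeriv β u X)) := i1.add i4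
    have i7 : ∀ β ∈ ofOrderLE d m, Integrable fun X => (-1 : ℝ) ^ order β •
        (spaceDerivs β φ X • f β X) := fun β hβ =>
      (integrable_smul_locallyIntegrable (hφ.spaceDerivs β)
        (hf β hβ).locallyIntegrable).smul ((-1 : ℝ) ^ order β)
    rw [integral_add i6 i5, integral_add i1 i4, integral_neg, integral_finsetSum _ i3,
      integral_finsetSum _ i7, integral_smul] at h0
    simp only [integral_smul] at h0
    rw [← h0]
    congr 2
    refine Finset.sum_congr rfl fun α hα => ?_
    rw [integral_finsetSum _ (i2 α hα)]
    refine Finset.sum_congr rfl fun β _ => ?_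
    rw [integral_smul, mem_ofOrder.mp hα, ← two_mul, pow_mul]
    simp
  · intro X hX
    simp only [multiDeriv_eq_spaceDerivs, spaceDerivs_eq_zero_of_notMem _ (hout hX), mul_zero,
      zero_smul, Finset.sum_const_zero]
  · intro X hX
    simp only [timeDeriv_eq_dirDeriv, multiDeriv_eq_spaceDerivs,
      spaceDerivs_eq_zero_of_notMem _ (hout hX), dirDeriv_eq_zero_of_notMem _ (hout hX),
      image_eq_zero_of_notMem_tsupport (hout hX), mul_zero, neg_zero, zero_smul,
      Finset.sum_const_zero, add_zero]

theorem matVec_sub (B : Matrix (Fin n) (Fin n) ℂ) (v w : Val n) :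
    matVec B (v - w) = matVec B v - matVec B w := by
  simp only [matVec_eq, map_sub]

/-- Every weak solution differs from solutions of the homogeneous system by functions controlled by
the right-hand side. -/
theorem exists_decomposition (d n : ℕ) (hm : 1 ≤ m) (hδ : 0 < δ) :
    ∃ C : ℝ, 0 < C ∧
    ∀ (A : MultiIndex d → MultiIndex d → ℝ → Matrix (Fin n) (Fin n) ℂ) (lam R : ℝ)
      (X₀ : SpaceTime d) (f : MultiIndex d → SpaceTime d → Val n) (u : SpaceTime d → Val n),
      IsLegendreHadamard m δ A → 0 < lam → 0 < R → (∀ α ∈ ofOrderLE d m, MemL2Loc (f α)) →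
      MemHLoc m u → IsWeakSolution m A lam f (Q m R X₀) u →
    ∃ (v : Lp (Val n) 2 (volume : Measure (SpaceTime d)))
      (V : MultiIndex d → Lp (Val n) 2 (volume : Measure (SpaceTime d))),
      √lam * ((√(volume.real (Q m R X₀)))⁻¹ * ‖v‖) ≤ C * ∑ β ∈ ofOrderLE d m,
        lam ^ ((order β : ℝ) / (2 * (m : ℝ)) - (1 / 2 : ℝ)) * √(⨍ X in Q m R X₀, ‖f β X‖ ^ 2) ∧
      (∀ α ∈ ofOrder d m, (√(volume.real (Q m R X₀)))⁻¹ * ‖V α‖ ≤ C * ∑ β ∈ ofOrderLE d m,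
        lam ^ ((order β : ℝ) / (2 * (m : ℝ)) - (1 / 2 : ℝ)) * √(⨍ X in Q m R X₀, ‖f β X‖ ^ 2)) ∧
      IsVeryWeakSolution m A lam (Q m R X₀) (fun X => u X - v X) ∧
      ∀ α ∈ ofOrder d m,
        IsVeryWeakSolution m A lam (Q m R X₀) (fun X => weakDeriv α u X - V α X) := by
  classical
  obtain ⟨C, hC, H⟩ := exists_global_solution d n m hm hδ
  refine ⟨C, hC, fun A lam R X₀ f u hA hl hR hf hu hus => ?_⟩
  set U := Q m R X₀ with hU
  have hUm : MeasurableSet U := measurableSet_Q m R X₀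
  have hUpos : 0 < volume.real U := volume_real_Q_pos m hR X₀
  have hfU : ∀ β ∈ ofOrderLE d m, MemLp (U.indicator (f β)) 2 := fun β hβ =>
    (memLp_indicator_iff_restrict hUm).mpr ((hf β hβ).memLp_Q m R X₀)
  let G : MultiIndex d → Lp (Val n) 2 (volume : Measure (SpaceTime d)) := fun β =>
    if h : MemLp (U.indicator (f β)) 2 then h.toLp _ else 0
  have hG : ∀ β (hβ : β ∈ ofOrderLE d m), G β = (hfU β hβ).toLp _ := fun β hβ => dif_pos (hfU β hβ)
  obtain ⟨v, V, hv, hV, hvV, hw⟩ := H A hA lam hl G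
  have hGn : ∀ β ∈ ofOrderLE d m,
      (√(volume.real U))⁻¹ * ‖G β‖ = √(⨍ X in U, ‖f β X‖ ^ 2) := by
    intro β hβ
    have h1 : ‖G β‖ ^ 2 = ∫ X in U, ‖f β X‖ ^ 2 := by
      rw [hG β hβ, norm_toLp_sq, ← integral_indicator hUm]
      refine integral_congr_ae (.of_forall fun X => ?_)
      by_cases hX : X ∈ U
      · simp [hX]
      · simp [hX]
    rw [setAverage_eq, ← h1, smul_eq_mul, Real.sqrt_mul (by positivity), Real.sqrt_inv,
      Real.sqrt_sq (norm_nonneg _)]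
  have hGs : (√(volume.real U))⁻¹ * (C * ∑ β ∈ ofOrderLE d m,
      lam ^ ((order β : ℝ) / (2 * (m : ℝ)) - (1 / 2 : ℝ)) * ‖G β‖) =
      C * ∑ β ∈ ofOrderLE d m, lam ^ ((order β : ℝ) / (2 * (m : ℝ)) - (1 / 2 : ℝ)) *
        √(⨍ X in U, ‖f β X‖ ^ 2) := by
    rw [mul_left_comm, Finset.mul_sum]
    congr 1
    refine Finset.sum_congr rfl fun β hβ => ?_
    rw [← hGn β hβ]
    ring
  have hu1 := hu.memL2Loc.locallyIntegrable
  have hv1 := locallyIntegrable_Lp v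
  have hDu1 : ∀ β ∈ ofOrder d m, LocallyIntegrable (weakDeriv β u) := fun β hβ =>
    (hu.memL2Loc_weakDeriv (mem_ofOrder.mp hβ).le).locallyIntegrable
  have hw1 : LocallyIntegrable fun X => u X - v X := hu1.sub hv1
  have hW1 : ∀ β ∈ ofOrder d m, LocallyIntegrable fun X => weakDeriv β u X - V β X :=
    fun β hβ => (hDu1 β hβ).sub (locallyIntegrable_Lp (V β))
  have hsub {ψ : SpaceTime d → ℝ} (hψ : IsTestFunction U ψ) {g g' : SpaceTime d → Val n}
      (hg : LocallyIntegrable g) (hg' : LocallyIntegrable g') :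
      ∫ X, ψ X • (g X - g' X) = (∫ X, ψ X • g X) - ∫ X, ψ X • g' X := by
    simp only [smul_sub]
    exact integral_sub (integrable_smul_locallyIntegrable hψ hg)
      (integrable_smul_locallyIntegrable hψ hg')
  have hder : ∀ β ∈ ofOrder d m, ∀ φ : SpaceTime d → ℝ, IsTestFunction U φ →
      ∫ X, spaceDerivs β φ X • (u X - v X) =
        (-1 : ℝ) ^ m • ∫ X, φ X • (weakDeriv β u X - V β X) := by
    intro β hβ φ hφ
    have hφ' : IsTestFunction Set.univ φ := ⟨hφ.smooth, hφ.compact, Set.subset_univ _⟩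
    have h1 := (hu.hasWeakDeriv (mem_ofOrder.mp hβ).le).integral_eq φ hφ'
    rw [multiDeriv_eq_spaceDerivs, mem_ofOrder.mp hβ] at h1
    rw [hsub (hφ.spaceDerivs β) hu1 hv1, hsub hφ (hDu1 β hβ) (locallyIntegrable_Lp _), h1,
      hvV β hβ φ hφ', smul_sub]
  have hweak : ∀ φ : SpaceTime d → ℝ, IsTestFunction U φ →
      -(∫ X, dirDeriv timeVec φ X • (u X - v X)) +
        (∑ α ∈ ofOrder d m, ∑ β ∈ ofOrder d m,
          ∫ X, spaceDerivs α φ X • matVec (A α β X.1) (weakDeriv β u X - V β X)) +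
        lam • ∫ X, φ X • (u X - v X) = 0 := by
    intro φ hφ
    have hφ' : IsTestFunction Set.univ φ := ⟨hφ.smooth, hφ.compact, Set.subset_univ _⟩
    have h1 := hus.integral_eq hA hf hu hφ
    have h2 := hw φ hφ'
    -- Test functions supported in the cylinder do not see the truncation, so `u` and `v` have the
    -- same right-hand side there.
    have h3 : ∀ β ∈ ofOrderLE d m, ∫ X, spaceDerivs β φ X • G β X =
        ∫ X, spaceDerivs β φ X • f β X := by
      intro β hβ
      refine integral_congr_ae ?_
      rw [hG β hβ]
      filter_upwards [(hfU β hβ).coeFn_toLp] with X hX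
      rw [hX]
      by_cases hXU : X ∈ U
      · rw [Set.indicator_of_mem hXU]
      · rw [spaceDerivs_eq_zero_of_notMem _ fun h => hXU (hφ.supp h), zero_smul, zero_smul]
    have h5 : ∑ β ∈ ofOrderLE d m, (-1 : ℝ) ^ order β • ∫ X, spaceDerivs β φ X • G β X =
        ∑ β ∈ ofOrderLE d m, (-1 : ℝ) ^ order β • ∫ X, spaceDerivs β φ X • f β X :=
      Finset.sum_congr rfl fun β hβ => by rw [h3 β hβ]
    rw [h5, ← h1] at h2
    have h4 : ∀ α ∈ ofOrder d m, ∀ β ∈ ofOrder d m,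
        ∫ X, spaceDerivs α φ X • matVec (A α β X.1) (weakDeriv β u X - V β X) =
        (∫ X, spaceDerivs α φ X • matVec (A α β X.1) (weakDeriv β u X)) -
          ∫ X, spaceDerivs α φ X • matVec (A α β X.1) (V β X) := by
      intro α hα β hβ
      simp only [matVec_sub]
      exact hsub (hφ.spaceDerivs α) (hA.locallyIntegrable_matVec hα hβ (hDu1 β hβ))
        (hA.locallyIntegrable_matVec hα hβ (locallyIntegrable_Lp _))
    rw [hsub (hφ.dirDeriv timeVec) hu1 hv1, hsub hφ hu1 hv1,
      Finset.sum_congr rfl fun α hα => Finset.sum_congr rfl fun β hβ => h4 α hα β hβ]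
    simp only [Finset.sum_sub_distrib, smul_sub]
    rw [← sub_eq_zero] at h2
    rw [← neg_zero, ← h2]
    abel
  have hvw := isVeryWeakSolution_of_weak hA hw1 hW1 hder hweak
  refine ⟨v, V, ?_, fun α hα => ?_, hvw, fun α hα =>
    hvw.weakDeriv hA hw1 (hW1 α hα) (pow_ne_zero m (by norm_num)) (hder α hα)⟩
  · rw [← hGs, mul_left_comm]
    gcongr
  · rw [← hGs]
    gcongr
    exact hV α hα

end

end ParabolicSystem

/-! ### The mean oscillation estimate. -/

theorem theorem4p6 (d n m : ℕ) (hd : 1 ≤ d) (hn : 1 ≤ n) (hm : 1 ≤ m) (δ : ℝ) (hδ : 0 < δ) :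
    ∃ N : ℝ, 0 < N ∧
      ∀ (A : MultiIndex d → MultiIndex d → ℝ → Matrix (Fin n) (Fin n) ℂ),
        IsLegendreHadamard m δ A →
      ∀ (r κ lam : ℝ), 0 < r → 8 ≤ κ → 0 < lam →
      ∀ (X₀ : SpaceTime d) (f : MultiIndex d → SpaceTime d → Val n),
        (∀ α ∈ ofOrderLE d m, MemL2Loc (f α)) →
      ∀ u : SpaceTime d → Val n, MemHLoc m u →
        IsWeakSolution m A lam f (Q m (κ * r) X₀) u →
      ∀ α : MultiIndex d, order α = m →
        meanOsc (Q m r X₀) (weakDeriv α u) + lam ^ (1 / 2 : ℝ) * meanOsc (Q m r X₀) u ≤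
          N * κ⁻¹ * ∑ k ∈ Finset.range (m + 1),
              lam ^ ((1 / 2 : ℝ) - (k : ℝ) / (2 * (m : ℝ))) *
                (⨍ X in Q m (κ * r) X₀, sqNormDeriv k u X) ^ (1 / 2 : ℝ)
          + N * κ ^ ((m : ℝ) + (d : ℝ) / 2) * ∑ β ∈ ofOrderLE d m,
              lam ^ ((order β : ℝ) / (2 * (m : ℝ)) - (1 / 2 : ℝ)) *
                (⨍ X in Q m (κ * r) X₀, ‖f β X‖ ^ 2) ^ (1 / 2 : ℝ) := by
  obtain ⟨C, hC, H⟩ := exists_meanOsc_le_of_sub (m := m) d n hm hδ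
  obtain ⟨C', hC', H'⟩ := exists_decomposition (m := m) d n hm hδ
  -- `C` serves the homogeneous part. The data enter twice, through `D^α u` and through `√λ u`, each
  -- time with `(C + 2) C'`.
  refine ⟨C + 2 * ((C + 2) * C'), by positivity, ?_⟩
  intro A hA r κ lam hr hκ hl X₀ f hf u hu hus α hα
  have hκ0 : 0 < κ := by linarith
  have hαm : α ∈ ofOrder d m := mem_ofOrder.mpr hα
  obtain ⟨v, V, hv, hV, hvs, hVs⟩ := H' A lam (κ * r) X₀ f u hA hl (by positivity) hf hu hus
  have h1 := H A lam r κ X₀ (weakDeriv α u) (V α) hA hl hr hκ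
    ((hu.memL2Loc_weakDeriv hα.le).memLp_Q m _ X₀) (hVs α hαm)
  have h2 := H A lam r κ X₀ u v hA hl hr hκ (hu.memL2Loc.memLp_Q m _ X₀) hvs
  have h3 := hV α hαm
  simp only [← Real.sqrt_eq_rpow]
  set F := ∑ β ∈ ofOrderLE d m, lam ^ ((order β : ℝ) / (2 * (m : ℝ)) - (1 / 2 : ℝ)) *
    √(⨍ X in Q m (κ * r) X₀, ‖f β X‖ ^ 2) with hF
  set p := κ ^ ((m : ℝ) + (d : ℝ) / 2) with hp
  have hp0 : 0 < p := by positivity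
  set E : ℕ → ℝ := fun k => lam ^ ((1 / 2 : ℝ) - (k : ℝ) / (2 * (m : ℝ))) *
    √(⨍ X in Q m (κ * r) X₀, sqNormDeriv k u X) with hE
  have hE0 (k : ℕ) : 0 ≤ E k := by positivity
  have hint (k : ℕ) (hk : k ≤ m) : IntegrableOn (sqNormDeriv k u) (Q m (κ * r) X₀) :=
    integrable_finsetSum _ fun β hβ => ((hu.memL2Loc_weakDeriv
      ((mem_ofOrder.mp hβ).trans_le hk)).memLp_Q m _ X₀).norm.integrable_sq
  have hsq (k : ℕ) (hk : k ≤ m) (β : MultiIndex d) (hβ : β ∈ ofOrder d k) :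
      √(⨍ X in Q m (κ * r) X₀, ‖weakDeriv β u X‖ ^ 2) ≤
        √(⨍ X in Q m (κ * r) X₀, sqNormDeriv k u X) := by
    refine Real.sqrt_le_sqrt (average_mono (fun _ => sq_nonneg _) (hint k hk) (.of_forall fun X => ?_))
    exact Finset.single_le_sum (f := fun β => ‖weakDeriv β u X‖ ^ 2) (fun _ _ => sq_nonneg _) hβ
  have hEm : √(⨍ X in Q m (κ * r) X₀, ‖weakDeriv α u X‖ ^ 2) ≤ E m := by
    have hm0 : (m : ℝ) ≠ 0 := by positivity
    have e : (1 / 2 : ℝ) - (m : ℝ) / (2 * (m : ℝ)) = 0 := by field_simp; ring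
    simp only [hE, e, Real.rpow_zero, one_mul]
    exact hsq m le_rfl α hαm
  have hEz : √lam * √(⨍ X in Q m (κ * r) X₀, ‖u X‖ ^ 2) ≤ E 0 := by
    have e : ⨍ X in Q m (κ * r) X₀, ‖u X‖ ^ 2 = ⨍ X in Q m (κ * r) X₀, ‖weakDeriv 0 u X‖ ^ 2 := by
      refine average_congr (ae_restrict_of_ae ?_)
      filter_upwards [hu.ae_eq_weakDeriv_zero] with X hX
      rw [hX]
    rw [e]
    simp only [hE, Nat.cast_zero, zero_div, sub_zero, ← Real.sqrt_eq_rpow]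
    refine mul_le_mul_of_nonneg_left ?_ (Real.sqrt_nonneg _)
    exact hsq 0 (Nat.zero_le _) 0 (mem_ofOrder.mpr (by simp [order]))
  -- The argument only produces the terms `k = 0` and `k = m`, which are distinct since `m ≥ 1`; the
  -- others are nonnegative.
  have hsum : E m + E 0 ≤ ∑ k ∈ Finset.range (m + 1), E k := by
    rw [Finset.sum_range_succ, add_comm]
    gcongr
    exact Finset.single_le_sum (fun k _ => hE0 k) (Finset.mem_range.mpr (by omega))
  have h4 : meanOsc (Q m r X₀) (weakDeriv α u) ≤ C * κ⁻¹ * E m + (C + 2) * p * (C' * F) :=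
    h1.trans (by gcongr)
  have h5 : √lam * meanOsc (Q m r X₀) u ≤ C * κ⁻¹ * E 0 + (C + 2) * p * (C' * F) := by
    calc _ ≤ √lam * _ := mul_le_mul_of_nonneg_left h2 (Real.sqrt_nonneg _)
      _ = C * κ⁻¹ * (√lam * √(⨍ X in Q m (κ * r) X₀, ‖u X‖ ^ 2)) + (C + 2) * p *
          (√lam * ((√(volume.real (Q m (κ * r) X₀)))⁻¹ * ‖v‖)) := by ring
      _ ≤ _ := by gcongr
  have hF0 : 0 ≤ F := Finset.sum_nonneg fun β _ => by positivity
  have hS0 : 0 ≤ ∑ k ∈ Finset.range (m + 1), E k := Finset.sum_nonneg fun k _ => hE0 k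
  calc _ ≤ C * κ⁻¹ * (E m + E 0) + 2 * ((C + 2) * C') * p * F := by linarith
    _ ≤ (C + 2 * ((C + 2) * C')) * κ⁻¹ * (∑ k ∈ Finset.range (m + 1), E k) +
        (C + 2 * ((C + 2) * C')) * p * F := by
      gcongr
      · have : 0 ≤ 2 * ((C + 2) * C') := by positivity
        linarith
      · linarith
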